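/- Let $k$ be a field, let $R=\bigoplus_{n\ge 0}R_n$ be a finitely generated commutative $\mathbb N$-graded $k$-algebra with $R_0=k$, and let $M,N$ be finitely generated $\mathbb Z$-graded $R$-modules. The modules $\operatorname{Tor}_i^R(M,N)$ carry the grading induced by a graded projective resolution of $M$; each graded piece $\operatorname{Tor}_i^R(M,N)_j$ is finite-dimensional over $k$, for each $j$ it is nonzero for only finitely many $i$, and it vanishes for all $i$ when $j\ll 0$. Hence $$\chi(M,N)(t):=\sum_{i\ge 0}(-1)^i\operatorname{HS}_{\operatorname{Tor}_i^R(M,N)}(t)=\sum_{j}\Big(\sum_{i\ge 0}(-1)^i\dim_k \operatorname{Tor}_i^R(M,N)_j\Big)t^j$$ is a well-defined formal Laurent series. There is a unique rational function in $\mathbb Q(t)$, independent of the resolution, whose Laurent expansion at $t=0$ is $\chi(M,N)(t)$; let $\chi(M,N)(1)\in\mathbb Q\cup\{\infty\}$ denote its value at $t=1$, where the value is $\infty$ if there is a pole at $t=1$. Then, with $\dim$ denoting Krull dimension (and $\dim 0=-\infty$ for the zero module): (1) $\chi(M,N)(1)=\infty$ if and only if $\dim M+\dim N>\dim R$; (2)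 $\chi(M,N)(1)\in\mathbb Q_{>0}$ if and only if $\dim M+\dim N=\dim R$; (3) $\chi(M,N)(1)=0$ if and only if $\dim M+\dim N<\dim R$. -/

import Mathlib

open scoped TensorProduct

universe u v w x y

noncomputable section

namespace GradedTor

/-- `ℳ` makes the `R`-module `M` a `ℤ`-graded module over the `ℕ`-graded algebra `(R, 𝒜)`:
`M` is the internal direct sum of the `ℳ j`, and `R_i M_j ⊆ M_{i+j}`. -/
structure IsGradedModule {k : Type u} {R : Type v} [Field k] [CommRing R] [Algebra k R]
    (𝒜 : ℕ → Submodule k R) {M : Type w} [AddCommGroup M] [Module k M] [Module R M]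
    (ℳ : ℤ → Submodule k M) : Prop where
  isInternal : DirectSum.IsInternal ℳ
  smul_mem : ∀ (i : ℕ) (j : ℤ) (a : R) (m : M), a ∈ 𝒜 i → m ∈ ℳ j → a • m ∈ ℳ (i + j)

/-- The grading of a tensor product over `R` of two graded modules: the degree `j` part is spanned
by the `p ⊗ q` with `p`, `q` homogeneous of degrees adding up to `j`. -/
def tensorGrading {k : Type u} (R : Type v) [Field k] [CommRing R] [Algebra k R]
    {P : Type w} [AddCommGroup P] [Module k P] [Module R P] [IsScalarTower k R P]
    {Q : Type x} [AddCommGroup Q] [Module k Q] [Module R Q]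
    (𝒱 : ℤ → Submodule k P) (𝒲 : ℤ → Submodule k Q) (j : ℤ) : Submodule k (P ⊗[R] Q) :=
  Submodule.span k {t | ∃ a c : ℤ, a + c = j ∧ ∃ p ∈ 𝒱 a, ∃ q ∈ 𝒲 c, t = p ⊗ₜ[R] q}

/-- A graded projective resolution `⋯ → X₂ → X₁ → X₀ → M → 0` of the graded module `(M, ℳ)`:
an exact complex of graded `R`-modules and degree-preserving `R`-linear maps, in which all `X n`
are projective. -/
structure GradedResolution {k : Type u} {R : Type v} [Field k] [CommRing R] [Algebra k R]
    (𝒜 : ℕ → Submodule k R) {M : Type w} [AddCommGroup M] [Module k M] [Module R M]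
    (ℳ : ℤ → Submodule k M) where
  /-- the modules of the resolution -/
  X : ℕ → Type x
  [addCommGroup : ∀ n, AddCommGroup (X n)]
  [moduleBase : ∀ n, Module k (X n)]
  [module : ∀ n, Module R (X n)]
  [isScalarTower : ∀ n, IsScalarTower k R (X n)]
  /-- the gradings of the modules of the resolution -/
  grading : (n : ℕ) → ℤ → Submodule k (X n)
  isGradedModule : ∀ n, IsGradedModule 𝒜 (grading n)
  projective : ∀ n, Module.Projective R (X n)
  /-- the differential `X_{n+1} → X_n` -/
  d : (n : ℕ) → X (n + 1) →ₗ[R] X n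
  /-- the augmentation `X_0 → M` -/
  aug : X 0 →ₗ[R] M
  d_mem : ∀ (n : ℕ) (j : ℤ), ∀ p ∈ grading (n + 1) j, d n p ∈ grading n j
  aug_mem : ∀ (j : ℤ), ∀ p ∈ grading 0 j, aug p ∈ ℳ j
  aug_surjective : Function.Surjective aug
  exact_zero : Function.Exact (d 0) aug
  exact_succ : ∀ n, Function.Exact (d (n + 1)) (d n)

namespace GradedResolution

attribute [instance] addCommGroup moduleBase module isScalarTower

section tor

variable {k : Type u} {R : Type v} [Field k] [CommRing R] [Algebra k R]
  {𝒜 : ℕ → Submodule k R} {M : Type w} [AddCommGroup M] [Module k M] [Module R M]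
  {ℳ : ℤ → Submodule k M} (F : GradedResolution.{u, v, w, x} 𝒜 ℳ)

/-- The cycles of the complex `X ⊗_R N` in homological degree `i`. -/
def cycles (N : Type y) [AddCommGroup N] [Module R N] :
    (i : ℕ) → Submodule R (F.X i ⊗[R] N)
  | 0 => ⊤
  | i + 1 => LinearMap.ker ((F.d i).rTensor N)

/-- The boundaries of the complex `X ⊗_R N` in homological degree `i`. -/
def boundaries (N : Type y) [AddCommGroup N] [Module R N] (i : ℕ) :
    Submodule R (F.X i ⊗[R] N) :=
  LinearMap.range ((F.d i).rTensor N)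

/-- `Tor_i^R(M, N)`, computed by the resolution `F` of `M`: the homology `H_i(X ⊗_R N)`. -/
abbrev Tor (N : Type y) [AddCommGroup N] [Module R N] (i : ℕ) : Type (max x y) :=
  F.cycles N i ⧸ (F.boundaries N i).submoduleOf (F.cycles N i)

/-- The grading of `Tor_i^R(M, N)`: the degree `j` part consists of the classes of the cycles
that are homogeneous of degree `j` in `X_i ⊗_R N`. -/
def torGrading {N : Type y} [AddCommGroup N] [Module k N] [Module R N] [IsScalarTower k R N]
    (𝒩 : ℤ → Submodule k N) (i : ℕ) (j : ℤ) : Submodule k (F.Tor N i) :=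
  ((tensorGrading R (F.grading i) 𝒩 j).comap
    ((F.cycles N i).subtype.restrictScalars k)).map
      (((F.boundaries N i).submoduleOf (F.cycles N i)).mkQ.restrictScalars k)

end tor

end GradedResolution

/-! Graded resolutions exist: resolve by graded free modules on all homogeneous elements of the
successive kernels. -/

section existence

variable {k : Type u} {R : Type v} [Field k] [CommRing R] [Algebra k R]

/-- A family of `k`-subspaces indexed by `ℕ`, extended by zero to negative degrees. -/
def intGrading (𝒜 : ℕ → Submodule k R) : ℤ → Submodule k R
  | Int.ofNat n => 𝒜 n
  | Int.negSucc _ => ⊥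

/-- The grading of the free module `⨁_{b ∈ B} R(-deg b)`, in which the basis vector `e_b` has
degree `deg b`. -/
def freeGrading (𝒜 : ℕ → Submodule k R) {B : Type x} (deg : B → ℤ) (j : ℤ) :
    Submodule k (B →₀ R) where
  carrier := {f | ∀ b, f b ∈ intGrading 𝒜 (j - deg b)}
  add_mem' hf hg b := by
    rw [Finsupp.add_apply]
    exact add_mem (hf b) (hg b)
  zero_mem' b := by
    rw [Finsupp.zero_apply]
    exact zero_mem _
  smul_mem' c f hf b := by
    rw [Finsupp.smul_apply]
    exact Submodule.smul_mem _ c (hf b)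

theorem IsGradedModule.intGrading_smul_mem {𝒜 : ℕ → Submodule k R}
    {M : Type w} [AddCommGroup M] [Module k M] [Module R M] {ℳ : ℤ → Submodule k M}
    (hℳ : IsGradedModule 𝒜 ℳ) {i j : ℤ} {a : R} {m : M} (ha : a ∈ intGrading 𝒜 i)
    (hm : m ∈ ℳ j) : a • m ∈ ℳ (i + j) := by
  cases i with
  | ofNat n => exact hℳ.smul_mem n j a m ha hm
  | negSucc n =>
    have : a = 0 := by simpa [intGrading] using ha
    simp [this]

theorem intGrading_proj (𝒜 : ℕ → Submodule k R) [GradedAlgebra 𝒜] (m : ℤ) :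
    ∃ π : R →ₗ[k] R, (∀ r ∈ intGrading 𝒜 m, π r = r) ∧
      ∀ i, i ≠ m → ∀ r ∈ intGrading 𝒜 i, π r = 0 := by
  cases m with
  | ofNat n =>
    refine ⟨GradedAlgebra.proj 𝒜 n, fun r hr => ?_, fun i hi r hr => ?_⟩
    · rw [GradedAlgebra.proj_apply]
      exact DirectSum.decompose_of_mem_same 𝒜 hr
    · cases i with
      | ofNat i =>
        rw [GradedAlgebra.proj_apply]
        exact DirectSum.decompose_of_mem_ne 𝒜 hr (fun h => hi (by rw [h]))
      | negSucc i =>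
        have : r = 0 := by simpa [intGrading] using hr
        simp [this]
  | negSucc n =>
    refine ⟨0, fun r hr => ?_, fun i hi r hr => rfl⟩
    have : r = 0 := by simpa [intGrading] using hr
    simp [this]

theorem isGradedModule_freeGrading (𝒜 : ℕ → Submodule k R) [GradedAlgebra 𝒜] {B : Type x}
    (deg : B → ℤ) : IsGradedModule 𝒜 (freeGrading 𝒜 deg) := by
  classical
  refine ⟨?_, ?_⟩
  · rw [DirectSum.isInternal_submodule_iff_iSupIndep_and_iSup_eq_top]
    constructor
    · intro j
      rw [Submodule.disjoint_def]
      intro z hz hz'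
      ext b
      obtain ⟨π, h1, h2⟩ := intGrading_proj 𝒜 (j - deg b)
      have hle : (⨆ (i) (_ : i ≠ j), freeGrading 𝒜 deg i) ≤
          LinearMap.ker (π ∘ₗ Finsupp.lapply b) := by
        refine iSup₂_le fun i hi f hf => ?_
        exact h2 (i - deg b) (fun h => hi (by linarith)) _ (hf b)
      have h3 : π (z b) = 0 := hle hz'
      rw [h1 _ (hz b)] at h3
      exact h3
    · rw [eq_top_iff]
      rintro f -
      induction f using Finsupp.induction_linear with
      | zero => exact zero_mem _
      | add f g hf hg => exact add_mem hf hg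
      | single b r =>
        induction r using DirectSum.Decomposition.inductionOn 𝒜 with
        | zero => simp
        | @homogeneous i m =>
          refine Submodule.mem_iSup_of_mem ((i : ℤ) + deg b) fun c => ?_
          by_cases h : b = c
          · subst h
            rw [Finsupp.single_eq_same, add_sub_cancel_right]
            exact m.2
          · rw [Finsupp.single_eq_of_ne (Ne.symm h)]
            exact zero_mem _
        | add r s hr hs =>
          rw [Finsupp.single_add]
          exact add_mem hr hs
  · intro i j a f ha hf b
    rw [Finsupp.smul_apply, add_sub_assoc]
    have hb := hf b
    generalize j - deg b = l at hb
    cases l with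
    | ofNat n =>
      have h : a * f b ∈ 𝒜 (i + n) := SetLike.mul_mem_graded ha (show f b ∈ 𝒜 n from hb)
      exact h
    | negSucc n =>
      have : f b = 0 := by simpa [intGrading] using hb
      simp [this]

theorem mem_span_homogeneous_ker {𝒜 : ℕ → Submodule k R}
    {P : Type w} [AddCommGroup P] [Module k P] [Module R P] [IsScalarTower k R P]
    {𝒱 : ℤ → Submodule k P} (h𝒱 : IsGradedModule 𝒜 𝒱)
    {Q : Type x} [AddCommGroup Q] [Module k Q] [Module R Q] [IsScalarTower k R Q]
    {𝒲 : ℤ → Submodule k Q} (h𝒲 : IsGradedModule 𝒜 𝒲)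
    (φ : P →ₗ[R] Q) (hφ : ∀ j, ∀ p ∈ 𝒱 j, φ p ∈ 𝒲 j) (p : P) (hp : p ∈ LinearMap.ker φ) :
    p ∈ Submodule.span R {q | q ∈ LinearMap.ker φ ∧ ∃ j, q ∈ 𝒱 j} := by
  classical
  obtain ⟨z, rfl⟩ := h𝒱.isInternal.2 p
  let ψ : (j : ℤ) → 𝒱 j →+ 𝒲 j := fun j =>
    { toFun := fun q => ⟨φ q, hφ j q q.2⟩
      map_zero' := by ext; simp
      map_add' := fun a b => by ext; simp }
  have hcomm : ∀ z, DirectSum.coeAddMonoidHom 𝒲 (DirectSum.map ψ z) =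
      φ (DirectSum.coeAddMonoidHom 𝒱 z) := by
    intro z
    induction z using DirectSum.induction_on with
    | zero => simp
    | of i q => simp [ψ]
    | add a b ha hb => simp only [map_add, ha, hb]
  have hz : DirectSum.map ψ z = 0 := by
    apply h𝒲.isInternal.1
    rw [hcomm, map_zero]
    exact hp
  rw [DirectSum.coeAddMonoidHom_eq_dfinsuppSum]
  refine Submodule.sum_mem _ fun j _ => Submodule.subset_span ⟨?_, j, (z j).2⟩
  have := congrArg (fun t => ((t j : 𝒲 j) : Q)) hz
  simpa [ψ, DirectSum.map_apply] using this

/-- A graded free module with a submodule generated by homogeneous elements. -/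
structure Stage (𝒜 : ℕ → Submodule k R) where
  /-- the index set of the basis -/
  B : Type x
  /-- the degrees of the basis vectors -/
  deg : B → ℤ
  /-- the submodule -/
  K : Submodule R (B →₀ R)
  le_span : ∀ p ∈ K, p ∈ Submodule.span R {q | q ∈ K ∧ ∃ j, q ∈ freeGrading 𝒜 deg j}

theorem linearCombination_mem {𝒜 : ℕ → Submodule k R}
    {M : Type w} [AddCommGroup M] [Module k M] [Module R M] {ℳ : ℤ → Submodule k M}
    (hℳ : IsGradedModule 𝒜 ℳ) {B : Type x} (deg : B → ℤ) (g : B → M) (hg : ∀ b, g b ∈ ℳ (deg b))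
    (j : ℤ) (f : B →₀ R) (hf : f ∈ freeGrading 𝒜 deg j) :
    Finsupp.linearCombination R g f ∈ ℳ j := by
  rw [Finsupp.linearCombination_apply]
  refine Submodule.sum_mem _ fun b _ => ?_
  have := hℳ.intGrading_smul_mem (hf b) (hg b)
  rwa [sub_add_cancel] at this

/-- The index set of the basis of the next free module. -/
abbrev Stage.Next {𝒜 : ℕ → Submodule k R} (s : Stage.{u, v, max v x} 𝒜) : Type (max v x) :=
  {p : ℤ × (s.B →₀ R) // p.2 ∈ s.K ∧ p.2 ∈ freeGrading 𝒜 s.deg p.1}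

/-- The map from the next free module, onto `s.K`. -/
def Stage.map {𝒜 : ℕ → Submodule k R} (s : Stage.{u, v, max v x} 𝒜) :
    (s.Next →₀ R) →ₗ[R] (s.B →₀ R) :=
  Finsupp.linearCombination R fun p => p.1.2

theorem Stage.map_mem {𝒜 : ℕ → Submodule k R} [GradedAlgebra 𝒜] (s : Stage.{u, v, max v x} 𝒜)
    (j : ℤ) (f : s.Next →₀ R) (hf : f ∈ freeGrading 𝒜 (fun p : s.Next => p.1.1) j) :
    s.map f ∈ freeGrading 𝒜 s.deg j :=
  linearCombination_mem (isGradedModule_freeGrading 𝒜 s.deg) _ _ (fun p => p.2.2) j f hf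

theorem Stage.range_map {𝒜 : ℕ → Submodule k R} (s : Stage.{u, v, max v x} 𝒜) :
    LinearMap.range s.map = s.K := by
  rw [Stage.map, Finsupp.range_linearCombination]
  apply le_antisymm
  · rw [Submodule.span_le]
    rintro _ ⟨p, rfl⟩
    exact p.2.1
  · intro p hp
    refine Submodule.span_mono ?_ (s.le_span p hp)
    rintro q ⟨hq, j, hj⟩
    exact ⟨⟨(j, q), hq, hj⟩, rfl⟩

/-- The next stage: the kernel of `s.map`. -/
def Stage.next {𝒜 : ℕ → Submodule k R} [GradedAlgebra 𝒜] (s : Stage.{u, v, max v x} 𝒜) :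
    Stage.{u, v, max v x} 𝒜 where
  B := s.Next
  deg p := p.1.1
  K := LinearMap.ker s.map
  le_span := mem_span_homogeneous_ker (isGradedModule_freeGrading 𝒜 _)
    (isGradedModule_freeGrading 𝒜 s.deg) s.map s.map_mem

theorem nonempty_gradedResolution (𝒜 : ℕ → Submodule k R) [GradedAlgebra 𝒜]
    {M : Type w} [AddCommGroup M] [Module k M] [Module R M] [IsScalarTower k R M]
    (ℳ : ℤ → Submodule k M) (hℳ : IsGradedModule 𝒜 ℳ) :
    Nonempty (GradedResolution.{u, v, w, max v w} 𝒜 ℳ) := by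
  classical
  let B₀ : Type (max v w) := ULift.{v} {p : ℤ × M // p.2 ∈ ℳ p.1}
  let deg₀ : B₀ → ℤ := fun p => p.down.1.1
  let aug : (B₀ →₀ R) →ₗ[R] M := Finsupp.linearCombination R fun p => p.down.1.2
  have haug : ∀ j, ∀ f ∈ freeGrading 𝒜 deg₀ j, aug f ∈ ℳ j := fun j f hf =>
    linearCombination_mem hℳ deg₀ _ (fun p => p.down.2) j f hf
  let s₀ : Stage.{u, v, max v w} 𝒜 :=
    { B := B₀
      deg := deg₀
      K := LinearMap.ker aug
      le_span := mem_span_homogeneous_ker (isGradedModule_freeGrading 𝒜 _) hℳ aug haug }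
  let s : ℕ → Stage.{u, v, max v w} 𝒜 := fun n => Nat.rec s₀ (fun _ t => t.next) n
  exact ⟨{
    X := fun n => (s n).B →₀ R
    grading := fun n => freeGrading 𝒜 (s n).deg
    isGradedModule := fun n => isGradedModule_freeGrading 𝒜 _
    projective := fun n => inferInstance
    d := fun n => (s n).map
    aug := aug
    d_mem := fun n j f hf => (s n).map_mem j f hf
    aug_mem := haug
    aug_surjective := by
      rw [← LinearMap.range_eq_top, Finsupp.range_linearCombination, eq_top_iff]
      rintro m -
      obtain ⟨z, rfl⟩ := hℳ.isInternal.2 m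
      rw [DirectSum.coeAddMonoidHom_eq_dfinsuppSum]
      exact Submodule.sum_mem _ fun j _ =>
        Submodule.subset_span ⟨⟨⟨(j, (z j : M)), (z j).2⟩⟩, rfl⟩
    exact_zero := by
      intro y
      change y ∈ LinearMap.ker aug ↔ y ∈ LinearMap.range s₀.map
      rw [s₀.range_map]
    exact_succ := fun n => by
      intro y
      change y ∈ LinearMap.ker (s n).map ↔ y ∈ LinearMap.range (s n).next.map
      rw [(s n).next.range_map]
      rfl }⟩

end existence

/-- The `j`-th coefficient of the Hilbert series of a graded vector space. -/
def hilbertCoeff {k : Type u} [Field k] {V : Type v} [AddCommGroup V] [Module k V]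
    (𝒱 : ℤ → Submodule k V) (j : ℤ) : ℤ :=
  (Module.finrank k (𝒱 j) : ℤ)

/-- The `j`-th coefficient of `χ(M, N)(t) = ∑_i (-1)^i HS_{Tor_i(M, N)}(t)`. -/
def chiCoeff {k : Type u} {R : Type v} [Field k] [CommRing R] [Algebra k R]
    {𝒜 : ℕ → Submodule k R} {M : Type w} [AddCommGroup M] [Module k M] [Module R M]
    {ℳ : ℤ → Submodule k M} (F : GradedResolution.{u, v, w, x} 𝒜 ℳ)
    {N : Type y} [AddCommGroup N] [Module k N] [Module R N] [IsScalarTower k R N]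
    (𝒩 : ℤ → Submodule k N) (j : ℤ) : ℤ :=
  ∑ᶠ i : ℕ, (-1) ^ i * hilbertCoeff (F.torGrading 𝒩 i) j

/-- The Laurent series `∑_j c_j t^j` is the expansion at `t = 0` of the rational function `f`. -/
def IsExpansion (f : RatFunc ℚ) (c : ℤ → ℤ) : Prop :=
  ∀ j : ℤ, (f : LaurentSeries ℚ).coeff j = (c j : ℚ)

open Classical in
/-- The value at `t = 1` of a rational function, in `ℚ ∪ {∞}`; it is `∞` at a pole.
(`f.num` and `f.denom` are coprime.) -/
def valueAtOne (f : RatFunc ℚ) : OnePoint ℚ :=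
  if f.denom.eval 1 = 0 then OnePoint.infty
  else ((f.num.eval 1 / f.denom.eval 1 : ℚ) : OnePoint ℚ)

end GradedTor

end

/-!
The theorem rests on the identity `HS_R(t) χ(M, N)(t) = HS_M(t) HS_N(t)` of Laurent series
(`hilbertSeries_mul_chiSeries`), together with the fact that the Hilbert series of a nonzero
finitely generated graded module `M` is a rational function with a pole of order exactly `dim M` at
`t = 1` and a positive leading coefficient there (`hilbertSeries_pole`). Granting these, for nonzero
`M` and `N` the series `χ(M, N)(t)` is `(1 - t) ^ (dim R - dim M - dim N)` times a rational function
that is defined and positive at `1`, and its value at `1` is `∞`, positive or zero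
according to the sign of the exponent (`exists_ratFunc`).

The identity is proved by dimension shifting in the second variable. A module `N` that vanishes
below degree `c` is covered by a finite graded free module `G` whose kernel `K` vanishes below
degree `c + 1` (`exists_free_cover`). As the terms of the resolution of `M` are flat, the long exact
sequence (`torGrading_step`) gives `χ(M, N) + χ(M, K) = χ(M, G)`, and `χ(M, G) = HS_M HS_G / HS_R`
because `Tor_i(M, G) = 0` for `i > 0`. Hence `HS_R χ(M, N) - HS_M HS_N` changes its sign when `N` is
replaced by `K`. It vanishes below a degree that goes up by one in each step, so it is zero. The
same induction shows that `Tor_i(M, N)_j` is finite-dimensional, and zero for `j` smaller than `i`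
plus the sum of the initial degrees of `M` and `N` (`torGrading_finite_and_eq_bot`). Working in the
second variable leaves the given resolution of `M` untouched, so the argument applies to every
resolution.

For the pole, the Hilbert–Serre theorem (`exists_hilbertSerre`) gives rationality and bounds the
possible poles, and Noether normalization of `R / Ann M` (`exists_normalization`) makes `M` a finite
and faithful module over a polynomial ring in `s = dim M` variables. The normalization need not be
homogeneous: counting monomials already shows that `∑_{j ≤ n} dim M_j` is bounded above and, along
an arithmetic progression, below by positive multiples of `n ^ s` (`exists_sum_finrank_le`,
`exists_le_sum_finrank`). So `∑ₙ (∑_{j ≤ n} dim M_j) t ^ n` lies between positive multiples of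
`(1 - t) ^ (-(s + 1))` as `t` tends to `1` from below, which fixes the order of the pole and the sign
of the leading coefficient (`pole_of_growth`).
-/

noncomputable section

namespace GradedTor

/-! ### Homogeneous components -/

section components

variable {k : Type u} [Field k] {M : Type w} [AddCommGroup M] [Module k M]
  {ℳ : ℤ → Submodule k M}

@[elab_as_elim]
theorem induction_homogeneous (h : DirectSum.IsInternal ℳ) {C : M → Prop}
    (hom : ∀ j, ∀ x ∈ ℳ j, C x) (add : ∀ x y, C x → C y → C (x + y)) (m : M) : C m := by
  have hm : m ∈ ⨆ j, ℳ j := by rw [h.submodule_iSup_eq_top]; trivial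
  exact Submodule.iSup_induction ℳ (motive := C) hm hom (hom 0 0 (zero_mem _)) add

/-- The projection of an internally graded vector space onto its part of degree `j`. -/
def gcomp (h : DirectSum.IsInternal ℳ) (j : ℤ) : M →ₗ[k] M :=
  (ℳ j).subtype ∘ₗ DirectSum.component k ℤ (fun i => ℳ i) j ∘ₗ
    (LinearEquiv.ofBijective (DirectSum.coeLinearMap ℳ) h).symm.toLinearMap

variable (h : DirectSum.IsInternal ℳ)

theorem gcomp_mem (j : ℤ) (x : M) : gcomp h j x ∈ ℳ j := Subtype.property _

theorem gcomp_same {j : ℤ} {x : M} (hx : x ∈ ℳ j) : gcomp h j x = x :=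
  congrArg Subtype.val (h.ofBijective_coeLinearMap_of_mem hx)

theorem gcomp_of_ne {i j : ℤ} (hij : i ≠ j) {x : M} (hx : x ∈ ℳ i) : gcomp h j x = 0 :=
  congrArg Subtype.val (h.ofBijective_coeLinearMap_of_mem_ne hij hx)

/-- A subspace containing all homogeneous components of `x` contains `x`. -/
theorem mem_of_gcomp_mem {W : Submodule k M} {x : M} (hx : ∀ j, gcomp h j x ∈ W) : x ∈ W := by
  classical
  obtain ⟨z, rfl⟩ := (LinearEquiv.ofBijective (DirectSum.coeLinearMap ℳ) h).surjective x
  have hz : ∀ j, (z j : M) ∈ W := fun j => by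
    have := hx j
    rw [gcomp, LinearMap.comp_apply, LinearMap.comp_apply, LinearEquiv.coe_coe,
      LinearEquiv.symm_apply_apply] at this
    exact this
  change DirectSum.coeLinearMap ℳ z ∈ W
  rw [DirectSum.coeLinearMap_eq_dfinsuppSum]
  exact Submodule.sum_mem _ fun j _ => hz j

theorem eq_zero_of_gcomp {x : M} (hx : ∀ j, gcomp h j x = 0) : x = 0 := by
  simpa using mem_of_gcomp_mem h (W := ⊥) (x := x) (by simpa using hx)

/-- A family of complementary projections exhibits a direct sum decomposition. -/
theorem isInternal_of_proj (π : ℤ → M →ₗ[k] M) (h1 : ∀ j, ∀ x ∈ ℳ j, π j x = x)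
    (h2 : ∀ i j, i ≠ j → ∀ x ∈ ℳ i, π j x = 0) (h3 : ∀ x, x ∈ ⨆ j, ℳ j) :
    DirectSum.IsInternal ℳ := by
  classical
  rw [DirectSum.isInternal_submodule_iff_iSupIndep_and_iSup_eq_top]
  refine ⟨fun j => ?_, eq_top_iff.2 fun x _ => h3 x⟩
  rw [Submodule.disjoint_def]
  intro z hz hz'
  have hle : (⨆ (i) (_ : i ≠ j), ℳ i) ≤ LinearMap.ker (π j) :=
    iSup₂_le fun i hi f hf => h2 i j hi f hf
  rw [← h1 j z hz]
  exact hle hz'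

end components

section maps

variable {k : Type u} [Field k] {P : Type w} [AddCommGroup P] [Module k P]
  {𝒱 : ℤ → Submodule k P} (h : DirectSum.IsInternal 𝒱)
  {Q : Type x} [AddCommGroup Q] [Module k Q] {𝒲 : ℤ → Submodule k Q}
  (h' : DirectSum.IsInternal 𝒲)

theorem gcomp_map {d : ℤ} (φ : P →ₗ[k] Q) (hφ : ∀ j, ∀ p ∈ 𝒱 j, φ p ∈ 𝒲 (d + j)) (j : ℤ) (p : P) :
    gcomp h' (d + j) (φ p) = φ (gcomp h j p) := by
  induction p using induction_homogeneous h with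
  | hom i x hx =>
    by_cases hij : i = j
    · subst hij
      rw [gcomp_same h hx, gcomp_same h' (hφ _ _ hx)]
    · rw [gcomp_of_ne h hij hx, gcomp_of_ne h' (by simpa using hij) (hφ _ _ hx), map_zero]
  | add x y hx hy => simp only [map_add, hx, hy]

theorem gcomp_map_zero (φ : P →ₗ[k] Q) (hφ : ∀ j, ∀ p ∈ 𝒱 j, φ p ∈ 𝒲 j) (j : ℤ) (p : P) :
    gcomp h' j (φ p) = φ (gcomp h j p) := by
  have := gcomp_map h h' (d := 0) φ (by simpa using hφ) j p
  rwa [zero_add] at this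

include h h' in
/-- A homogeneous element in the image of a graded map is the image of an element of the same
degree. -/
theorem exists_homogeneous_preimage (φ : P →ₗ[k] Q) (hφ : ∀ j, ∀ p ∈ 𝒱 j, φ p ∈ 𝒲 j) {j : ℤ}
    {q : Q} (hq : q ∈ 𝒲 j) (hr : q ∈ LinearMap.range φ) : ∃ p ∈ 𝒱 j, φ p = q := by
  obtain ⟨p, rfl⟩ := hr
  exact ⟨gcomp h j p, gcomp_mem h j p, by rw [← gcomp_map_zero h h' φ hφ, gcomp_same h' hq]⟩

end maps

section modules

variable {k : Type u} {R : Type v} [Field k] [CommRing R] [Algebra k R]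
  {𝒜 : ℕ → Submodule k R}
  {M : Type w} [AddCommGroup M] [Module k M] [Module R M] [IsScalarTower k R M]
  {ℳ : ℤ → Submodule k M}

theorem IsGradedModule.gcomp_smul (hℳ : IsGradedModule 𝒜 ℳ) {i : ℕ} {a : R} (ha : a ∈ 𝒜 i)
    (j : ℤ) (m : M) :
    gcomp hℳ.isInternal (i + j) (a • m) = a • gcomp hℳ.isInternal j m :=
  gcomp_map hℳ.isInternal hℳ.isInternal
    ((LinearMap.lsmul R M a).restrictScalars k) (fun j p hp => hℳ.smul_mem i j a p ha hp) j m

/-- The grading induced on a submodule. -/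
abbrev subGrading (ℳ : ℤ → Submodule k M) (K : Submodule R M) (j : ℤ) : Submodule k K :=
  (ℳ j).comap (K.subtype.restrictScalars k)

/-- The grading induced on a quotient module. -/
abbrev quotGrading (ℳ : ℤ → Submodule k M) (K : Submodule R M) (j : ℤ) : Submodule k (M ⧸ K) :=
  (ℳ j).map (K.mkQ.restrictScalars k)

theorem isGradedModule_subGrading (hℳ : IsGradedModule 𝒜 ℳ) (K : Submodule R M)
    (hK : ∀ j, ∀ m ∈ K, gcomp hℳ.isInternal j m ∈ K) :
    IsGradedModule 𝒜 (subGrading ℳ K) := by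
  refine ⟨?_, fun i j a m ha hm => hℳ.smul_mem i j a m ha hm⟩
  refine isInternal_of_proj
    (fun j => ((gcomp hℳ.isInternal j).restrict (p := K.restrictScalars k)
      (q := K.restrictScalars k) (hK j)))
    (fun j x hx => ?_) (fun i j hij x hx => ?_) (fun x => ?_)
  · exact Subtype.ext (gcomp_same _ hx)
  · exact Subtype.ext (gcomp_of_ne _ hij hx)
  · have hx : (x : M) ∈ (⨆ j, subGrading ℳ K j).map (K.subtype.restrictScalars k) := by
      refine mem_of_gcomp_mem hℳ.isInternal fun j => ?_
      refine ⟨⟨gcomp hℳ.isInternal j x, hK j x x.2⟩, ?_, rfl⟩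
      exact Submodule.mem_iSup_of_mem j (gcomp_mem hℳ.isInternal j x)
    obtain ⟨y, hy, hyx⟩ := hx
    have : y = x := Subtype.ext hyx
    exact this ▸ hy

theorem isGradedModule_quotGrading (hℳ : IsGradedModule 𝒜 ℳ) (K : Submodule R M)
    (hK : ∀ j, ∀ m ∈ K, gcomp hℳ.isInternal j m ∈ K) :
    IsGradedModule 𝒜 (quotGrading ℳ K) := by
  constructor
  · refine isInternal_of_proj
      (fun j => Submodule.mapQ (K.restrictScalars k) (K.restrictScalars k)
        (gcomp hℳ.isInternal j) (hK j)) ?_ ?_ fun x => ?_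
    · rintro j _ ⟨m, hm, rfl⟩
      exact congrArg K.mkQ (gcomp_same hℳ.isInternal hm)
    · rintro i j hij _ ⟨m, hm, rfl⟩
      exact (congrArg K.mkQ (gcomp_of_ne hℳ.isInternal hij hm)).trans (map_zero _)
    · obtain ⟨m, rfl⟩ := K.mkQ_surjective x
      have : m ∈ (⨆ j, quotGrading ℳ K j).comap (K.mkQ.restrictScalars k) :=
        mem_of_gcomp_mem hℳ.isInternal fun j =>
          Submodule.mem_iSup_of_mem j ⟨_, gcomp_mem hℳ.isInternal j m, rfl⟩
      exact this
  · rintro i j a _ ha ⟨m, hm, rfl⟩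
    exact ⟨a • m, hℳ.smul_mem i j a m ha hm, rfl⟩

theorem isGradedModule_intGrading (𝒜 : ℕ → Submodule k R) [GradedAlgebra 𝒜] :
    IsGradedModule 𝒜 (intGrading 𝒜) := by
  constructor
  · choose π h1 h2 using intGrading_proj 𝒜
    refine isInternal_of_proj π h1 (fun i j hij => h2 j i hij) fun r => ?_
    induction r using DirectSum.Decomposition.inductionOn 𝒜 with
    | zero => exact zero_mem _
    | @homogeneous i m => exact Submodule.mem_iSup_of_mem (i : ℤ) m.2
    | add r s hr hs => exact add_mem hr hs
  · intro i j a m ha hm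
    cases j with
    | ofNat n =>
      have h : a * m ∈ 𝒜 (i + n) := SetLike.mul_mem_graded ha (show m ∈ 𝒜 n from hm)
      exact h
    | negSucc n =>
      have : m = 0 := by simpa [intGrading] using hm
      simp [this]

/-- A finitely generated graded module has finitely many homogeneous generators. -/
theorem exists_homogeneous_generators (hℳ : IsGradedModule 𝒜 ℳ) [Module.Finite R M] :
    ∃ (r : ℕ) (g : Fin r → M) (deg : Fin r → ℤ), (∀ l, g l ∈ ℳ (deg l)) ∧
      Submodule.span R (Set.range g) = ⊤ := by
  classical
  have hspan : Submodule.span R {m | ∃ j, m ∈ ℳ j} = ⊤ := by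
    rw [eq_top_iff]
    rintro m -
    exact mem_of_gcomp_mem hℳ.isInternal
      (W := (Submodule.span R {m | ∃ j, m ∈ ℳ j}).restrictScalars k)
      fun j => Submodule.subset_span ⟨j, gcomp_mem hℳ.isInternal j m⟩
  obtain ⟨t, hts, ht⟩ := (Submodule.fg_span_iff_fg_span_finset_subset _).1
    (hspan.symm ▸ Module.Finite.fg_top : (Submodule.span R {m | ∃ j, m ∈ ℳ j}).FG)
  have hdeg : ∀ l : Fin t.card, ∃ j, (t.equivFin.symm l : M) ∈ ℳ j := fun l =>
    hts (t.equivFin.symm l).2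
  choose deg hdeg using hdeg
  refine ⟨t.card, fun l => t.equivFin.symm l, deg, hdeg, ?_⟩
  rw [← hspan, ht]
  congr 1
  ext m
  constructor
  · rintro ⟨l, rfl⟩
    exact (t.equivFin.symm l).2
  · intro hm
    exact ⟨t.equivFin ⟨m, hm⟩, by simp⟩

end modules

/-! ### The grading of a tensor product -/

section tensor

variable {k : Type u} {R : Type v} [Field k] [CommRing R] [Algebra k R]
  {𝒜 : ℕ → Submodule k R} [GradedAlgebra 𝒜]
  {P : Type w} [AddCommGroup P] [Module k P] [Module R P] [IsScalarTower k R P]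
  {𝒱 : ℤ → Submodule k P}
  {Q : Type x} [AddCommGroup Q] [Module k Q] [Module R Q] [IsScalarTower k R Q]
  {𝒲 : ℤ → Submodule k Q}

omit [IsScalarTower k R Q] in
theorem tmul_mem_tensorGrading {a c : ℤ} {p : P} (hp : p ∈ 𝒱 a) {q : Q} (hq : q ∈ 𝒲 c) :
    p ⊗ₜ[R] q ∈ tensorGrading R 𝒱 𝒲 (a + c) :=
  Submodule.subset_span ⟨a, c, rfl, p, hp, q, hq, rfl⟩

/-- The biadditive map `(p, q) ↦ ∑ₐ pₐ ⊗ q_{j-a}`. -/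
def tensorProjAux (R : Type v) [CommRing R] [Module R P] [Module R Q]
    (h : DirectSum.IsInternal 𝒱) (h' : DirectSum.IsInternal 𝒲) (j : ℤ) :
    P →+ Q →+ P ⊗[R] Q :=
  (DirectSum.toAddMonoid fun a =>
    AddMonoidHom.mk' (fun p : 𝒱 a => ((TensorProduct.mk R P Q p).toAddMonoidHom.comp
      (gcomp h' (j - a)).toAddMonoidHom)) (fun p q => by
        ext z; simp)).comp
  (LinearEquiv.ofBijective (DirectSum.coeLinearMap 𝒱) h).symm.toLinearMap.toAddMonoidHom

omit [Algebra k R] [IsScalarTower k R P] [IsScalarTower k R Q] in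
theorem tensorProjAux_of_mem (h : DirectSum.IsInternal 𝒱) (h' : DirectSum.IsInternal 𝒲) (j : ℤ)
    {a : ℤ} {p : P} (hp : p ∈ 𝒱 a) (q : Q) :
    tensorProjAux R h h' j p q = p ⊗ₜ[R] gcomp h' (j - a) q := by
  have : (LinearEquiv.ofBijective (DirectSum.coeLinearMap 𝒱) h).symm p =
      DirectSum.of (fun i => 𝒱 i) a ⟨p, hp⟩ := by
    rw [LinearEquiv.symm_apply_eq]
    exact (DirectSum.coeLinearMap_of 𝒱 a ⟨p, hp⟩).symm
  simp [tensorProjAux, this]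

omit [IsScalarTower k R P] in
theorem tensorProjAux_balanced (h𝒱 : IsGradedModule 𝒜 𝒱) (h𝒲 : IsGradedModule 𝒜 𝒲) (j : ℤ)
    (r : R) (p : P) (q : Q) :
    tensorProjAux R h𝒱.isInternal h𝒲.isInternal j (r • p) q =
      tensorProjAux R h𝒱.isInternal h𝒲.isInternal j p (r • q) := by
  induction r using DirectSum.Decomposition.inductionOn 𝒜 with
  | zero => simp
  | @homogeneous i m =>
    induction p using induction_homogeneous h𝒱.isInternal with
    | hom a x hx =>
      have h1 := h𝒲.gcomp_smul m.2 (j - (i + a)) q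
      rw [show (i : ℤ) + (j - (i + a)) = j - a by ring] at h1
      rw [tensorProjAux_of_mem _ _ _ (h𝒱.smul_mem i a m x m.2 hx),
        tensorProjAux_of_mem _ _ _ hx, h1, TensorProduct.smul_tmul]
    | add x y hx hy => simp only [smul_add, map_add, AddMonoidHom.add_apply, hx, hy]
  | add r s hr hs => simp only [add_smul, map_add, AddMonoidHom.add_apply, hr, hs]

/-- The projection of the tensor product of two graded modules onto its part of degree `j`. -/
def tensorProj (h𝒱 : IsGradedModule 𝒜 𝒱) (h𝒲 : IsGradedModule 𝒜 𝒲) (j : ℤ) :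
    P ⊗[R] Q →+ P ⊗[R] Q :=
  TensorProduct.liftAddHom (tensorProjAux R h𝒱.isInternal h𝒲.isInternal j)
    (tensorProjAux_balanced h𝒱 h𝒲 j)

omit [IsScalarTower k R P] in
theorem tensorProj_tmul (h𝒱 : IsGradedModule 𝒜 𝒱) (h𝒲 : IsGradedModule 𝒜 𝒲) (j : ℤ)
    {a : ℤ} {p : P} (hp : p ∈ 𝒱 a) (q : Q) :
    tensorProj h𝒱 h𝒲 j (p ⊗ₜ q) = p ⊗ₜ[R] gcomp h𝒲.isInternal (j - a) q :=
  tensorProjAux_of_mem h𝒱.isInternal h𝒲.isInternal j hp q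

theorem tensorProj_smul (h𝒱 : IsGradedModule 𝒜 𝒱) (h𝒲 : IsGradedModule 𝒜 𝒲) (j : ℤ)
    (c : k) (t : P ⊗[R] Q) : tensorProj h𝒱 h𝒲 j (c • t) = c • tensorProj h𝒱 h𝒲 j t := by
  induction t with
  | zero => simp
  | add s t hs ht => simp only [smul_add, map_add, hs, ht]
  | tmul p q =>
    induction p using induction_homogeneous h𝒱.isInternal with
    | hom a x hx =>
      rw [TensorProduct.smul_tmul', tensorProj_tmul _ _ _ (Submodule.smul_mem _ c hx),
        tensorProj_tmul _ _ _ hx, TensorProduct.smul_tmul']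
    | add x y hx hy => simp only [TensorProduct.add_tmul, smul_add, map_add, hx, hy]

theorem isInternal_tensorGrading (h𝒱 : IsGradedModule 𝒜 𝒱) (h𝒲 : IsGradedModule 𝒜 𝒲) :
    DirectSum.IsInternal (tensorGrading R 𝒱 𝒲) := by
  let π : ℤ → P ⊗[R] Q →ₗ[k] P ⊗[R] Q := fun j =>
    { toFun := tensorProj h𝒱 h𝒲 j
      map_add' := map_add _
      map_smul' := tensorProj_smul h𝒱 h𝒲 j }
  have hπ : ∀ j a c, ∀ p ∈ 𝒱 a, ∀ q ∈ 𝒲 c,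
      π j (p ⊗ₜ q) = p ⊗ₜ[R] gcomp h𝒲.isInternal (j - a) q := fun j a c p hp q hq =>
    tensorProj_tmul h𝒱 h𝒲 j hp q
  refine isInternal_of_proj π (fun j x hx => ?_) (fun i j hij x hx => ?_) fun x => ?_
  · induction hx using Submodule.span_induction with
    | mem t ht =>
      obtain ⟨a, c, hac, p, hp, q, hq, rfl⟩ := ht
      rw [hπ j a c p hp q hq, gcomp_same]
      rwa [show j - a = c by omega]
    | zero => simp
    | add s t _ _ hs ht => rw [map_add, hs, ht]
    | smul c t _ ht => rw [map_smul, ht]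
  · induction hx using Submodule.span_induction with
    | mem t ht =>
      obtain ⟨a, c, hac, p, hp, q, hq, rfl⟩ := ht
      rw [hπ j a c p hp q hq, gcomp_of_ne _ (i := c) (by omega) hq, TensorProduct.tmul_zero]
    | zero => simp
    | add s t _ _ hs ht => rw [map_add, hs, ht, add_zero]
    | smul c t _ ht => rw [map_smul, ht, smul_zero]
  · induction x with
    | zero => exact zero_mem _
    | add s t hs ht => exact add_mem hs ht
    | tmul p q =>
      induction p using induction_homogeneous h𝒱.isInternal with
      | hom a p hp =>
        induction q using induction_homogeneous h𝒲.isInternal with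
        | hom c q hq => exact Submodule.mem_iSup_of_mem _ (tmul_mem_tensorGrading hp hq)
        | add x y hx hy => rw [TensorProduct.tmul_add]; exact add_mem hx hy
      | add x y hx hy => rw [TensorProduct.add_tmul]; exact add_mem hx hy

omit [IsScalarTower k R Q] in
theorem map_mem_tensorGrading {P' : Type*} [AddCommGroup P'] [Module k P'] [Module R P']
    [IsScalarTower k R P'] {𝒱' : ℤ → Submodule k P'} (φ : P →ₗ[R] P')
    (hφ : ∀ j, ∀ p ∈ 𝒱 j, φ p ∈ 𝒱' j)
    {Q' : Type*} [AddCommGroup Q'] [Module k Q'] [Module R Q'] [IsScalarTower k R Q']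
    {𝒲' : ℤ → Submodule k Q'} (ψ : Q →ₗ[R] Q') (hψ : ∀ j, ∀ q ∈ 𝒲 j, ψ q ∈ 𝒲' j) (j : ℤ)
    (t : P ⊗[R] Q) (ht : t ∈ tensorGrading R 𝒱 𝒲 j) :
    TensorProduct.map φ ψ t ∈ tensorGrading R 𝒱' 𝒲' j := by
  induction ht using Submodule.span_induction with
  | mem t ht =>
    obtain ⟨a, c, rfl, p, hp, q, hq, rfl⟩ := ht
    exact tmul_mem_tensorGrading (hφ a p hp) (hψ c q hq)
  | zero => rw [map_zero]; exact zero_mem _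
  | add s t _ _ hs ht => rw [map_add]; exact add_mem hs ht
  | smul c t _ ht =>
    have : TensorProduct.map φ ψ (c • t) = c • TensorProduct.map φ ψ t := by
      rw [← algebraMap_smul R c t, map_smul, algebraMap_smul]
    rw [this]
    exact Submodule.smul_mem _ c ht

omit [IsScalarTower k R Q] in
theorem lTensor_mem_tensorGrading {Q' : Type*} [AddCommGroup Q'] [Module k Q'] [Module R Q']
    [IsScalarTower k R Q']
    {𝒲' : ℤ → Submodule k Q'} (ψ : Q →ₗ[R] Q') (hψ : ∀ j, ∀ q ∈ 𝒲 j, ψ q ∈ 𝒲' j) (j : ℤ)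
    (t : P ⊗[R] Q) (ht : t ∈ tensorGrading R 𝒱 𝒲 j) :
    ψ.lTensor P t ∈ tensorGrading R 𝒱 𝒲' j :=
  map_mem_tensorGrading LinearMap.id (fun _ _ hp => hp) ψ hψ j t ht

theorem rTensor_mem_tensorGrading {P' : Type*} [AddCommGroup P'] [Module k P'] [Module R P']
    [IsScalarTower k R P'] {𝒱' : ℤ → Submodule k P'} (φ : P →ₗ[R] P')
    (hφ : ∀ j, ∀ p ∈ 𝒱 j, φ p ∈ 𝒱' j) (j : ℤ)
    (t : P ⊗[R] Q) (ht : t ∈ tensorGrading R 𝒱 𝒲 j) :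
    φ.rTensor Q t ∈ tensorGrading R 𝒱' 𝒲 j :=
  map_mem_tensorGrading φ hφ LinearMap.id (fun _ _ hp => hp) j t ht

end tensor

/-! ### Krull dimension and Noether normalization -/

section normalization

/-- An injective integral extension preserves the Krull dimension: chains of primes lift by lying
over and going up, and contract to chains by incomparability. -/
theorem ringKrullDim_eq_of_isIntegral {A : Type*} {B : Type*} [CommRing A] [CommRing B]
    [Algebra A B] [Algebra.IsIntegral A B] [FaithfulSMul A B] :
    ringKrullDim A = ringKrullDim B := by
  apply le_antisymm
  · rw [ringKrullDim, Order.krullDim]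
    refine iSup_le fun l => ?_
    have hp : l.head.asIdeal.IsPrime := l.head.2
    obtain ⟨Q, -, hQ, hQl⟩ := Ideal.exists_ideal_over_prime_of_isIntegral (S := B) l.head.asIdeal ⊥
      (by
        rw [Ideal.comap_bot_of_injective _ (FaithfulSMul.algebraMap_injective A B)]
        exact bot_le)
    have hlo : Q.LiesOver l.head.asIdeal := ⟨hQl.symm⟩
    obtain ⟨L, hL, -⟩ := Ideal.exists_ltSeries_of_hasGoingUp l Q
    rw [← hL]
    exact Order.LTSeries.length_le_krullDim L
  · refine Order.krullDim_le_of_strictMono (PrimeSpectrum.comap (algebraMap A B)) fun P Q h => ?_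
    have hP : P.asIdeal.IsPrime := P.2
    exact Ideal.IsIntegral.comap_lt_comap (show P.asIdeal < Q.asIdeal from h)

/-- Noether normalization for the support of a module: `M` is finite and faithful over a polynomial
ring in `dim M` variables, which acts through a homomorphism to `R`. -/
theorem exists_normalization (k : Type u) {R : Type v} [Field k] [CommRing R] [Algebra k R]
    [Algebra.FiniteType k R] (M : Type w) [AddCommGroup M] [Module R M]
    [Module.Finite R M] [Nontrivial M] :
    ∃ (s : ℕ) (φ : MvPolynomial (Fin s) k →ₐ[k] R),
      Module.supportDim R M = s ∧
      (∀ a, (∀ m : M, φ a • m = 0) → a = 0) ∧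
      ∃ (q : ℕ) (g : Fin q → M), ∀ m, ∃ c : Fin q → MvPolynomial (Fin s) k,
        m = ∑ l, φ (c l) • g l := by
  set I := Module.annihilator R M with hI
  have hne : Nontrivial (R ⧸ I) := Ideal.Quotient.nontrivial_iff.2 fun h => by
    have h1 : (1 : R) ∈ I := h ▸ Submodule.mem_top
    obtain ⟨m, hm⟩ := exists_ne (0 : M)
    exact hm (by simpa using Module.mem_annihilator.1 h1 m)
  have : Algebra.FiniteType k (R ⧸ I) := inferInstance
  obtain ⟨s, g, hg, hfin⟩ := exists_finite_inj_algHom_of_fg k (R ⧸ I)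
  choose z hz using fun i : Fin s => Ideal.Quotient.mk_surjective (g (MvPolynomial.X i))
  let φ : MvPolynomial (Fin s) k →ₐ[k] R := MvPolynomial.aeval z
  have hφ : ∀ a, Ideal.Quotient.mk I (φ a) = g a := by
    have : (Ideal.Quotient.mkₐ k I).comp φ = g := by
      apply MvPolynomial.algHom_ext
      intro i
      simp [φ, hz]
    exact fun a => DFunLike.congr_fun this a
  refine ⟨s, φ, ?_, ?_, ?_⟩
  · rw [Module.supportDim_eq_ringKrullDim_quotient_annihilator, ← hI]
    let : Algebra (MvPolynomial (Fin s) k) (R ⧸ I) := g.toRingHom.toAlgebra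
    have : Module.Finite (MvPolynomial (Fin s) k) (R ⧸ I) := hfin
    have : FaithfulSMul (MvPolynomial (Fin s) k) (R ⧸ I) :=
      (faithfulSMul_iff_algebraMap_injective _ _).2 hg
    rw [← ringKrullDim_eq_of_isIntegral (A := MvPolynomial (Fin s) k),
      MvPolynomial.ringKrullDim_of_isNoetherianRing, ringKrullDim_eq_zero_of_field]
    simp
  · intro a ha
    apply hg
    rw [map_zero, ← hφ, Ideal.Quotient.eq_zero_iff_mem, hI, Module.mem_annihilator]
    exact ha
  · let : Algebra (MvPolynomial (Fin s) k) (R ⧸ I) := g.toRingHom.toAlgebra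
    have h1 : Module.Finite (MvPolynomial (Fin s) k) (R ⧸ I) := hfin
    let : Module (R ⧸ I) M := Module.quotientAnnihilator
    let : Module (MvPolynomial (Fin s) k) M := Module.compHom M φ.toRingHom
    have : IsScalarTower R (R ⧸ I) M := ⟨fun r x m => by
      obtain ⟨x, rfl⟩ := Ideal.Quotient.mk_surjective x
      exact mul_smul r x m⟩
    have : IsScalarTower (MvPolynomial (Fin s) k) (R ⧸ I) M := ⟨fun r x m => by
      rw [Algebra.smul_def, mul_smul]
      change g r • x • m = φ r • x • m
      rw [← hφ]
      rfl⟩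
    have h2 : Module.Finite (R ⧸ I) M := Module.Finite.of_restrictScalars_finite R (R ⧸ I) M
    have h3 : Module.Finite (MvPolynomial (Fin s) k) M := Module.Finite.trans (R ⧸ I) M
    obtain ⟨q, g', hg'⟩ := Module.Finite.exists_fin (R := MvPolynomial (Fin s) k) (M := M)
    refine ⟨q, g', fun m => ?_⟩
    obtain ⟨c, hc⟩ := (Submodule.mem_span_range_iff_exists_fun _).1
      (hg' ▸ Submodule.mem_top : m ∈ Submodule.span (MvPolynomial (Fin s) k) (Set.range g'))
    exact ⟨c, hc.symm⟩

end normalization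

/-- A finitely generated graded algebra with `R₀ = k` is generated by finitely many homogeneous
elements of positive degree. -/
theorem exists_positive_generators {k : Type u} {R : Type v} [Field k] [CommRing R] [Algebra k R]
    [Algebra.FiniteType k R] (𝒜 : ℕ → Submodule k R) [GradedAlgebra 𝒜] (h𝒜 : 𝒜 0 = 1) :
    ∃ S : Finset R, Algebra.adjoin k (S : Set R) = ⊤ ∧ ∀ x ∈ S, ∃ n ≠ 0, x ∈ 𝒜 n := by
  have : Algebra.FiniteType (𝒜 0) R := by
    have : IsScalarTower k (𝒜 0) R := ⟨fun c a r => smul_mul_assoc c (a : R) r⟩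
    exact Algebra.FiniteType.of_restrictScalars_finiteType k (𝒜 0) R
  obtain ⟨S, hS, hS'⟩ := GradedAlgebra.exists_finset_adjoin_eq_top_and_homogeneous_ne_zero 𝒜
  refine ⟨S, ?_, hS'⟩
  rw [eq_top_iff]
  intro x _
  have hx : x ∈ Algebra.adjoin (𝒜 0) (S : Set R) := hS ▸ Algebra.mem_top
  induction hx using Algebra.adjoin_induction with
  | mem x hx => exact Algebra.subset_adjoin hx
  | algebraMap r =>
    have hr : (r : R) ∈ (1 : Submodule k R) := h𝒜 ▸ r.2
    obtain ⟨c, hc⟩ := Submodule.mem_one.1 hr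
    change (r : R) ∈ _
    rw [← hc]
    exact Subalgebra.algebraMap_mem _ c
  | add x y _ _ hx hy => exact add_mem (hx trivial) (hy trivial)
  | mul x y _ _ hx hy => exact mul_mem (hx trivial) (hy trivial)

/-! ### Growth of graded modules -/

section growth

open MvPolynomial

theorem finrank_restrictDegree (k : Type u) [Field k] (s n : ℕ) :
    Module.finrank k (restrictDegree (Fin s) k n) = (n + 1) ^ s ∧
      Module.Finite k (restrictDegree (Fin s) k n) := by
  let e : {d : Fin s →₀ ℕ // ∀ i, d i ≤ n} ≃ (Fin s → Fin (n + 1)) :=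
    { toFun := fun d i => ⟨d.1 i, Nat.lt_succ_of_le (d.2 i)⟩
      invFun := fun f => ⟨Finsupp.equivFunOnFinite.symm fun i => f i,
        fun i => Nat.le_of_lt_succ (f i).2⟩
      left_inv := fun d => by ext; simp
      right_inv := fun f => by ext; simp }
  have b : Module.Basis {d : Fin s →₀ ℕ // ∀ i, d i ≤ n} k (restrictDegree (Fin s) k n) :=
    basisRestrictSupport k {d : Fin s →₀ ℕ | ∀ i, d i ≤ n}
  have b' := b.reindex e
  exact ⟨by simp [Module.finrank_eq_card_basis b'], Module.Finite.of_basis b'⟩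

theorem mem_restrictDegree_iff {k : Type u} [Field k] {s n : ℕ} {p : MvPolynomial (Fin s) k} :
    p ∈ restrictDegree (Fin s) k n ↔ ∀ i, p.degreeOf i ≤ n := by
  simp only [mem_restrictDegree, degreeOf_le_iff]
  exact ⟨fun h i d hd => h d hd i, fun h d hd i => h i d hd⟩

variable {k : Type u} {R : Type v} [Field k] [CommRing R] [Algebra k R]
  {𝒜 : ℕ → Submodule k R}
  {M : Type w} [AddCommGroup M] [Module k M] [Module R M] [IsScalarTower k R M]
  {ℳ : ℤ → Submodule k M}

/-- The span of the `φ(p) gₗ` with `p` of degree at most `E` in each variable. -/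
def boxSpan {s q : ℕ} (φ : MvPolynomial (Fin s) k →ₐ[k] R) (g : Fin q → M) (E : ℕ) :
    Submodule k M :=
  LinearMap.range (∑ l, ((LinearMap.toSpanSingleton R M (g l)).restrictScalars k ∘ₗ
    φ.toLinearMap ∘ₗ (restrictDegree (Fin s) k E).subtype) ∘ₗ
      LinearMap.proj (R := k) (φ := fun _ : Fin q => restrictDegree (Fin s) k E) l)

theorem mem_boxSpan {s q : ℕ} {φ : MvPolynomial (Fin s) k →ₐ[k] R} {g : Fin q → M} {E : ℕ}
    {m : M} : m ∈ boxSpan φ g E ↔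
      ∃ c : Fin q → MvPolynomial (Fin s) k, (∀ l i, (c l).degreeOf i ≤ E) ∧
        m = ∑ l, φ (c l) • g l := by
  rw [boxSpan, LinearMap.mem_range]
  constructor
  · rintro ⟨c, rfl⟩
    exact ⟨fun l => c l, fun l => mem_restrictDegree_iff.1 (c l).2, by simp⟩
  · rintro ⟨c, hc, rfl⟩
    exact ⟨fun l => ⟨c l, mem_restrictDegree_iff.2 (hc l)⟩, by simp⟩

theorem finite_boxSpan {s q : ℕ} (φ : MvPolynomial (Fin s) k →ₐ[k] R) (g : Fin q → M) (E : ℕ) :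
    Module.Finite k (boxSpan φ g E) := by
  have := (finrank_restrictDegree k s E).2
  unfold boxSpan
  infer_instance

theorem finrank_boxSpan_le {s q : ℕ} (φ : MvPolynomial (Fin s) k →ₐ[k] R) (g : Fin q → M)
    (E : ℕ) : Module.finrank k (boxSpan φ g E) ≤ q * (E + 1) ^ s := by
  have := (finrank_restrictDegree k s E).2
  refine (LinearMap.finrank_range_le _).trans ?_
  rw [Module.finrank_pi_fintype]
  simp [(finrank_restrictDegree k s E).1]

theorem boxSpan_mono {s q : ℕ} (φ : MvPolynomial (Fin s) k →ₐ[k] R) (g : Fin q → M) {E E' : ℕ}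
    (h : E ≤ E') : boxSpan φ g E ≤ boxSpan φ g E' := fun m hm => by
  obtain ⟨c, hc, rfl⟩ := mem_boxSpan.1 hm
  exact mem_boxSpan.2 ⟨c, fun l i => (hc l i).trans h, rfl⟩

theorem exists_mem_boxSpan {s q : ℕ} {φ : MvPolynomial (Fin s) k →ₐ[k] R} {g : Fin q → M}
    (hg : ∀ m, ∃ c : Fin q → MvPolynomial (Fin s) k, m = ∑ l, φ (c l) • g l) (m : M) :
    ∃ E, m ∈ boxSpan φ g E := by
  obtain ⟨c, hc⟩ := hg m
  refine ⟨Finset.univ.sup fun l => Finset.univ.sup fun i => (c l).degreeOf i,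
    mem_boxSpan.2 ⟨c, fun l i => ?_, hc⟩⟩
  exact (Finset.le_sup (f := fun i => (c l).degreeOf i) (Finset.mem_univ i)).trans
    (Finset.le_sup (f := fun l => Finset.univ.sup fun i => (c l).degreeOf i) (Finset.mem_univ l))

/-- An element of `R` moves the filtration of `M` by the `boxSpan`s by a bounded amount. -/
theorem exists_smul_mem_boxSpan {s q : ℕ} {φ : MvPolynomial (Fin s) k →ₐ[k] R} {g : Fin q → M}
    (hg : ∀ m, ∃ c : Fin q → MvPolynomial (Fin s) k, m = ∑ l, φ (c l) • g l) (r : R) :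
    ∃ e, ∀ E, ∀ m ∈ boxSpan φ g E, r • m ∈ boxSpan φ g (E + e) := by
  choose e he using fun l => exists_mem_boxSpan hg (r • g l)
  refine ⟨Finset.univ.sup e, fun E m hm => ?_⟩
  have he' : ∀ l, r • g l ∈ boxSpan φ g (Finset.univ.sup e) := fun l =>
    boxSpan_mono φ g (Finset.le_sup (Finset.mem_univ l)) (he l)
  choose c' hc' hc'' using fun l => mem_boxSpan.1 (he' l)
  obtain ⟨c, hc, rfl⟩ := mem_boxSpan.1 hm
  rw [Finset.smul_sum]
  refine Submodule.sum_mem _ fun l _ => ?_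
  rw [smul_comm, hc'', Finset.smul_sum]
  refine mem_boxSpan.2 ⟨fun l' => c l * c' l l', fun l' i => ?_, ?_⟩
  · exact (degreeOf_mul_le i _ _).trans (add_le_add (hc l i) (hc' l l' i))
  · simp [mul_smul]

theorem exists_bddBelow [GradedAlgebra 𝒜] (hℳ : IsGradedModule 𝒜 ℳ) [Module.Finite R M] :
    ∃ c : ℤ, ∀ j < c, ℳ j = ⊥ := by
  obtain ⟨r, g, deg, hg, hspan⟩ := exists_homogeneous_generators hℳ
  obtain ⟨c, hc⟩ : ∃ c, ∀ l, c ≤ deg l := by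
    obtain ⟨c, hc⟩ := (Set.finite_range deg).bddBelow
    exact ⟨c, fun l => hc ⟨l, rfl⟩⟩
  have key : ∀ m : M, ∀ j < c, gcomp hℳ.isInternal j m = 0 := by
    intro m
    have hm : m ∈ Submodule.span R (Set.range g) := hspan ▸ Submodule.mem_top
    induction hm using Submodule.span_induction with
    | mem m hm =>
      obtain ⟨l, rfl⟩ := hm
      exact fun j hj => gcomp_of_ne _ (hj.trans_le (hc l)).ne' (hg l)
    | zero => simp
    | add x y _ _ hx hy => intro j hj; rw [map_add, hx j hj, hy j hj, add_zero]
    | smul a x _ hx =>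
      induction a using DirectSum.Decomposition.inductionOn 𝒜 with
      | zero => simp
      | @homogeneous i a =>
        intro j hj
        have h := hℳ.gcomp_smul a.2 (j - i) x
        rw [hx (j - i) (by omega), smul_zero, add_sub_cancel] at h
        exact h
      | add a b ha hb => intro j hj; rw [add_smul, map_add, ha j hj, hb j hj, add_zero]
  refine ⟨c, fun j hj => ?_⟩
  rw [eq_bot_iff]
  intro m hm
  rw [Submodule.mem_bot, ← gcomp_same hℳ.isInternal hm, key m j hj]

/-- A finitely generated graded module `M` with normalization `φ` in `s` variables is contained,
degree by degree, in the filtration of `M` as a module over the polynomial ring. -/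
theorem exists_le_boxSpan [Algebra.FiniteType k R] [GradedAlgebra 𝒜] (h𝒜 : 𝒜 0 = 1)
    (hℳ : IsGradedModule 𝒜 ℳ) [Module.Finite R M] {c : ℤ} (hc : ∀ j < c, ℳ j = ⊥)
    {s q : ℕ} {φ : MvPolynomial (Fin s) k →ₐ[k] R} {g : Fin q → M}
    (hg : ∀ m, ∃ c : Fin q → MvPolynomial (Fin s) k, m = ∑ l, φ (c l) • g l) :
    ∃ e : ℕ, ∀ n : ℕ, ℳ (c + n) ≤ boxSpan φ g (e * n + e) := by
  obtain ⟨S, hS, hSdeg⟩ := exists_positive_generators 𝒜 h𝒜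
  obtain ⟨r, f, deg, hf, hspan⟩ := exists_homogeneous_generators hℳ
  choose eS heS using exists_smul_mem_boxSpan (k := k) hg
  choose eM heM using exists_mem_boxSpan hg
  set e := S.sup eS + Finset.univ.sup (fun l => eM (f l)) with he
  have hS' : ∀ x ∈ S, ∀ E, ∀ m ∈ boxSpan φ g E, x • m ∈ boxSpan φ g (E + e) := fun x hx E m hm =>
    boxSpan_mono φ g (by have := Finset.le_sup (f := eS) hx; omega) (heS x E m hm)
  have hM' : ∀ l, f l ∈ boxSpan φ g e := fun l => boxSpan_mono φ g
    (by have := Finset.le_sup (f := fun l => eM (f l)) (Finset.mem_univ l); omega) (heM (f l))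
  -- a product of generators shifts the filtration by at most `e` times its degree
  have hmon : ∀ y ∈ Submonoid.closure (S : Set R), ∃ n, y ∈ 𝒜 n ∧
      ∀ E, ∀ m ∈ boxSpan φ g E, y • m ∈ boxSpan φ g (E + e * n) := by
    intro y hy
    induction hy using Submonoid.closure_induction with
    | mem x hx =>
      obtain ⟨n, hn, hxn⟩ := hSdeg x hx
      exact ⟨n, hxn, fun E m hm => boxSpan_mono φ g
        (by have := Nat.le_mul_of_pos_right e (Nat.pos_of_ne_zero hn); omega) (hS' x hx E m hm)⟩
    | one => exact ⟨0, SetLike.one_mem_graded 𝒜, fun E m hm => by simpa using hm⟩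
    | mul x y _ _ hx hy =>
      obtain ⟨n, hn, hx⟩ := hx
      obtain ⟨n', hn', hy⟩ := hy
      refine ⟨n + n', SetLike.mul_mem_graded hn hn', fun E m hm => ?_⟩
      rw [mul_smul, mul_add, add_comm (e * n), ← add_assoc]
      exact hx _ _ (hy _ _ hm)
  let W : Submodule k M := ⨅ n : ℕ,
    (boxSpan φ g (e * n + e)).comap (gcomp hℳ.isInternal (c + n))
  have hW : ∀ m, m ∈ W := by
    intro m
    have hm : m ∈ Submodule.span R (Set.range f) := hspan ▸ Submodule.mem_top
    obtain ⟨a, rfl⟩ := (Submodule.mem_span_range_iff_exists_fun _).1 hm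
    refine Submodule.sum_mem _ fun l _ => ?_
    have ha : a l ∈ Submodule.span k (Submonoid.closure (S : Set R) : Set R) := by
      rw [← Algebra.adjoin_eq_span, hS]; trivial
    generalize a l = b at ha ⊢
    induction ha using Submodule.span_induction with
    | mem y hy =>
      obtain ⟨n, hyn, hy⟩ := hmon y hy
      refine Submodule.mem_iInf _ |>.2 fun n' => ?_
      rw [Submodule.mem_comap]
      by_cases hl : f l = 0
      · rw [hl, smul_zero, map_zero]; exact zero_mem _
      have hcl : c ≤ deg l := by
        by_contra hlt
        exact hl (by simpa [hc (deg l) (by omega)] using hf l)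
      have hyl := hℳ.smul_mem n (deg l) y (f l) hyn (hf l)
      by_cases hn : (n : ℤ) + deg l = c + n'
      · rw [gcomp_same _ (hn ▸ hyl)]
        refine boxSpan_mono φ g ?_ (hy _ _ (hM' l))
        have : n ≤ n' := by omega
        have := Nat.mul_le_mul_left e this
        omega
      · rw [gcomp_of_ne _ hn hyl]; exact zero_mem _
    | zero => rw [zero_smul]; exact zero_mem _
    | add x y _ _ hx hy => rw [add_smul]; exact add_mem hx hy
    | smul t x _ hx => rw [smul_assoc]; exact Submodule.smul_mem _ t hx
  refine ⟨e, fun n m hm => ?_⟩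
  rw [← gcomp_same hℳ.isInternal hm]
  exact (Submodule.mem_iInf _).1 (hW m) n

theorem finiteDimensional_graded [Algebra.FiniteType k R] [GradedAlgebra 𝒜] (h𝒜 : 𝒜 0 = 1)
    (hℳ : IsGradedModule 𝒜 ℳ) [Module.Finite R M] (j : ℤ) : FiniteDimensional k (ℳ j) := by
  obtain ⟨c, hc⟩ := exists_bddBelow hℳ
  rcases subsingleton_or_nontrivial M with hM | hM
  · infer_instance
  by_cases hj : j < c
  · rw [hc j hj]; infer_instance
  obtain ⟨s, φ, -, -, q, g, hg⟩ := exists_normalization k (R := R) M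
  obtain ⟨e, he⟩ := exists_le_boxSpan h𝒜 hℳ hc hg
  have := finite_boxSpan φ g (e * (j - c).toNat + e)
  have h1 := he (j - c).toNat
  rw [show c + ((j - c).toNat : ℤ) = j by omega] at h1
  exact Submodule.finiteDimensional_of_le h1

/-- The parts of a graded vector space in different degrees are independent. -/
theorem sum_finrank_le_of_le (h : DirectSum.IsInternal ℳ) (c : ℤ) (n : ℕ) (W : Submodule k M)
    [Module.Finite k W] (hW : ∀ i < n, ℳ (c + i) ≤ W) :
    ∑ i ∈ Finset.range n, Module.finrank k (ℳ (c + i)) ≤ Module.finrank k W := by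
  have hfin : ∀ i : Fin n, Module.Finite k (ℳ (c + (i : ℕ))) := fun i =>
    Submodule.finiteDimensional_of_le (hW i i.2)
  let F : ((i : Fin n) → ℳ (c + (i : ℕ))) →ₗ[k] W :=
    ∑ i : Fin n, (Submodule.inclusion (hW i i.2)) ∘ₗ
      LinearMap.proj (R := k) (φ := fun i : Fin n => ℳ (c + (i : ℕ))) i
  have hF : Function.Injective F := by
    rw [injective_iff_map_eq_zero]
    intro x hx
    have hx' : ∑ i : Fin n, (x i : M) = 0 := by
      have := congrArg (W.subtype) hx
      simpa [F] using this
    ext i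
    have := congrArg (gcomp h (c + (i : ℕ))) hx'
    rw [map_sum, map_zero, Finset.sum_eq_single i, gcomp_same h (x i).2] at this
    · simpa using this
    · intro i' _ hi'
      exact gcomp_of_ne h (by simpa [Fin.ext_iff] using hi') (x i').2
    · simp
  have := LinearMap.finrank_le_finrank_of_injective hF
  rwa [Module.finrank_pi_fintype,
    Fin.sum_univ_eq_sum_range (fun i => Module.finrank k (ℳ (c + i)))] at this

/-- The dimension of `M` up to degree `c + n` grows at most like `n ^ s`, if `M` is finite over a
polynomial ring in `s` variables: that part of `M` lies in the span of the monomials with exponents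
at most `e * n + e`, applied to finitely many generators. The variables need not act
homogeneously. -/
theorem exists_sum_finrank_le [Algebra.FiniteType k R] [GradedAlgebra 𝒜] (h𝒜 : 𝒜 0 = 1)
    (hℳ : IsGradedModule 𝒜 ℳ) [Module.Finite R M] {c : ℤ} (hc : ∀ j < c, ℳ j = ⊥)
    {s q : ℕ} {φ : MvPolynomial (Fin s) k →ₐ[k] R} {g : Fin q → M}
    (hg : ∀ m, ∃ c : Fin q → MvPolynomial (Fin s) k, m = ∑ l, φ (c l) • g l) :
    ∃ C : ℕ, ∀ n : ℕ,
      ∑ i ∈ Finset.range (n + 1), Module.finrank k (ℳ (c + i)) ≤ C * (n + 1) ^ s := by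
  obtain ⟨e, he⟩ := exists_le_boxSpan h𝒜 hℳ hc hg
  refine ⟨q * (e + 1) ^ s, fun n => ?_⟩
  have := finite_boxSpan φ g (e * n + e)
  refine (sum_finrank_le_of_le hℳ.isInternal c (n + 1) (boxSpan φ g (e * n + e))
    fun i hi => (he i).trans (boxSpan_mono φ g ?_)).trans
    ((finrank_boxSpan_le φ g _).trans ?_)
  · have : i ≤ n := by omega
    have := Nat.mul_le_mul_left e this
    omega
  · rw [mul_assoc, ← mul_pow]
    gcongr
    nlinarith

/-- The dimension of `M` in degrees below `c + n * D + e` grows at least like `n ^ s`, if a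
polynomial ring in `s` variables acts faithfully on `M`: a polynomial of degree at most `n` in each
variable is determined by its values on `r` generators of `M`, and these lie in that range of
degrees. -/
theorem exists_le_sum_finrank [Algebra.FiniteType k R] [GradedAlgebra 𝒜] (h𝒜 : 𝒜 0 = 1)
    (hℳ : IsGradedModule 𝒜 ℳ) [Module.Finite R M] {c : ℤ} (hc : ∀ j < c, ℳ j = ⊥)
    {s : ℕ} {φ : MvPolynomial (Fin s) k →ₐ[k] R} (hφ : ∀ a, (∀ m : M, φ a • m = 0) → a = 0) :
    ∃ r D e : ℕ, 0 < D ∧ ∀ n : ℕ,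
      (n + 1) ^ s ≤ r * ∑ i ∈ Finset.range (n * D + e), Module.finrank k (ℳ (c + i)) := by
  have hfin := finiteDimensional_graded h𝒜 hℳ
  set h := hℳ.isInternal
  obtain ⟨r, f, deg, hf, hspan⟩ := exists_homogeneous_generators hℳ
  -- the operators of degree at most `D`
  let sh : ℕ → Submodule k R := fun D =>
    { carrier := {a | ∀ (j : ℤ) (m : M), (∀ i > j, gcomp h i m = 0) →
        ∀ i > j + D, gcomp h i (a • m) = 0}
      add_mem' := fun {a b} ha hb j m hm i hi => by
        rw [add_smul, map_add, ha j m hm i hi, hb j m hm i hi, add_zero]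
      zero_mem' := fun j m hm i hi => by rw [zero_smul, map_zero]
      smul_mem' := fun t a ha j m hm i hi => by
        rw [smul_assoc, map_smul, ha j m hm i hi, smul_zero] }
  have sh_mono : ∀ {D D'}, D ≤ D' → sh D ≤ sh D' := fun hD a ha j m hm i hi =>
    ha j m hm i (by omega)
  have sh_mul : ∀ {D D' a b}, a ∈ sh D → b ∈ sh D' → a * b ∈ sh (D + D') := by
    intro D D' a b ha hb j m hm i hi
    rw [mul_smul]
    exact ha (j + D') (b • m) (hb j m hm) i (by push_cast at hi; omega)
  have sh_one : (1 : R) ∈ sh 0 := fun j m hm i hi => by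
    rw [one_smul]; exact hm i (by simpa using hi)
  have sh_pow : ∀ {D a} (n : ℕ), a ∈ sh D → a ^ n ∈ sh (n * D) := by
    intro D a n ha
    induction n with
    | zero => simpa using sh_one
    | succ n ih => rw [pow_succ, add_mul, one_mul]; exact sh_mul ih ha
  have sh_exists : ∀ a, ∃ D, a ∈ sh D := by
    intro a
    induction a using DirectSum.Decomposition.inductionOn 𝒜 with
    | zero => exact ⟨0, zero_mem _⟩
    | @homogeneous d a =>
      refine ⟨d, fun j m hm i hi => ?_⟩
      have h1 := hℳ.gcomp_smul a.2 (i - d) m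
      rw [hm (i - d) (by omega), smul_zero, add_sub_cancel] at h1
      exact h1
    | add a b ha hb =>
      obtain ⟨D, ha⟩ := ha
      obtain ⟨D', hb⟩ := hb
      exact ⟨max D D', add_mem (sh_mono (le_max_left _ _) ha) (sh_mono (le_max_right _ _) hb)⟩
  choose Dv hDv using fun i : Fin s => sh_exists (φ (X i))
  set D := ∑ i, Dv i with hD
  have sh_box : ∀ n, ∀ p ∈ restrictDegree (Fin s) k n, φ p ∈ sh (n * D) := by
    intro n p hp
    rw [MvPolynomial.aeval_unique φ, aeval_def, eval₂_eq']
    refine Submodule.sum_mem _ fun d hd => ?_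
    rw [← Algebra.smul_def]
    refine Submodule.smul_mem _ _ ?_
    rw [hD, Finset.mul_sum]
    have hprod : ∀ t : Finset (Fin s), ∏ i ∈ t, (φ ∘ X) i ^ d i ∈ sh (∑ i ∈ t, n * Dv i) := by
      intro t
      induction t using Finset.cons_induction with
      | empty => simpa using sh_one
      | cons i t hi ih =>
        rw [Finset.prod_cons, Finset.sum_cons]
        exact sh_mul (sh_mono (Nat.mul_le_mul_right _ ((mem_restrictDegree _ _ _).1 hp d hd i))
          (sh_pow (d i) (hDv i))) ih
    exact hprod Finset.univ
  obtain ⟨e, he⟩ : ∃ e : ℕ, ∀ l, deg l < c + e := by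
    obtain ⟨b, hb⟩ := (Set.finite_range deg).bddAbove
    exact ⟨(b - c + 1).toNat, fun l => by have := hb ⟨l, rfl⟩; omega⟩
  refine ⟨r, D + 1, e, Nat.succ_pos _, fun n => ?_⟩
  have := (finrank_restrictDegree k s n).2
  rw [← (finrank_restrictDegree k s n).1]
  -- the components of `φ p • f l` in the degrees below `c + n * (D + 1) + e`
  let F : restrictDegree (Fin s) k n →ₗ[k]
      ((l : Fin r) → (i : Fin (n * (D + 1) + e)) → ℳ (c + (i : ℕ))) :=
    LinearMap.pi fun l => LinearMap.pi fun i =>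
      ((gcomp h (c + (i : ℕ))).codRestrict (ℳ (c + (i : ℕ))) (gcomp_mem h _)) ∘ₗ
        (LinearMap.toSpanSingleton R M (f l)).restrictScalars k ∘ₗ φ.toLinearMap ∘ₗ
          (restrictDegree (Fin s) k n).subtype
  have hF : Function.Injective F := by
    rw [injective_iff_map_eq_zero]
    intro p hp
    have hp' : ∀ (l : Fin r) (i : ℕ), i < n * (D + 1) + e →
        gcomp h (c + i) (φ p • f l) = 0 := fun l i hi => by
      have := congrArg Subtype.val (congrFun (congrFun hp l) ⟨i, hi⟩)
      simpa [F] using this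
    have hzero : ∀ l, φ p • f l = 0 := by
      intro l
      refine eq_zero_of_gcomp h fun j => ?_
      by_cases hj : j < c
      · have := gcomp_mem h j (φ p • f l)
        simpa [hc j hj] using this
      by_cases hj' : j < c + (n * (D + 1) + e : ℕ)
      · have := hp' l (j - c).toNat (by omega)
        rwa [show c + ((j - c).toNat : ℤ) = j by omega] at this
      · refine sh_box n p p.2 (deg l) (f l) (fun i hi => gcomp_of_ne h hi.ne (hf l)) j ?_
        have := he l
        push_cast at hj' ⊢
        nlinarith
    refine Subtype.ext (hφ _ fun m => ?_)
    have hm : m ∈ Submodule.span R (Set.range f) := hspan ▸ Submodule.mem_top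
    obtain ⟨a, rfl⟩ := (Submodule.mem_span_range_iff_exists_fun _).1 hm
    rw [Finset.smul_sum]
    exact Finset.sum_eq_zero fun l _ => by rw [smul_comm, hzero, smul_zero]
  have := LinearMap.finrank_le_finrank_of_injective hF
  rw [Module.finrank_pi_fintype] at this
  simp only [Module.finrank_pi_fintype] at this
  rw [Fin.sum_univ_eq_sum_range (fun i => Module.finrank k (ℳ (c + i)))] at this
  simpa using this

end growth

/-! ### Hilbert series and the Hilbert–Serre theorem -/

section hilbertSerre

open Polynomial

open Classical in
/-- The Laurent series with the given coefficients; it is zero unless they vanish in all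
sufficiently small degrees. -/
def laurentOf (c : ℤ → ℚ) : LaurentSeries ℚ :=
  if h : BddBelow (Function.support c) then HahnSeries.ofSuppBddBelow c h else 0

theorem coeff_laurentOf {c : ℤ → ℚ} (h : ∃ b : ℤ, ∀ j < b, c j = 0) (j : ℤ) :
    (laurentOf c).coeff j = c j := by
  obtain ⟨b, hb⟩ := h
  have : BddBelow (Function.support c) := ⟨b, fun j hj => by
    by_contra hlt
    exact hj (hb j (not_le.1 hlt))⟩
  rw [laurentOf, dif_pos this]
  rfl

/-- The Hilbert series of a graded vector space, as a Laurent series. -/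
def hilbertSeries {k : Type u} [Field k] {M : Type w} [AddCommGroup M] [Module k M]
    (ℳ : ℤ → Submodule k M) : LaurentSeries ℚ :=
  laurentOf fun j => Module.finrank k (ℳ j)

theorem coeff_hilbertSeries {k : Type u} [Field k] {M : Type w} [AddCommGroup M] [Module k M]
    {ℳ : ℤ → Submodule k M} (h : ∃ c : ℤ, ∀ j < c, ℳ j = ⊥) (j : ℤ) :
    (hilbertSeries ℳ).coeff j = Module.finrank k (ℳ j) := by
  obtain ⟨c, hc⟩ := h
  exact coeff_laurentOf ⟨c, fun j hj => by rw [hc j hj]; simp⟩ j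

/-- Polynomials as Laurent series. -/
def toLaurent : ℚ[X] →+* LaurentSeries ℚ :=
  (HahnSeries.ofPowerSeries ℤ ℚ).comp Polynomial.coeToPowerSeries.ringHom

theorem toLaurent_apply (p : ℚ[X]) :
    toLaurent p = HahnSeries.ofPowerSeries ℤ ℚ (p : PowerSeries ℚ) := rfl

theorem toLaurent_X : toLaurent X = HahnSeries.single 1 1 := by
  rw [toLaurent_apply, Polynomial.coe_X, HahnSeries.ofPowerSeries_X]

theorem toLaurent_X_pow (n : ℕ) :
    toLaurent X ^ n = HahnSeries.single (n : ℤ) 1 := by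
  rw [toLaurent_X, HahnSeries.single_pow]; simp

/-- A Laurent series is, up to a shift by `a`, the power series of its coefficients from `-a` on. -/
theorem X_pow_mul_eq_ofPowerSeries {f : LaurentSeries ℚ} {a : ℕ}
    (h : ∀ j < -(a : ℤ), f.coeff j = 0) :
    toLaurent X ^ a * f =
      HahnSeries.ofPowerSeries ℤ ℚ (PowerSeries.mk fun n => f.coeff (-(a : ℤ) + n)) := by
  ext j
  rw [toLaurent_X_pow, HahnSeries.coeff_single_mul, one_mul]
  have := PowerSeries.coeff_coe (R := ℚ) (f := PowerSeries.mk fun n => f.coeff (-(a : ℤ) + n)) j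
  rw [this]
  split_ifs with hj
  · exact h _ (by omega)
  · rw [PowerSeries.coeff_mk]
    congr 1
    omega

/-- Multiplication by a homogeneous `x` of degree `d` gives the exact sequence
`0 → ker x → M → M(d) → (M / xM)(d) → 0`. -/
theorem hilbertSeries_mul_one_sub {k : Type u} {R : Type v} [Field k] [CommRing R] [Algebra k R]
    {𝒜 : ℕ → Submodule k R}
    {M : Type w} [AddCommGroup M] [Module k M] [Module R M] [IsScalarTower k R M]
    {ℳ : ℤ → Submodule k M} (hℳ : IsGradedModule 𝒜 ℳ) (hfin : ∀ j, FiniteDimensional k (ℳ j))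
    (hbdd : ∃ c : ℤ, ∀ j < c, ℳ j = ⊥) {x : R} {d : ℕ} (hx : x ∈ 𝒜 d) :
    hilbertSeries ℳ * (1 - toLaurent X ^ d) =
      hilbertSeries (quotGrading ℳ (LinearMap.range (LinearMap.lsmul R M x))) -
        toLaurent X ^ d *
          hilbertSeries (subGrading ℳ (LinearMap.ker (LinearMap.lsmul R M x))) := by
  obtain ⟨c, hc⟩ := hbdd
  ext j
  rw [mul_sub, mul_one, mul_comm, HahnSeries.coeff_sub, HahnSeries.coeff_sub, toLaurent_X_pow,
    HahnSeries.coeff_single_mul, HahnSeries.coeff_single_mul, one_mul, one_mul,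
    coeff_hilbertSeries ⟨c, hc⟩, coeff_hilbertSeries ⟨c, hc⟩,
    coeff_hilbertSeries ⟨c, fun i hi => by rw [quotGrading, hc i hi, Submodule.map_bot]⟩,
    coeff_hilbertSeries ⟨c, fun i hi => by
      rw [subGrading, hc i hi, eq_bot_iff]
      intro y hy
      exact Subtype.ext hy⟩]
  set K := LinearMap.ker (LinearMap.lsmul R M x)
  set I := LinearMap.range (LinearMap.lsmul R M x)
  have hmem : ∀ m ∈ ℳ (j - d), x • m ∈ ℳ j := fun m hm => by
    have := hℳ.smul_mem d (j - d) x m hx hm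
    rwa [add_sub_cancel] at this
  let f : ℳ (j - d) →ₗ[k] ℳ j :=
    ((LinearMap.lsmul R M x).restrictScalars k).restrict hmem
  let g : ℳ j →ₗ[k] M ⧸ I := (I.mkQ.restrictScalars k) ∘ₗ (ℳ j).subtype
  have hf := LinearMap.finrank_range_add_finrank_ker f
  have hg := LinearMap.finrank_range_add_finrank_ker g
  have h1 : LinearMap.range g = quotGrading ℳ I j := by
    rw [LinearMap.range_comp, Submodule.range_subtype]
  have h2 : LinearMap.ker g = LinearMap.range f := by
    ext m
    constructor
    · intro hm
      have hm' : (m : M) ∈ I := (Submodule.Quotient.mk_eq_zero _).1 hm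
      obtain ⟨n, hn⟩ := hm'
      refine ⟨⟨gcomp hℳ.isInternal (j - d) n, gcomp_mem _ _ _⟩, Subtype.ext ?_⟩
      have h3 := hℳ.gcomp_smul hx (j - d) n
      rw [add_sub_cancel] at h3
      change x • gcomp hℳ.isInternal (j - d) n = m
      rw [← h3, show x • n = m from hn, gcomp_same _ m.2]
    · rintro ⟨n, rfl⟩
      exact (Submodule.Quotient.mk_eq_zero _).2 ⟨n, rfl⟩
  have h3 : Module.finrank k (LinearMap.ker f) = Module.finrank k (subGrading ℳ K (j - d)) := by
    rw [(Submodule.equivMapOfInjective _ (ℳ (j - d)).injective_subtype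
        (LinearMap.ker f)).finrank_eq,
      (Submodule.equivMapOfInjective (K.subtype.restrictScalars k) K.injective_subtype
        (subGrading ℳ K (j - d))).finrank_eq]
    suffices h : (LinearMap.ker f).map (ℳ (j - d)).subtype =
        (subGrading ℳ K (j - d)).map (K.subtype.restrictScalars k) by rw [h]
    ext m
    constructor
    · rintro ⟨⟨m, hm⟩, hm', rfl⟩
      exact ⟨⟨m, congrArg Subtype.val hm'⟩, hm, rfl⟩
    · rintro ⟨⟨m, hm⟩, hm', rfl⟩
      exact ⟨⟨m, hm'⟩, Subtype.ext hm, rfl⟩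
  rw [h1, h2] at hg
  rw [h3] at hf
  have hf' : (Module.finrank k (LinearMap.range f) : ℚ) +
    Module.finrank k (subGrading ℳ K (j - d)) = Module.finrank k (ℳ (j - d)) := by exact_mod_cast hf
  have hg' : (Module.finrank k (quotGrading ℳ I j) : ℚ) +
    Module.finrank k (LinearMap.range f) = Module.finrank k (ℳ j) := by exact_mod_cast hg
  linarith

/-- If the generators of `R` act by zero, then `M` is finite-dimensional, and its Hilbert series is
a Laurent polynomial. -/
theorem exists_polynomial_of_smul_eq_zero {k : Type u} {R : Type v} [Field k] [CommRing R]
    [Algebra k R] {𝒜 : ℕ → Submodule k R} [GradedAlgebra 𝒜]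
    {M : Type w} [AddCommGroup M] [Module k M] [Module R M] [IsScalarTower k R M]
    {ℳ : ℤ → Submodule k M} (hℳ : IsGradedModule 𝒜 ℳ) [Module.Finite R M] {T : Set R}
    (hT : Algebra.adjoin k T = ⊤) (hT' : ∀ x ∈ T, ∀ m : M, x • m = 0) :
    ∃ (a : ℕ) (p : ℚ[X]), toLaurent X ^ a * hilbertSeries ℳ =
      toLaurent p := by
  have hscalar : ∀ r : R, ∃ t : k, ∀ m : M, r • m = t • m := by
    intro r
    have hr : r ∈ Algebra.adjoin k T := hT ▸ Algebra.mem_top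
    induction hr using Algebra.adjoin_induction with
    | mem x hx => exact ⟨0, fun m => by rw [hT' x hx, zero_smul]⟩
    | algebraMap t => exact ⟨t, fun m => algebraMap_smul R t m⟩
    | add x y _ _ hx hy =>
      obtain ⟨s, hs⟩ := hx
      obtain ⟨t, ht⟩ := hy
      exact ⟨s + t, fun m => by rw [add_smul, add_smul, hs, ht]⟩
    | mul x y _ _ hx hy =>
      obtain ⟨s, hs⟩ := hx
      obtain ⟨t, ht⟩ := hy
      exact ⟨s * t, fun m => by rw [mul_smul, mul_smul, ht, hs]⟩
  have hfin : Module.Finite k M := by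
    obtain ⟨n, g, hg⟩ := Module.Finite.exists_fin (R := R) (M := M)
    refine (⟨⟨(Set.finite_range g).toFinset, ?_⟩⟩ : Module.Finite k M)
    rw [Set.Finite.coe_toFinset, eq_top_iff]
    rintro m -
    have hm : m ∈ Submodule.span R (Set.range g) := hg ▸ Submodule.mem_top
    obtain ⟨c, rfl⟩ := (Submodule.mem_span_range_iff_exists_fun _).1 hm
    refine Submodule.sum_mem _ fun l _ => ?_
    obtain ⟨t, ht⟩ := hscalar (c l)
    rw [ht]
    exact Submodule.smul_mem _ t (Submodule.subset_span ⟨l, rfl⟩)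
  obtain ⟨c, hc⟩ := exists_bddBelow hℳ
  have hs := WellFoundedGT.finite_ne_bot_of_iSupIndep hℳ.isInternal.submodule_iSupIndep
  obtain ⟨b, hb⟩ := hs.bddAbove
  have hb' : ∀ j, b < j → ℳ j = ⊥ := fun j hj => by
    by_contra h
    exact absurd (hb h) (not_le.2 hj)
  set a := (-c).toNat
  have hbdd : ∃ c : ℤ, ∀ j < c, ℳ j = ⊥ := ⟨c, hc⟩
  refine ⟨a, PowerSeries.trunc ((b + a).toNat + 1) (PowerSeries.mk fun n =>
    (hilbertSeries ℳ).coeff (-(a : ℤ) + n)), ?_⟩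
  rw [X_pow_mul_eq_ofPowerSeries fun j hj => by
    rw [coeff_hilbertSeries hbdd, hc j (by omega)]; simp, toLaurent_apply]
  congr 1
  ext n
  rw [Polynomial.coeff_coe, PowerSeries.coeff_trunc]
  split_ifs with hn
  · rfl
  · rw [PowerSeries.coeff_mk, coeff_hilbertSeries hbdd, hb' _ (by omega)]
    simp

/-- The induction is on the number of generators of `R` that may act nontrivially: `S` holds these,
and the generators in `T` act by zero. Passing from `M` to the kernel and cokernel of `x ∈ S` moves
`x` to `T`. -/
theorem exists_hilbertSerre_aux {k : Type u} {R : Type v} [Field k] [CommRing R] [Algebra k R]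
    [Algebra.FiniteType k R] {𝒜 : ℕ → Submodule k R} [GradedAlgebra 𝒜] (h𝒜 : 𝒜 0 = 1)
    (S : Finset R) (hS : ∀ x ∈ S, ∃ n ≠ 0, x ∈ 𝒜 n) :
    ∀ (T : Set R) (_ : Algebra.adjoin k ((S : Set R) ∪ T) = ⊤)
      (M : Type w) [AddCommGroup M] [Module k M] [Module R M] [IsScalarTower k R M]
      (ℳ : ℤ → Submodule k M) (_ : IsGradedModule 𝒜 ℳ) [Module.Finite R M]
      (_ : ∀ x ∈ T, ∀ m : M, x • m = 0),
    ∃ (m : ℕ) (q : ℚ[X]) (a : ℕ) (p : ℚ[X]), 0 < q.eval 1 ∧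
      toLaurent X ^ a * hilbertSeries ℳ *
        toLaurent ((1 - X) ^ m * q) =
      toLaurent p := by
  have hR : IsNoetherianRing R := Algebra.FiniteType.isNoetherianRing k R
  induction S using Finset.cons_induction with
  | empty =>
    intro T hT M _ _ _ _ ℳ hℳ _ hT'
    obtain ⟨a, p, h⟩ := exists_polynomial_of_smul_eq_zero hℳ (T := T) (by simpa using hT) hT'
    exact ⟨0, 1, a, p, by simp, by simpa using h⟩
  | cons x S hxS ih =>
    intro T hT M _ _ _ _ ℳ hℳ _ hT'
    obtain ⟨d, hd, hxd⟩ := hS x (Finset.mem_cons_self x S)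
    have hT2 : Algebra.adjoin k ((S : Set R) ∪ insert x T) = ⊤ := by
      rw [← hT]
      congr 1
      ext y
      simp only [Finset.coe_cons, Set.mem_union, Set.mem_insert_iff]
      tauto
    have hgr := fun j m => hℳ.gcomp_smul hxd j m
    have hK : ∀ j, ∀ m ∈ LinearMap.ker (LinearMap.lsmul R M x),
        gcomp hℳ.isInternal j m ∈ LinearMap.ker (LinearMap.lsmul R M x) := fun j m hm => by
      have hm : x • m = 0 := hm
      change x • gcomp hℳ.isInternal j m = 0
      rw [← hgr, hm, map_zero]
    have hI : ∀ j, ∀ m ∈ LinearMap.range (LinearMap.lsmul R M x),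
        gcomp hℳ.isInternal j m ∈ LinearMap.range (LinearMap.lsmul R M x) := by
      rintro j _ ⟨m, rfl⟩
      refine ⟨gcomp hℳ.isInternal (j - d) m, ?_⟩
      have := hgr (j - d) m
      rw [add_sub_cancel] at this
      exact this.symm
    obtain ⟨mK, qK, aK, pK, hqK, hpK⟩ := ih (fun y hy => hS y (Finset.mem_cons_of_mem hy))
      (insert x T) hT2 _ _ (isGradedModule_subGrading hℳ _ hK) (by
        rintro y (rfl | hy) ⟨m, hm⟩
        · exact Subtype.ext hm
        · exact Subtype.ext (hT' y hy m))
    obtain ⟨mL, qL, aL, pL, hqL, hpL⟩ := ih (fun y hy => hS y (Finset.mem_cons_of_mem hy))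
      (insert x T) hT2 _ _ (isGradedModule_quotGrading hℳ _ hI) (by
        rintro y (rfl | hy) m
        · obtain ⟨m, rfl⟩ := Submodule.mkQ_surjective _ m
          rw [← map_smul]
          exact (Submodule.Quotient.mk_eq_zero _).2 ⟨m, rfl⟩
        · obtain ⟨m, rfl⟩ := Submodule.mkQ_surjective _ m
          rw [← map_smul, hT' y hy m, map_zero])
    have hmain := hilbertSeries_mul_one_sub hℳ (finiteDimensional_graded h𝒜 hℳ)
      (exists_bddBelow hℳ) hxd
    have hgeom : ((1 - X) * ∑ i ∈ Finset.range d, X ^ i : ℚ[X]) = 1 - X ^ d := mul_neg_geom_sum _ _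
    refine ⟨mK + mL + 1, qK * qL * ∑ i ∈ Finset.range d, X ^ i, aK + aL,
      X ^ aK * (1 - X) ^ mK * qK * pL - X ^ d * X ^ aL * (1 - X) ^ mL * qL * pK, ?_, ?_⟩
    · have : (0 : ℚ) < d := by exact_mod_cast Nat.pos_of_ne_zero hd
      simp only [eval_mul, eval_finsetSum, eval_pow, eval_X, one_pow, Finset.sum_const,
        Finset.card_range, nsmul_eq_mul, mul_one]
      positivity
    · have hg2 := congrArg toLaurent hgeom
      rw [show ((1 - X) ^ (mK + mL + 1) * (qK * qL * ∑ i ∈ Finset.range d, X ^ i) : ℚ[X]) =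
        (1 - X) ^ (mK + mL) * (qK * qL) * ((1 - X) * ∑ i ∈ Finset.range d, X ^ i) by ring, hgeom]
      simp only [map_mul, map_pow, map_sub, map_one] at hpK hpL ⊢
      rw [pow_add, pow_add]
      generalize toLaurent X = z at *
      generalize toLaurent qK = uK at *
      generalize toLaurent qL = uL at *
      linear_combination (z ^ aK * (1 - z) ^ mK * uK * z ^ aL * (1 - z) ^ mL * uL) * hmain +
        (z ^ aK * (1 - z) ^ mK * uK) * hpL - (z ^ d * z ^ aL * (1 - z) ^ mL * uL) * hpK

/-- The **Hilbert–Serre theorem**: the Hilbert series of a finitely generated graded module is a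
Laurent polynomial divided by a product of factors `1 - X ^ d`. The factor `1 - X` is split off
each of them, leaving a cofactor `q` that is positive at `1`. -/
theorem exists_hilbertSerre {k : Type u} {R : Type v} [Field k] [CommRing R] [Algebra k R]
    [Algebra.FiniteType k R] {𝒜 : ℕ → Submodule k R} [GradedAlgebra 𝒜] (h𝒜 : 𝒜 0 = 1)
    {M : Type w} [AddCommGroup M] [Module k M] [Module R M] [IsScalarTower k R M]
    {ℳ : ℤ → Submodule k M} (hℳ : IsGradedModule 𝒜 ℳ) [Module.Finite R M] :
    ∃ (m : ℕ) (q : ℚ[X]) (a : ℕ) (p : ℚ[X]), 0 < q.eval 1 ∧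
      toLaurent X ^ a * hilbertSeries ℳ *
        toLaurent ((1 - X) ^ m * q) =
      toLaurent p := by
  obtain ⟨S, hS, hS'⟩ := exists_positive_generators 𝒜 h𝒜
  exact exists_hilbertSerre_aux h𝒜 S hS' ∅ (by simpa using hS) M ℳ hℳ (by simp)

end hilbertSerre

/-! ### The pole of a power series with coefficients of polynomial growth -/

section pole

open Polynomial Filter Topology

theorem choose_le_succ_pow (n s : ℕ) : (n + s).choose s ≤ (n + 1) ^ s := by
  induction s with
  | zero => simp
  | succ s ih =>
    have h := Nat.add_one_mul_choose_eq (n + s) s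
    have h1 : (s + 1) * (n + s).succ.choose s.succ ≤ (s + 1) * (n + 1) ^ (s + 1) := by
      calc (s + 1) * (n + s).succ.choose s.succ = (n + s).succ * (n + s).choose s := by
            rw [h, Nat.succ_eq_add_one s, mul_comm]
        _ ≤ ((s + 1) * (n + 1)) * (n + 1) ^ s := by
            refine Nat.mul_le_mul ?_ ih
            rw [Nat.succ_eq_add_one]; nlinarith [Nat.zero_le (s * n)]
        _ = (s + 1) * (n + 1) ^ (s + 1) := by ring
    exact Nat.le_of_mul_le_mul_left h1 (Nat.succ_pos s)

theorem succ_pow_le_factorial_mul_choose (n s : ℕ) :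
    (n + 1) ^ s ≤ s.factorial * (n + s).choose s := by
  rw [← Nat.ascFactorial_eq_factorial_mul_choose]
  exact Nat.pow_succ_le_ascFactorial (n + 1) s

theorem hasSum_coeff_mul {A : PowerSeries ℚ} {t σ : ℝ}
    (h : HasSum (fun n => ((PowerSeries.coeff n A : ℚ) : ℝ) * t ^ n) σ) (Q : ℚ[X]) :
    HasSum (fun n => ((PowerSeries.coeff n (A * (Q : PowerSeries ℚ)) : ℚ) : ℝ) * t ^ n)
      (σ * aeval t Q) := by
  induction Q using Polynomial.induction_on' with
  | add p q hp hq =>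
    simp only [Polynomial.coe_add, mul_add, map_add, Rat.cast_add, add_mul]
    exact hp.add hq
  | monomial m c =>
    set f : ℕ → ℝ := fun n =>
      ((PowerSeries.coeff n (A * ((monomial m c : ℚ[X]) : PowerSeries ℚ)) : ℚ) : ℝ) * t ^ n with hf
    have hcoeff : ∀ n, PowerSeries.coeff n (A * ((monomial m c : ℚ[X]) : PowerSeries ℚ)) =
        if m ≤ n then c * PowerSeries.coeff (n - m) A else 0 := fun n => by
      rw [← C_mul_X_pow_eq_monomial, Polynomial.coe_mul, Polynomial.coe_C, Polynomial.coe_pow,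
        Polynomial.coe_X, mul_left_comm, PowerSeries.coeff_C_mul, PowerSeries.coeff_mul_X_pow']
      split_ifs <;> simp
    have h1 : HasSum (fun n => f (n + m)) (σ * (c * t ^ m)) := by
      convert! h.mul_right ((c : ℝ) * t ^ m) using 2 with n
      rw [hf]
      simp only [hcoeff, if_pos (Nat.le_add_left m n), Nat.add_sub_cancel, pow_add]
      push_cast
      ring
    have h2 : ∑ i ∈ Finset.range m, f i = 0 := Finset.sum_eq_zero fun i hi => by
      rw [hf]
      simp only [hcoeff]
      rw [if_neg (by simpa using hi), Rat.cast_zero, zero_mul]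
    have h3 := (hasSum_nat_add_iff (f := f) m).1 h1
    rw [h2, add_zero] at h3
    rw [aeval_monomial]
    exact h3

theorem hasSum_coeff_coe (t : ℝ) (p : ℚ[X]) :
    HasSum (fun n => ((PowerSeries.coeff n (p : PowerSeries ℚ) : ℚ) : ℝ) * t ^ n) (aeval t p) := by
  have h1 : HasSum (fun n => ((PowerSeries.coeff n (1 : PowerSeries ℚ) : ℚ) : ℝ) * t ^ n) 1 := by
    convert! hasSum_ite_eq (0 : ℕ) (1 : ℝ) using 2 with n
    rw [PowerSeries.coeff_one]
    split_ifs with hn <;> simp [hn]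
  simpa using hasSum_coeff_mul h1 p

theorem exists_eq_one_sub_pow_mul {p : ℚ[X]} (hp : p ≠ 0) :
    ∃ (b : ℕ) (p₁ : ℚ[X]), p = (1 - X) ^ b * p₁ ∧ p₁.eval 1 ≠ 0 := by
  obtain ⟨g, hg, hd⟩ := exists_eq_pow_rootMultiplicity_mul_and_not_dvd p hp 1
  refine ⟨p.rootMultiplicity 1, (-1) ^ p.rootMultiplicity 1 * g, ?_, ?_⟩
  · rw [← mul_assoc, ← mul_pow]
    simpa [sub_eq_add_neg, add_comm] using hg
  · have : g.eval 1 ≠ 0 := fun h => hd (dvd_iff_isRoot.2 h)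
    simp [this]

/-- A power series whose coefficients `aₙ` lie between positive multiples of `(n + 1) ^ s` (the
lower bound being required along an arithmetic progression of a nondecreasing sequence) is squeezed
between positive multiples of `(1 - t) ^ (-(s + 1))`. -/
theorem exists_sum_bounds {a : ℕ → ℕ} {s r D e C : ℕ} (hD : 0 < D)
    (hlow : ∀ n, (n + 1) ^ s ≤ r * a (n * D + e)) (hup : ∀ n, a n ≤ C * (n + 1) ^ s) :
    ∃ κ C' : ℝ, 0 < κ ∧ ∀ t : ℝ, 0 < t → t < 1 → ∃ σ : ℝ, HasSum (fun n => (a n : ℝ) * t ^ n) σ ∧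
      κ * t ^ e ≤ σ * (1 - t) ^ (s + 1) ∧ σ * (1 - t) ^ (s + 1) ≤ C' := by
  have hr : 0 < r := by
    rcases Nat.eq_zero_or_pos r with h | h
    · have := hlow 0
      simp [h] at this
    · exact h
  refine ⟨1 / (r * (D : ℝ) ^ (s + 1)), C * s.factorial, by positivity, fun t ht ht1 => ?_⟩
  have hup' := (hasSum_choose_mul_geometric_of_norm_lt_one s (r := t)
    (by rw [Real.norm_eq_abs, abs_of_pos ht]; exact ht1)).mul_left ((C : ℝ) * s.factorial)
  have hle : ∀ n, (a n : ℝ) * t ^ n ≤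
      (C : ℝ) * s.factorial * (((n + s).choose s : ℕ) * t ^ n) := fun n => by
    have h1 : (a n : ℝ) ≤ (C * s.factorial : ℝ) * ((n + s).choose s : ℕ) := by
      have := (hup n).trans (Nat.mul_le_mul_left C (succ_pow_le_factorial_mul_choose n s))
      rw [← mul_assoc] at this
      exact_mod_cast this
    calc _ ≤ ((C * s.factorial : ℝ) * ((n + s).choose s : ℕ)) * t ^ n := by gcongr
      _ = _ := by ring
  have hsum : Summable (fun n => (a n : ℝ) * t ^ n) :=
    Summable.of_nonneg_of_le (fun n => by positivity) hle hup'.summable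
  have h1t : 0 < 1 - t := by linarith
  refine ⟨_, hsum.hasSum, ?_, ?_⟩
  · have htD : t ^ D < 1 := pow_lt_one₀ ht.le ht1 hD.ne'
    have hlow' := (hasSum_choose_mul_geometric_of_norm_lt_one s (r := t ^ D)
      (by rw [Real.norm_eq_abs, abs_of_pos (by positivity)]; exact htD)).mul_left (t ^ e / r)
    have hinj : Function.Injective fun n : ℕ => n * D + e := fun m n h => by
      have : m * D = n * D := by simpa using h
      exact Nat.eq_of_mul_eq_mul_right hD this
    have h2 : t ^ e / r * (1 / (1 - t ^ D) ^ (s + 1)) ≤ ∑' n, (a n : ℝ) * t ^ n := by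
      rw [← hlow'.tsum_eq]
      refine Summable.tsum_le_tsum_of_inj (fun n => n * D + e) hinj
        (fun n _ => by positivity) (fun n => ?_) hlow'.summable hsum
      have h3 : (((n + s).choose s : ℕ) : ℝ) ≤ r * a (n * D + e) := by
        exact_mod_cast (choose_le_succ_pow n s).trans (hlow n)
      calc t ^ e / r * (((n + s).choose s : ℕ) * (t ^ D) ^ n)
          ≤ t ^ e / r * (r * a (n * D + e) * (t ^ D) ^ n) := by gcongr
        _ = a (n * D + e) * t ^ (n * D + e) := by
            rw [pow_add, mul_comm n D, pow_mul]
            field_simp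
    have h4 : 1 - t ^ D ≤ D * (1 - t) := by
      have := one_add_mul_le_pow (a := t - 1) (by linarith) D
      rw [add_sub_cancel] at this
      linarith
    have h5 : 0 < 1 - t ^ D := by linarith
    calc 1 / (r * (D : ℝ) ^ (s + 1)) * t ^ e
        = t ^ e / r * (1 / (D * (1 - t)) ^ (s + 1)) * (1 - t) ^ (s + 1) := by
          rw [mul_pow]; field_simp
      _ ≤ t ^ e / r * (1 / (1 - t ^ D) ^ (s + 1)) * (1 - t) ^ (s + 1) := by gcongr
      _ ≤ _ := by gcongr
  · have h2 := hsum.tsum_le_tsum hle hup'.summable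
    rw [hup'.tsum_eq] at h2
    calc _ ≤ (C : ℝ) * s.factorial * (1 / (1 - t) ^ (s + 1)) * (1 - t) ^ (s + 1) := by gcongr
      _ = _ := by field_simp

/-- A rational function `p / ((1 - X) ^ (m + 1) q)` whose expansion has nonnegative coefficients
that grow like `n ^ s` has a pole of order `s + 1` at `1`, with positive leading coefficient. -/
theorem pole_of_growth {a : ℕ → ℕ} {s r D e C : ℕ} (hD : 0 < D)
    (hlow : ∀ n, (n + 1) ^ s ≤ r * a (n * D + e)) (hup : ∀ n, a n ≤ C * (n + 1) ^ s)
    {m : ℕ} {q p : ℚ[X]} (hq : 0 < q.eval 1)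
    (h : (PowerSeries.mk fun n => (a n : ℚ)) * (((1 - X) ^ (m + 1) * q : ℚ[X]) : PowerSeries ℚ) =
      (p : PowerSeries ℚ)) :
    ∃ b p₁, m = b + s ∧ p = (1 - X) ^ b * p₁ ∧ 0 < p₁.eval 1 := by
  have hp : p ≠ 0 := by
    rintro rfl
    rw [Polynomial.coe_zero, mul_eq_zero] at h
    rcases h with h | h
    · have h1 := congrArg (PowerSeries.coeff (0 * D + e)) h
      rw [PowerSeries.coeff_mk, map_zero, Nat.cast_eq_zero] at h1
      have h2 := hlow 0
      rw [h1] at h2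
      simp at h2
    · rw [Polynomial.coe_eq_zero_iff, mul_eq_zero] at h
      rcases h with h | h
      · have := congrArg (eval 0) h
        simp at this
      · rw [h] at hq; simp at hq
  obtain ⟨b, p₁, hpp, hp1⟩ := exists_eq_one_sub_pow_mul hp
  obtain ⟨κ, C', hκ, hσ⟩ := exists_sum_bounds hD hlow hup
  -- `w t = (1 - t) ^ (s + 1) ∑ aₙ t ^ n` lies between positive constants near `1`
  have key : ∀ t : ℝ, 0 < t → t < 1 → ∃ w, κ * t ^ e ≤ w ∧ w ≤ C' ∧
      (1 - t) ^ (b + s) * aeval t p₁ = w * (1 - t) ^ m * aeval t q := by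
    intro t ht ht1
    obtain ⟨σ, hs, h1, h2⟩ := hσ t ht ht1
    refine ⟨_, h1, h2, ?_⟩
    have h3 := hasSum_coeff_mul (A := PowerSeries.mk fun n => (a n : ℚ)) (t := t) (σ := σ)
      (by simpa using hs) ((1 - X) ^ (m + 1) * q)
    rw [h] at h3
    have h4 := h3.unique (hasSum_coeff_coe t p)
    rw [hpp] at h4
    simp only [map_mul, map_pow, map_sub, map_one, aeval_X] at h4
    rw [pow_add, mul_right_comm, ← h4]
    ring
  have heval : ∀ f : ℚ[X], aeval (1 : ℝ) f = ((f.eval 1 : ℚ) : ℝ) := fun f => by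
    have := aeval_algebraMap_apply ℝ (1 : ℚ) f
    simpa using this
  have hcont : ∀ f : ℚ[X], Tendsto (fun t : ℝ => aeval t f) (𝓝[<] 1) (𝓝 ((f.eval 1 : ℚ) : ℝ)) := by
    intro f
    have := (f.continuous_aeval (A := ℝ)).tendsto 1
    rw [heval] at this
    exact this.mono_left nhdsWithin_le_nhds
  have hne : ∀ᶠ t : ℝ in 𝓝[<] 1, 0 < t ∧ t < 1 := by
    filter_upwards [Ioo_mem_nhdsLT (zero_lt_one (α := ℝ))] with t ht using ht
  have hpow : ∀ i : ℕ, Tendsto (fun t : ℝ => (1 - t) ^ (i + 1)) (𝓝[<] 1) (𝓝 0) := by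
    intro i
    have h1 : Continuous fun t : ℝ => (1 - t) ^ (i + 1) := by fun_prop
    have := h1.tendsto 1
    simp only [sub_self, ne_eq, Nat.add_eq_zero_iff, one_ne_zero, and_false, not_false_eq_true,
      zero_pow] at this
    exact this.mono_left nhdsWithin_le_nhds
  have hqpos : ∀ᶠ t : ℝ in 𝓝[<] 1, 0 < aeval t q :=
    (hcont q).eventually (lt_mem_nhds (by exact_mod_cast hq))
  have hlowlim : Tendsto (fun t : ℝ => κ * t ^ e * aeval t q) (𝓝[<] 1)
      (𝓝 (κ * (q.eval 1 : ℚ))) := by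
    have h1 : Tendsto (fun t : ℝ => κ * t ^ e) (𝓝[<] 1) (𝓝 (κ * 1 ^ e)) :=
      ((continuous_const.mul (continuous_id.pow e)).tendsto 1).mono_left nhdsWithin_le_nhds
    rw [one_pow, mul_one] at h1
    exact h1.mul (hcont q)
  have hκq : 0 < κ * ((q.eval 1 : ℚ) : ℝ) := mul_pos hκ (by exact_mod_cast hq)
  rcases lt_trichotomy m (b + s) with hlt | heq | hgt
  · -- the left-hand side of `key` would vanish to higher order
    exfalso
    obtain ⟨i, hi⟩ := Nat.exists_eq_add_of_lt hlt
    have h1 : Tendsto (fun t : ℝ => (1 - t) ^ (i + 1) * aeval t p₁) (𝓝[<] 1) (𝓝 0) := by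
      simpa using (hpow i).mul (hcont p₁)
    refine absurd (le_of_tendsto_of_tendsto hlowlim h1 ?_) (not_le.2 hκq)
    filter_upwards [hne, hqpos] with t ht hqt
    obtain ⟨w, hw1, -, hw⟩ := key t ht.1 ht.2
    have h1t : 0 < (1 - t) ^ m := pow_pos (by linarith [ht.2]) m
    have h2 : (1 - t) ^ (i + 1) * aeval t p₁ = w * aeval t q := by
      refine mul_left_cancel₀ h1t.ne' ?_
      rw [← mul_assoc, ← pow_add, ← add_assoc, ← hi, hw]
      ring
    rw [h2]
    gcongr
  · refine ⟨b, p₁, heq, hpp, ?_⟩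
    have h1 : κ * ((q.eval 1 : ℚ) : ℝ) ≤ ((p₁.eval 1 : ℚ) : ℝ) := by
      refine le_of_tendsto_of_tendsto hlowlim (hcont p₁) ?_
      filter_upwards [hne, hqpos] with t ht hqt
      obtain ⟨w, hw1, -, hw⟩ := key t ht.1 ht.2
      have h1t : 0 < (1 - t) ^ m := pow_pos (by linarith [ht.2]) m
      have h2 : aeval t p₁ = w * aeval t q := by
        refine mul_left_cancel₀ h1t.ne' ?_
        rw [← heq] at hw
        rw [hw]
        ring
      rw [h2]
      gcongr
    exact_mod_cast hκq.trans_le h1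
  · -- `p₁` would vanish at `1`
    exfalso
    obtain ⟨i, hi⟩ := Nat.exists_eq_add_of_lt hgt
    have h1 : Tendsto (fun t : ℝ => C' * ((1 - t) ^ (i + 1) * aeval t q)) (𝓝[<] 1) (𝓝 0) := by
      simpa using ((hpow i).mul (hcont q)).const_mul C'
    have h2 : Tendsto (fun t : ℝ => aeval t p₁) (𝓝[<] 1) (𝓝 0) := by
      refine tendsto_of_tendsto_of_tendsto_of_le_of_le' tendsto_const_nhds h1 ?_ ?_
      all_goals
        filter_upwards [hne, hqpos] with t ht hqt
        obtain ⟨w, hw1, hw2, hw⟩ := key t ht.1 ht.2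
        have h1t : 0 < 1 - t := by linarith [ht.2]
        have h0t : 0 < t := ht.1
        have h3 : aeval t p₁ = w * ((1 - t) ^ (i + 1) * aeval t q) := by
          refine mul_left_cancel₀ (pow_pos h1t (b + s)).ne' ?_
          rw [hw, hi]
          ring
        rw [h3]
      · have : 0 ≤ w := le_trans (by positivity) hw1
        positivity
      · gcongr
    have := tendsto_nhds_unique h2 (hcont p₁)
    exact hp1 (by exact_mod_cast this.symm)

end pole

section poleOfHilbertSeries

open Polynomial

/-- The Hilbert series of a nonzero finitely generated graded module `M` has at `1` a pole of order
`dim M`, with positive leading coefficient. -/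
theorem hilbertSeries_pole {k : Type u} {R : Type v} [Field k] [CommRing R] [Algebra k R]
    [Algebra.FiniteType k R] {𝒜 : ℕ → Submodule k R} [GradedAlgebra 𝒜] (h𝒜 : 𝒜 0 = 1)
    {M : Type w} [AddCommGroup M] [Module k M] [Module R M] [IsScalarTower k R M]
    {ℳ : ℤ → Submodule k M} (hℳ : IsGradedModule 𝒜 ℳ) [Module.Finite R M] [Nontrivial M] :
    ∃ (s : ℕ) (P Q : ℚ[X]), Module.supportDim R M = s ∧ 0 < P.eval 1 ∧ 0 < Q.eval 1 ∧
      toLaurent ((1 - X) ^ s * Q) * hilbertSeries ℳ = toLaurent P := by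
  obtain ⟨s, φ, hs, hφ, q', g, hg⟩ := exists_normalization k (R := R) M
  obtain ⟨c, hc⟩ := exists_bddBelow hℳ
  obtain ⟨m, q, a₀, p₀, hq, hp₀⟩ := exists_hilbertSerre h𝒜 hℳ
  set a := a₀ + (-c).toNat
  set p := X ^ (-c).toNat * p₀ with hpdef
  have hp : toLaurent X ^ a * hilbertSeries ℳ * toLaurent ((1 - X) ^ m * q) = toLaurent p := by
    rw [hpdef, map_mul toLaurent (X ^ _) p₀, ← hp₀, map_pow, pow_add]
    ring
  have hca : ∀ j < -(a : ℤ), ℳ j = ⊥ := fun j hj => hc j (by omega)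
  have hcoeff := coeff_hilbertSeries ⟨c, hc⟩
  have hF := X_pow_mul_eq_ofPowerSeries (f := hilbertSeries ℳ) (a := a)
    fun j hj => by rw [hcoeff, hca j hj]; simp
  obtain ⟨C, hup⟩ := exists_sum_finrank_le h𝒜 hℳ hca hg
  obtain ⟨r, D, e, hD, hlow⟩ := exists_le_sum_finrank h𝒜 hℳ hca hφ
  set f : ℕ → ℕ := fun n => Module.finrank k (ℳ (-(a : ℤ) + n)) with hf
  have hps : (PowerSeries.mk fun n => ((∑ i ∈ Finset.range (n + 1), f i : ℕ) : ℚ)) *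
      (((1 - X) ^ (m + 1) * q : ℚ[X]) : PowerSeries ℚ) = (p : PowerSeries ℚ) := by
    have h1 : (PowerSeries.mk fun n => ((∑ i ∈ Finset.range (n + 1), f i : ℕ) : ℚ)) *
        (1 - PowerSeries.X) = PowerSeries.mk fun n => (hilbertSeries ℳ).coeff (-(a : ℤ) + n) := by
      ext n
      rw [mul_sub, mul_one, map_sub]
      cases n with
      | zero => simp [hcoeff, hf]
      | succ n =>
        rw [PowerSeries.coeff_succ_mul_X, PowerSeries.coeff_mk, PowerSeries.coeff_mk,
          PowerSeries.coeff_mk, Finset.sum_range_succ _ (n + 1), hcoeff]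
        simp [hf]
    apply HahnSeries.ofPowerSeries_injective (Γ := ℤ) (R := ℚ)
    rw [← toLaurent_apply p, ← hp, hF, ← h1, toLaurent_apply, ← map_mul]
    congr 1
    push_cast
    ring
  obtain ⟨b, p₁, hm, hpp, hp1⟩ := pole_of_growth (a := fun n => ∑ i ∈ Finset.range (n + 1), f i)
    (s := s) (r := r) (D := D) (e := e) (C := C) hD
    (fun n => (hlow n).trans (Nat.mul_le_mul_left r (Finset.sum_le_sum_of_subset
      (Finset.range_mono (Nat.le_succ _))))) hup hq hps
  refine ⟨s, p₁, X ^ a * q, hs, hp1, by simpa using hq, ?_⟩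
  have hne : toLaurent ((1 - X) ^ b) ≠ 0 := by
    intro h0
    have h1 : ((1 - X : ℚ[X]) ^ b) = 0 := by
      have h2 : HahnSeries.ofPowerSeries ℤ ℚ (((1 - X : ℚ[X]) ^ b : ℚ[X]) : PowerSeries ℚ) =
        HahnSeries.ofPowerSeries ℤ ℚ 0 := by rw [map_zero]; exact h0
      exact Polynomial.coe_eq_zero_iff.1 (HahnSeries.ofPowerSeries_injective h2)
    have := congrArg (eval 0) h1
    simp at this
  refine mul_left_cancel₀ hne ?_
  rw [← map_mul, ← hpp, ← hp, hm]
  simp only [map_mul, map_pow]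
  ring

end poleOfHilbertSeries

/-! ### Homology of complexes of vector spaces -/

section homology

variable {k : Type*} [Field k]

/-- The cycles of a complex `⋯ → A₂ → A₁ → A₀`. -/
def cyc {A : ℕ → Type*} [∀ i, AddCommGroup (A i)] [∀ i, Module k (A i)]
    (d : ∀ i, A (i + 1) →ₗ[k] A i) : (i : ℕ) → Submodule k (A i)
  | 0 => ⊤
  | i + 1 => LinearMap.ker (d i)

/-- The homology of a complex `⋯ → A₂ → A₁ → A₀`. -/
abbrev Homology {A : ℕ → Type*} [∀ i, AddCommGroup (A i)] [∀ i, Module k (A i)]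
    (d : ∀ i, A (i + 1) →ₗ[k] A i) (i : ℕ) :=
  cyc d i ⧸ (LinearMap.range (d i)).submoduleOf (cyc d i)

variable {A B C : ℕ → Type*}
  [∀ i, AddCommGroup (A i)] [∀ i, Module k (A i)]
  [∀ i, AddCommGroup (B i)] [∀ i, Module k (B i)]
  [∀ i, AddCommGroup (C i)] [∀ i, Module k (C i)]
  {dA : ∀ i, A (i + 1) →ₗ[k] A i} {dB : ∀ i, B (i + 1) →ₗ[k] B i} {dC : ∀ i, C (i + 1) →ₗ[k] C i}

theorem map_mem_cyc (f : ∀ i, A i →ₗ[k] B i) (hf : ∀ i a, f i (dA i a) = dB i (f (i + 1) a))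
    (i : ℕ) : ∀ a ∈ cyc dA i, f i a ∈ cyc dB i := by
  intro a ha
  cases i with
  | zero => trivial
  | succ i =>
    have ha : dA i a = 0 := ha
    change dB i _ = 0
    rw [← hf, ha, map_zero]

theorem mem_cyc_of_map_mem (f : ∀ i, A i →ₗ[k] B i)
    (hf : ∀ i a, f i (dA i a) = dB i (f (i + 1) a)) (hinj : ∀ i, Function.Injective (f i))
    (i : ℕ) (a : A i) (ha : f i a ∈ cyc dB i) : a ∈ cyc dA i := by
  cases i with
  | zero => trivial
  | succ i =>
    have ha : dB i (f (i + 1) a) = 0 := ha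
    change dA i a = 0
    apply hinj i
    rw [hf, ha, map_zero]

theorem d_mem_cyc (hdd : ∀ i b, dB i (dB (i + 1) b) = 0) (i : ℕ) (b : B (i + 1)) :
    dB i b ∈ cyc dB i := by
  cases i with
  | zero => trivial
  | succ i => exact hdd i b

/-- A linear map on the cycles whose kernel consists of the boundaries identifies the homology with
its range. -/
theorem nonempty_homology_equiv_range {d : ∀ i, A (i + 1) →ₗ[k] A i} {i : ℕ} {V : Type*}
    [AddCommGroup V] [Module k V] (Φ : cyc d i →ₗ[k] V)
    (h : ∀ t, Φ t = 0 ↔ ∃ p, d i p = t) : Nonempty (Homology d i ≃ₗ[k] LinearMap.range Φ) := by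
  have hker : LinearMap.ker Φ = (LinearMap.range (d i)).submoduleOf (cyc d i) := by
    ext t
    exact h t
  exact ⟨Submodule.quotEquivOfEq _ _ hker.symm ≪≫ₗ Φ.quotKerEquivRange⟩

/-- The map on homology induced by a map of complexes. -/
def homologyMap (f : ∀ i, A i →ₗ[k] B i) (hf : ∀ i a, f i (dA i a) = dB i (f (i + 1) a))
    (i : ℕ) : Homology dA i →ₗ[k] Homology dB i :=
  Submodule.mapQ _ _ ((f i).restrict (map_mem_cyc f hf i)) (by
    rintro ⟨a, ha⟩ ⟨a', ha'⟩
    exact ⟨f (i + 1) a', by rw [← hf, ha']; rfl⟩)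

/-- Part of the long exact homology sequence: if `B` is exact in degree `i + 1`, then `H_{i+1}(C)`
is the kernel of `H_i(A) → H_i(B)`. -/
theorem nonempty_homology_succ_equiv (f : ∀ i, A i →ₗ[k] B i) (g : ∀ i, B i →ₗ[k] C i)
    (hf : ∀ i a, f i (dA i a) = dB i (f (i + 1) a))
    (hg : ∀ i b, g i (dB i b) = dC i (g (i + 1) b))
    (hinj : ∀ i, Function.Injective (f i)) (hexact : ∀ i, Function.Exact (f i) (g i))
    (hsurj : ∀ i, Function.Surjective (g i)) (hdd : ∀ i b, dB i (dB (i + 1) b) = 0)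
    (i : ℕ) (hB : Function.Exact (dB (i + 1)) (dB i)) :
    Nonempty (Homology dC (i + 1) ≃ₗ[k] LinearMap.ker (homologyMap f hf i)) := by
  let E : Submodule k (B (i + 1)) := LinearMap.ker (dC i ∘ₗ g (i + 1))
  have hE : ∀ b ∈ E, dB i b ∈ LinearMap.range (f i) := fun b hb => by
    rw [LinearMap.mem_range]
    refine (hexact i _).1 ?_
    rw [hg]; exact hb
  let inv := (LinearEquiv.ofInjective (f i) (hinj i)).symm
  have hinv : ∀ y, f i (inv y) = y := fun y =>
    congrArg Subtype.val ((LinearEquiv.ofInjective (f i) (hinj i)).apply_symm_apply y)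
  let β₀ : E →ₗ[k] A i := inv.toLinearMap ∘ₗ (dB i).restrict hE
  have hβ₀ : ∀ b, f i (β₀ b) = dB i b := fun b => hinv _
  have hβcyc : ∀ b, β₀ b ∈ cyc dA i := fun b =>
    mem_cyc_of_map_mem f hf hinj i _ (by rw [hβ₀]; exact d_mem_cyc hdd i b)
  let β : E →ₗ[k] Homology dA i := Submodule.mkQ _ ∘ₗ β₀.codRestrict _ hβcyc
  let α : E →ₗ[k] Homology dC (i + 1) :=
    Submodule.mkQ _ ∘ₗ (g (i + 1)).restrict (q := cyc dC (i + 1)) (fun b hb => hb)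
  have hα : Function.Surjective α := by
    refine (Submodule.mkQ_surjective _).comp ?_
    rintro ⟨c, hc⟩
    obtain ⟨b, rfl⟩ := hsurj (i + 1) c
    exact ⟨⟨b, hc⟩, rfl⟩
  have hker : LinearMap.ker α = LinearMap.ker β := by
    ext b
    constructor
    · intro hb
      obtain ⟨c, hc⟩ := (Submodule.Quotient.mk_eq_zero _).1 hb
      obtain ⟨b', rfl⟩ := hsurj _ c
      have hc' : g (i + 1) (b - dB (i + 1) b') = 0 := by
        rw [map_sub, hg, hc]; exact sub_self _
      obtain ⟨a, ha⟩ := (hexact (i + 1) _).1 hc'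
      refine (Submodule.Quotient.mk_eq_zero _).2 ⟨a, hinj i ?_⟩
      change f i (dA i a) = f i (β₀ b)
      rw [hβ₀, hf, ha, map_sub, hdd, sub_zero]
    · intro hb
      obtain ⟨a, ha⟩ := (Submodule.Quotient.mk_eq_zero _).1 hb
      have ha : dA i a = β₀ b := ha
      have h1 : dB i (b - f (i + 1) a) = 0 := by rw [map_sub, ← hf, ha, hβ₀, sub_self]
      obtain ⟨b', hb'⟩ := (hB _).1 h1
      refine (Submodule.Quotient.mk_eq_zero _).2 ⟨g _ b', ?_⟩
      change dC (i + 1) (g _ b') = g (i + 1) b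
      rw [← hg, hb', map_sub, (hexact (i + 1)).apply_apply_eq_zero, sub_zero]
  have hrange : LinearMap.range β = LinearMap.ker (homologyMap f hf i) := by
    ext z
    constructor
    · rintro ⟨b, rfl⟩
      exact (Submodule.Quotient.mk_eq_zero _).2 ⟨b, (hβ₀ b).symm⟩
    · obtain ⟨⟨a, ha⟩, rfl⟩ := Submodule.mkQ_surjective _ z
      intro hz
      obtain ⟨b, hb⟩ := (Submodule.Quotient.mk_eq_zero _).1 hz
      have hb : dB i b = f i a := hb
      have hbE : b ∈ E := by
        change dC i (g (i + 1) b) = 0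
        rw [← hg, hb, (hexact i).apply_apply_eq_zero]
      refine ⟨⟨b, hbE⟩, congrArg (Submodule.mkQ _) (Subtype.ext (hinj i ?_))⟩
      exact (hβ₀ ⟨b, hbE⟩).trans hb
  exact ⟨(α.quotKerEquivOfSurjective hα).symm ≪≫ₗ Submodule.quotEquivOfEq _ _ hker ≪≫ₗ
    β.quotKerEquivRange ≪≫ₗ LinearEquiv.ofEq _ _ hrange⟩

/-- The end of the long exact homology sequence: `H_0(C)` is the cokernel of `H_0(A) → H_0(B)`. -/
theorem nonempty_homology_zero_equiv (f : ∀ i, A i →ₗ[k] B i) (g : ∀ i, B i →ₗ[k] C i)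
    (hf : ∀ i a, f i (dA i a) = dB i (f (i + 1) a))
    (hg : ∀ i b, g i (dB i b) = dC i (g (i + 1) b))
    (hexact : ∀ i, Function.Exact (f i) (g i)) (hsurj : ∀ i, Function.Surjective (g i)) :
    Nonempty ((Homology dB 0 ⧸ LinearMap.range (homologyMap f hf 0)) ≃ₗ[k] Homology dC 0) := by
  have hker : LinearMap.ker (homologyMap g hg 0) = LinearMap.range (homologyMap f hf 0) := by
    ext z
    obtain ⟨⟨b, hb⟩, rfl⟩ := Submodule.mkQ_surjective _ z
    constructor
    · intro hz
      obtain ⟨c, hc⟩ := (Submodule.Quotient.mk_eq_zero _).1 hz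
      obtain ⟨b', rfl⟩ := hsurj _ c
      have hc : dC 0 (g 1 b') = g 0 b := hc
      have h1 : g 0 (b - dB 0 b') = 0 := by rw [map_sub, hg, hc, sub_self]
      obtain ⟨a, ha⟩ := (hexact 0 _).1 h1
      refine ⟨Submodule.mkQ _ ⟨a, trivial⟩, ?_⟩
      refine (Submodule.Quotient.eq _).2 ⟨-b', ?_⟩
      change dB 0 (-b') = f 0 a - b
      rw [ha, map_neg]; abel
    · rintro ⟨a, ha⟩
      obtain ⟨⟨a, ha'⟩, rfl⟩ := Submodule.mkQ_surjective _ a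
      rw [LinearMap.mem_ker, ← ha]
      refine (Submodule.Quotient.mk_eq_zero _).2 ⟨0, ?_⟩
      rw [map_zero]
      exact ((hexact 0).apply_apply_eq_zero a).symm
  have hs : Function.Surjective (homologyMap g hg 0) := by
    intro z
    obtain ⟨⟨c, hc⟩, rfl⟩ := Submodule.mkQ_surjective _ z
    obtain ⟨b, rfl⟩ := hsurj _ c
    exact ⟨Submodule.mkQ _ ⟨b, trivial⟩, rfl⟩
  exact ⟨Submodule.quotEquivOfEq _ _ hker.symm ≪≫ₗ
    (homologyMap g hg 0).quotKerEquivOfSurjective hs⟩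

end homology

/-! ### The homogeneous parts of `Tor` -/

section tor

variable {k : Type u} {R : Type v} [Field k] [CommRing R] [Algebra k R]
  {𝒜 : ℕ → Submodule k R} {M : Type w} [AddCommGroup M] [Module k M] [Module R M]
  {ℳ : ℤ → Submodule k M} (F : GradedResolution.{u, v, w, x} 𝒜 ℳ)
  {N : Type y} [AddCommGroup N] [Module k N] [Module R N] [IsScalarTower k R N]
  (𝒩 : ℤ → Submodule k N)

/-- The part of degree `j` of the complex `F ⊗ N`. -/
abbrev DegreePart (j : ℤ) (i : ℕ) : Type _ := tensorGrading R (F.grading i) 𝒩 j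

/-- The differential of the part of degree `j` of the complex `F ⊗ N`. -/
def degreeD (j : ℤ) (i : ℕ) : DegreePart F 𝒩 j (i + 1) →ₗ[k] DegreePart F 𝒩 j i :=
  (((F.d i).rTensor N).restrictScalars k).restrict
    (fun t ht => rTensor_mem_tensorGrading (F.d i) (F.d_mem i) j t ht)

theorem coe_degreeD (j : ℤ) (i : ℕ) (t : DegreePart F 𝒩 j (i + 1)) :
    (degreeD F 𝒩 j i t : F.X i ⊗[R] N) = (F.d i).rTensor N t := rfl

theorem degreeD_degreeD (j : ℤ) (i : ℕ) (t : DegreePart F 𝒩 j (i + 2)) :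
    degreeD F 𝒩 j i (degreeD F 𝒩 j (i + 1) t) = 0 := by
  apply Subtype.ext
  rw [coe_degreeD, coe_degreeD, ← LinearMap.comp_apply, ← LinearMap.rTensor_comp,
    (F.exact_succ i).linearMap_comp_eq_zero, LinearMap.rTensor_zero]
  rfl

theorem mem_cyc_degreeD (j : ℤ) (i : ℕ) (t : DegreePart F 𝒩 j i) :
    t ∈ cyc (A := DegreePart F 𝒩 j) (degreeD F 𝒩 j) i ↔ (t : F.X i ⊗[R] N) ∈ F.cycles N i := by
  cases i with
  | zero => exact ⟨fun _ => trivial, fun _ => trivial⟩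
  | succ i => exact ⟨fun h => congrArg Subtype.val h, fun h => Subtype.ext h⟩

variable {𝒩}

/-- The part of degree `j` of `Tor` is the homology of the part of degree `j` of `F ⊗ N`. -/
theorem nonempty_torGrading_equiv [GradedAlgebra 𝒜] (h𝒩 : IsGradedModule 𝒜 𝒩) (j : ℤ) (i : ℕ) :
    Nonempty (F.torGrading 𝒩 i j ≃ₗ[k] Homology (A := DegreePart F 𝒩 j) (degreeD F 𝒩 j) i) := by
  let Φ : cyc (A := DegreePart F 𝒩 j) (degreeD F 𝒩 j) i →ₗ[k] F.Tor N i :=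
    (((F.boundaries N i).submoduleOf (F.cycles N i)).mkQ.restrictScalars k) ∘ₗ
      (LinearMap.codRestrict ((F.cycles N i).restrictScalars k)
        ((tensorGrading R (F.grading i) 𝒩 j).subtype ∘ₗ
          (cyc (A := DegreePart F 𝒩 j) (degreeD F 𝒩 j) i).subtype)
        fun t => (mem_cyc_degreeD F 𝒩 j i t).1 t.2)
  have hrange : LinearMap.range Φ = F.torGrading 𝒩 i j := by
    ext z
    constructor
    · rintro ⟨t, rfl⟩
      exact ⟨⟨t, (mem_cyc_degreeD F 𝒩 j i t).1 t.2⟩, t.1.2, rfl⟩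
    · rintro ⟨t, ht, rfl⟩
      exact ⟨⟨⟨t, ht⟩, (mem_cyc_degreeD F 𝒩 j i ⟨t, ht⟩).2 t.2⟩, rfl⟩
  have hker : ∀ t, Φ t = 0 ↔ ∃ p, degreeD F 𝒩 j i p = t := by
    intro t
    have h0 : Φ t = 0 ↔ (t.1.1 : F.X i ⊗[R] N) ∈ F.boundaries N i :=
      Submodule.Quotient.mk_eq_zero ((F.boundaries N i).submoduleOf (F.cycles N i))
    rw [h0]
    constructor
    · intro h
      obtain ⟨p, hp, hpt⟩ := exists_homogeneous_preimage
        (isInternal_tensorGrading (F.isGradedModule (i + 1)) h𝒩)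
        (isInternal_tensorGrading (F.isGradedModule i) h𝒩)
        (((F.d i).rTensor N).restrictScalars k)
        (fun j t ht => rTensor_mem_tensorGrading (F.d i) (F.d_mem i) j t ht) t.1.2 h
      exact ⟨⟨p, hp⟩, Subtype.ext hpt⟩
    · rintro ⟨p, hp⟩
      exact ⟨p, congrArg Subtype.val hp⟩
  obtain ⟨e⟩ := nonempty_homology_equiv_range Φ hker
  exact ⟨LinearEquiv.ofEq _ _ hrange.symm ≪≫ₗ e.symm⟩

/-! ### `Tor` of a graded free module -/

section free

variable {B : Type*} [Finite B] [DecidableEq B] (deg : B → ℤ)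

/-- Under `X ⊗ ⨁_b R(-deg b) = ⨁_b X(-deg b)`, the gradings correspond. -/
theorem mem_tensorGrading_free [GradedAlgebra 𝒜] (i : ℕ) (j : ℤ)
    (t : F.X i ⊗[R] (B →₀ R)) :
    t ∈ tensorGrading R (F.grading i) (freeGrading 𝒜 deg) j ↔
      ∀ b, TensorProduct.finsuppScalarRight R R (F.X i) B t b ∈ F.grading i (j - deg b) := by
  classical
  constructor
  · intro ht b
    induction ht using Submodule.span_induction with
    | mem t ht =>
      obtain ⟨a, c, rfl, p, hp, f, hf, rfl⟩ := ht
      rw [TensorProduct.finsuppScalarRight_apply_tmul_apply]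
      have := (F.isGradedModule i).intGrading_smul_mem (hf b) hp
      rwa [show c - deg b + a = a + c - deg b by ring] at this
    | zero => rw [map_zero]; exact zero_mem _
    | add s t _ _ hs ht => rw [map_add]; exact add_mem hs ht
    | smul c t _ ht =>
      rw [← algebraMap_smul R c t, map_smul, Finsupp.smul_apply, algebraMap_smul]
      exact Submodule.smul_mem _ c ht
  · intro ht
    have := Fintype.ofFinite B
    have h1 : t = ∑ b, TensorProduct.finsuppScalarRight R R (F.X i) B t b ⊗ₜ[R]
        Finsupp.single b 1 := by
      apply (TensorProduct.finsuppScalarRight R R (F.X i) B).injective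
      ext b
      rw [map_sum, Finsupp.finsetSum_apply]
      simp [TensorProduct.finsuppScalarRight_apply_tmul_apply, Finsupp.single_apply]
    rw [h1]
    refine Submodule.sum_mem _ fun b _ => ?_
    have h2 : Finsupp.single b (1 : R) ∈ freeGrading 𝒜 deg (deg b) := fun c => by
      by_cases h : b = c
      · subst h
        rw [Finsupp.single_eq_same, sub_self]
        exact SetLike.one_mem_graded 𝒜
      · rw [Finsupp.single_eq_of_ne (Ne.symm h)]
        exact zero_mem _
    have := tmul_mem_tensorGrading (R := R) (ht b) h2
    rwa [sub_add_cancel] at this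

omit [Finite B] in
theorem finsuppScalarRight_rTensor {P Q : Type*} [AddCommGroup P] [Module R P] [AddCommGroup Q]
    [Module R Q] (φ : P →ₗ[R] Q) (t : P ⊗[R] (B →₀ R)) (b : B) :
    TensorProduct.finsuppScalarRight R R Q B (φ.rTensor (B →₀ R) t) b =
      φ (TensorProduct.finsuppScalarRight R R P B t b) := by
  induction t with
  | zero => simp
  | add s t hs ht => simp only [map_add, Finsupp.add_apply, hs, ht]
  | tmul p f => simp

theorem exact_degreeD_free [GradedAlgebra 𝒜] (j : ℤ) (i : ℕ) :
    Function.Exact (degreeD F (freeGrading 𝒜 deg) j (i + 1))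
      (degreeD F (freeGrading 𝒜 deg) j i) := by
  intro z
  constructor
  · intro hz
    have hz' := congrArg Subtype.val hz
    rw [coe_degreeD] at hz'
    have h1 : ∀ b, ∃ p ∈ F.grading (i + 2) (j - deg b), F.d (i + 1) p =
        TensorProduct.finsuppScalarRight R R (F.X (i + 1)) B z b := fun b => by
      refine exists_homogeneous_preimage (F.isGradedModule _).isInternal
        (F.isGradedModule _).isInternal ((F.d (i + 1)).restrictScalars k) (F.d_mem _)
        ((mem_tensorGrading_free F deg _ _ _).1 z.2 b) ((F.exact_succ i _).1 ?_)
      rw [← finsuppScalarRight_rTensor, hz']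
      simp
    choose p hp hpz using h1
    refine ⟨⟨(TensorProduct.finsuppScalarRight R R _ B).symm (Finsupp.equivFunOnFinite.symm p),
      (mem_tensorGrading_free F deg _ _ _).2 fun b => ?_⟩, Subtype.ext ?_⟩
    · rw [LinearEquiv.apply_symm_apply]
      exact hp b
    · rw [coe_degreeD]
      apply (TensorProduct.finsuppScalarRight R R _ B).injective
      ext b
      rw [finsuppScalarRight_rTensor, LinearEquiv.apply_symm_apply]
      exact hpz b
  · rintro ⟨p, rfl⟩
    exact degreeD_degreeD F _ j i p

theorem subsingleton_homology_succ_free [GradedAlgebra 𝒜] (j : ℤ) (i : ℕ) :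
    Subsingleton (Homology (A := DegreePart F (freeGrading 𝒜 deg) j)
      (degreeD F (freeGrading 𝒜 deg) j) (i + 1)) := by
  refine Submodule.Quotient.subsingleton_iff.2 (eq_top_iff.2 ?_)
  rintro ⟨z, hz⟩ -
  exact (exact_degreeD_free F deg j i z).1 hz

theorem nonempty_homology_zero_free_equiv [GradedAlgebra 𝒜] [IsScalarTower k R M]
    (hℳ : IsGradedModule 𝒜 ℳ) (j : ℤ) :
    Nonempty (Homology (A := DegreePart F (freeGrading 𝒜 deg) j)
      (degreeD F (freeGrading 𝒜 deg) j) 0 ≃ₗ[k] ((b : B) → ℳ (j - deg b))) := by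
  let e := TensorProduct.finsuppScalarRight R R (F.X 0) B
  let Φ : cyc (A := DegreePart F (freeGrading 𝒜 deg) j)
      (degreeD F (freeGrading 𝒜 deg) j) 0 →ₗ[k] ((b : B) → ℳ (j - deg b)) :=
    LinearMap.pi fun b => LinearMap.codRestrict (ℳ (j - deg b))
      ((F.aug ∘ₗ Finsupp.lapply b ∘ₗ e.toLinearMap).restrictScalars k ∘ₗ
        (tensorGrading R (F.grading 0) (freeGrading 𝒜 deg) j).subtype ∘ₗ Submodule.subtype _)
      fun t => F.aug_mem _ _ ((mem_tensorGrading_free F deg _ _ _).1 t.1.2 b)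
  have hΦ : ∀ t b, (Φ t b : M) = F.aug (e t.1 b) := fun t b => rfl
  have hsurj : Function.Surjective Φ := by
    intro m
    have h1 : ∀ b, ∃ p ∈ F.grading 0 (j - deg b), F.aug p = m b := fun b =>
      exists_homogeneous_preimage (F.isGradedModule 0).isInternal hℳ.isInternal
        (F.aug.restrictScalars k) F.aug_mem (m b).2 (F.aug_surjective _)
    choose p hp hpm using h1
    refine ⟨⟨⟨e.symm (Finsupp.equivFunOnFinite.symm p),
      (mem_tensorGrading_free F deg _ _ _).2 fun b => ?_⟩, trivial⟩, ?_⟩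
    · rw [LinearEquiv.apply_symm_apply]
      exact hp b
    · ext b
      rw [hΦ, LinearEquiv.apply_symm_apply]
      exact hpm b
  have hker : ∀ t, Φ t = 0 ↔ ∃ p, degreeD F (freeGrading 𝒜 deg) j 0 p = t := by
    intro t
    constructor
    · intro ht
      have h1 : ∀ b, ∃ p ∈ F.grading 1 (j - deg b), F.d 0 p = e t.1 b := fun b => by
        refine exists_homogeneous_preimage (F.isGradedModule _).isInternal
          (F.isGradedModule _).isInternal ((F.d 0).restrictScalars k) (F.d_mem _)
          ((mem_tensorGrading_free F deg _ _ _).1 t.1.2 b) ((F.exact_zero _).1 ?_)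
        have h2 := congrArg Subtype.val (congrFun ht b)
        rw [hΦ] at h2
        exact h2
      choose p hp hpz using h1
      refine ⟨⟨(TensorProduct.finsuppScalarRight R R _ B).symm (Finsupp.equivFunOnFinite.symm p),
        (mem_tensorGrading_free F deg _ _ _).2 fun b => ?_⟩, Subtype.ext ?_⟩
      · rw [LinearEquiv.apply_symm_apply]
        exact hp b
      · rw [coe_degreeD]
        apply e.injective
        ext b
        rw [finsuppScalarRight_rTensor, LinearEquiv.apply_symm_apply]
        exact hpz b
    · rintro ⟨p, hp⟩
      ext b
      rw [hΦ, ← hp, coe_degreeD, finsuppScalarRight_rTensor, F.exact_zero.apply_apply_eq_zero]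
      rfl
  obtain ⟨e'⟩ := nonempty_homology_equiv_range Φ hker
  exact ⟨e' ≪≫ₗ LinearEquiv.ofTop _ (LinearMap.range_eq_top.2 hsurj)⟩

end free

end tor

/-! ### Dimension shifting in the second variable -/

section shift

variable {k : Type u} {R : Type v} [Field k] [CommRing R] [Algebra k R]
  {𝒜 : ℕ → Submodule k R} [GradedAlgebra 𝒜]

/-- A finitely generated graded module vanishing below degree `c` is covered by a finite graded free
module such that the kernel vanishes below degree `c + 1`: take a basis of the part of degree `c`,
and homogeneous generators of larger degree. -/
theorem exists_free_cover (h𝒜 : 𝒜 0 = 1)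
    {N : Type y} [AddCommGroup N] [Module k N] [Module R N] [IsScalarTower k R N]
    [Algebra.FiniteType k R] [Module.Finite R N]
    {𝒩 : ℤ → Submodule k N} (h𝒩 : IsGradedModule 𝒜 𝒩) {c : ℤ} (hc : ∀ j < c, 𝒩 j = ⊥) :
    ∃ (B : Type) (_ : Fintype B) (_ : DecidableEq B) (deg : B → ℤ) (φ : (B →₀ R) →ₗ[R] N),
      (∀ b, c ≤ deg b) ∧ Function.Surjective φ ∧
      (∀ j, ∀ p ∈ freeGrading 𝒜 deg j, φ p ∈ 𝒩 j) ∧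
      ∀ j < c + 1, subGrading (freeGrading 𝒜 deg) (LinearMap.ker φ) j = ⊥ := by
  classical
  have := finiteDimensional_graded h𝒜 h𝒩 c
  obtain ⟨r, g, d, hg, hspan⟩ := exists_homogeneous_generators h𝒩
  let e := Module.finBasis k (𝒩 c)
  let B := Fin (Module.finrank k (𝒩 c)) ⊕ {l : Fin r // c < d l}
  let gen : B → N := Sum.elim (fun i => (e i : N)) fun l => g l
  let deg : B → ℤ := Sum.elim (fun _ => c) fun l => d l
  have hgen : ∀ b, gen b ∈ 𝒩 (deg b) := by
    rintro (i | l)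
    · exact (e i).2
    · exact hg l
  have hdeg : ∀ b, c ≤ deg b := by
    rintro (i | l)
    · exact le_rfl
    · exact l.2.le
  refine ⟨B, inferInstance, inferInstance, deg, Finsupp.linearCombination R gen, hdeg, ?_,
    linearCombination_mem h𝒩 deg gen hgen, fun j hj => ?_⟩
  · rw [← LinearMap.range_eq_top, Finsupp.range_linearCombination, eq_top_iff, ← hspan,
      Submodule.span_le]
    rintro _ ⟨l, rfl⟩
    rcases lt_trichotomy (d l) c with h | h | h
    · have := hg l
      rw [hc _ h, Submodule.mem_bot] at this
      rw [this]
      exact zero_mem _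
    · have h1 : g l = ∑ i, e.repr ⟨g l, h ▸ hg l⟩ i • (e i : N) := by
        have := congrArg (𝒩 c).subtype (e.sum_repr ⟨g l, h ▸ hg l⟩)
        rw [map_sum] at this
        exact this.symm
      rw [h1]
      refine Submodule.sum_mem _ fun i _ => ?_
      rw [← algebraMap_smul R]
      exact Submodule.smul_mem _ _ (Submodule.subset_span ⟨Sum.inl i, rfl⟩)
    · exact Submodule.subset_span ⟨Sum.inr ⟨l, h⟩, rfl⟩
  · rw [eq_bot_iff]
    rintro ⟨p, hp⟩ hpj
    have hpj : ∀ b, p b ∈ intGrading 𝒜 (j - deg b) := hpj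
    have hp : Finsupp.linearCombination R gen p = 0 := hp
    have hneg : ∀ b, j < deg b → p b = 0 := fun b hb => by
      have h1 := hpj b
      obtain ⟨n, hn⟩ := Int.eq_negSucc_of_lt_zero (show j - deg b < 0 by omega)
      rw [hn] at h1
      simpa [intGrading] using h1
    have hinr : ∀ l, p (Sum.inr l) = 0 := fun l =>
      hneg _ ((Int.le_of_lt_add_one hj).trans_lt l.2)
    have hinl : ∀ i, p (Sum.inl i) = 0 := by
      rcases (Int.le_of_lt_add_one hj).lt_or_eq with hlt | rfl
      · exact fun i => hneg _ hlt
      have hscal : ∀ i, ∃ t : k, algebraMap k R t = p (Sum.inl i) := fun i => by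
        have h1 := hpj (Sum.inl i)
        have h2 : p (Sum.inl i) ∈ 𝒜 0 := by
          rwa [show j - deg (Sum.inl i) = ((0 : ℕ) : ℤ) from sub_self j] at h1
        rw [h𝒜] at h2
        exact Submodule.mem_one.1 h2
      choose t ht using hscal
      rw [Finsupp.linearCombination_apply, Finsupp.sum_fintype _ _ (by simp),
        Fintype.sum_sum_type] at hp
      simp only [hinr, zero_smul, Finset.sum_const_zero, add_zero, ← ht, algebraMap_smul] at hp
      have h3 : ∑ i, t i • e i = 0 := Subtype.ext (by simpa [gen] using hp)
      intro i
      rw [← ht, Fintype.linearIndependent_iff.1 e.linearIndependent t h3 i, map_zero]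
    refine Subtype.ext (Finsupp.ext ?_)
    rintro (i | l)
    · exact hinl i
    · exact hinr l

variable {M : Type w} [AddCommGroup M] [Module k M] [Module R M] [IsScalarTower k R M]
  {ℳ : ℤ → Submodule k M} (F : GradedResolution.{u, v, w, x} 𝒜 ℳ)

omit [IsScalarTower k R M] in
/-- A short exact sequence of graded modules stays exact, degree by degree, after tensoring with a
graded projective resolution. Here the middle term is a graded free module. -/
theorem exists_homology_maps {N : Type y} [AddCommGroup N] [Module k N] [Module R N]
    [IsScalarTower k R N] {𝒩 : ℤ → Submodule k N} (h𝒩 : IsGradedModule 𝒜 𝒩)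
    {B : Type*} [Finite B] [DecidableEq B] {deg : B → ℤ} {φ : (B →₀ R) →ₗ[R] N}
    (hφs : Function.Surjective φ) (hφ : ∀ j, ∀ p ∈ freeGrading 𝒜 deg j, φ p ∈ 𝒩 j)
    {K : Type*} [AddCommGroup K] [Module k K] [Module R K] [IsScalarTower k R K]
    {𝒦 : ℤ → Submodule k K} (h𝒦 : IsGradedModule 𝒜 𝒦) {ι : K →ₗ[R] (B →₀ R)}
    (hι : ∀ j, ∀ q ∈ 𝒦 j, ι q ∈ freeGrading 𝒜 deg j) (hιi : Function.Injective ι)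
    (hιφ : Function.Exact ι φ) (j : ℤ) :
    ∃ ψ : ∀ i, F.torGrading 𝒦 i j →ₗ[k]
        F.torGrading (freeGrading 𝒜 deg) i j,
      (∀ i, Nonempty (F.torGrading 𝒩 (i + 1) j ≃ₗ[k] LinearMap.ker (ψ i))) ∧
      Nonempty ((F.torGrading (freeGrading 𝒜 deg) 0 j ⧸ LinearMap.range (ψ 0)) ≃ₗ[k]
        F.torGrading 𝒩 0 j) := by
  have h𝒢 := isGradedModule_freeGrading 𝒜 deg
  let f : ∀ i, DegreePart F 𝒦 j i →ₗ[k]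
      DegreePart F (freeGrading 𝒜 deg) j i := fun i =>
    ((ι.lTensor (F.X i)).restrictScalars k).restrict
      (lTensor_mem_tensorGrading ι hι j)
  let g : ∀ i, DegreePart F (freeGrading 𝒜 deg) j i →ₗ[k] DegreePart F 𝒩 j i := fun i =>
    ((φ.lTensor (F.X i)).restrictScalars k).restrict (lTensor_mem_tensorGrading φ hφ j)
  have hfv : ∀ i t, (f i t : F.X i ⊗[R] (B →₀ R)) = ι.lTensor (F.X i) t := fun _ _ => rfl
  have hgv : ∀ i t, (g i t : F.X i ⊗[R] N) = φ.lTensor (F.X i) t := fun _ _ => rfl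
  have hf : ∀ i a, f i (degreeD F _ j i a) = degreeD F _ j i (f (i + 1) a) := fun i a => by
    apply Subtype.ext
    rw [hfv, coe_degreeD, coe_degreeD, hfv, ← LinearMap.comp_apply, ← LinearMap.comp_apply,
      LinearMap.lTensor_comp_rTensor, LinearMap.rTensor_comp_lTensor]
  have hg : ∀ i b, g i (degreeD F _ j i b) = degreeD F _ j i (g (i + 1) b) := fun i a => by
    apply Subtype.ext
    rw [hgv, coe_degreeD, coe_degreeD, hgv, ← LinearMap.comp_apply, ← LinearMap.comp_apply,
      LinearMap.lTensor_comp_rTensor, LinearMap.rTensor_comp_lTensor]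
  have hinj : ∀ i, Function.Injective (f i) := fun i a b hab => by
    have := F.projective i
    have h1 := congrArg Subtype.val hab
    rw [hfv, hfv] at h1
    exact Subtype.ext (Module.Flat.lTensor_preserves_injective_linearMap (M := F.X i) ι
      hιi h1)
  have hex : ∀ i, Function.Exact (f i) (g i) := fun i z => by
    have h1 := lTensor_exact (F.X i) hιφ hφs z
    constructor
    · intro hz
      have hz' := congrArg Subtype.val hz
      rw [hgv] at hz'
      obtain ⟨p, hp, hpz⟩ := exists_homogeneous_preimage
        (isInternal_tensorGrading (F.isGradedModule i) h𝒦)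
        (isInternal_tensorGrading (F.isGradedModule i) h𝒢)
        ((ι.lTensor (F.X i)).restrictScalars k)
        (lTensor_mem_tensorGrading ι hι) z.2 (h1.1 hz')
      exact ⟨⟨p, hp⟩, Subtype.ext hpz⟩
    · rintro ⟨p, hp⟩
      apply Subtype.ext
      rw [hgv]
      exact h1.2 ⟨p, congrArg Subtype.val hp⟩
  have hsurj : ∀ i, Function.Surjective (g i) := fun i z => by
    obtain ⟨p, hp, hpz⟩ := exists_homogeneous_preimage
      (isInternal_tensorGrading (F.isGradedModule i) h𝒢)
      (isInternal_tensorGrading (F.isGradedModule i) h𝒩)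
      ((φ.lTensor (F.X i)).restrictScalars k)
      (lTensor_mem_tensorGrading φ hφ) z.2 (LinearMap.lTensor_surjective _ hφs _)
    exact ⟨⟨p, hp⟩, Subtype.ext hpz⟩
  have eK := fun i => (nonempty_torGrading_equiv F h𝒦 j i).some
  have eG := fun i => (nonempty_torGrading_equiv F h𝒢 j i).some
  have eN := fun i => (nonempty_torGrading_equiv F h𝒩 j i).some
  let ψ : ∀ i, F.torGrading 𝒦 i j →ₗ[k]
      F.torGrading (freeGrading 𝒜 deg) i j := fun i =>
    (eG i).symm.toLinearMap ∘ₗ homologyMap f hf i ∘ₗ (eK i).toLinearMap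
  refine ⟨ψ, fun i => ?_, ?_⟩
  · obtain ⟨e⟩ := nonempty_homology_succ_equiv f g hf hg hinj hex hsurj
      (fun i b => degreeD_degreeD F _ j i b) i (exact_degreeD_free F deg j i)
    have h1 : LinearMap.ker (ψ i) = (LinearMap.ker (homologyMap f hf i)).comap
        (eK i).toLinearMap := by
      rw [LinearEquiv.ker_comp, LinearMap.ker_comp]
    exact ⟨eN (i + 1) ≪≫ₗ e ≪≫ₗ ((eK i).ofSubmodule' _).symm ≪≫ₗ LinearEquiv.ofEq _ _ h1.symm⟩
  · obtain ⟨e⟩ := nonempty_homology_zero_equiv f g hf hg hex hsurj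
    have h1 : (LinearMap.range (ψ 0)).map (eG 0).toLinearMap =
        LinearMap.range (homologyMap f hf 0) := by
      rw [← LinearMap.range_comp]
      have h2 : (eG 0).toLinearMap ∘ₗ ψ 0 = homologyMap f hf 0 ∘ₗ (eK 0).toLinearMap := by
        ext1 z
        simp [ψ]
      rw [h2, LinearEquiv.range_comp]
    exact ⟨Submodule.Quotient.equiv _ _ (eG 0) h1 ≪≫ₗ e ≪≫ₗ (eN 0).symm⟩

omit [IsScalarTower k R M] in
theorem torGrading_free_succ {B : Type*} [Finite B] [DecidableEq B] (deg : B → ℤ) (i : ℕ) (j : ℤ) :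
    Subsingleton (F.torGrading (freeGrading 𝒜 deg) (i + 1) j) := by
  obtain ⟨e⟩ := nonempty_torGrading_equiv F (isGradedModule_freeGrading 𝒜 deg) j (i + 1)
  have := subsingleton_homology_succ_free F deg j i
  exact e.toEquiv.subsingleton

theorem torGrading_free_zero (hℳ : IsGradedModule 𝒜 ℳ) {B : Type*} [Finite B] [DecidableEq B]
    (deg : B → ℤ) (j : ℤ) :
    Nonempty (F.torGrading (freeGrading 𝒜 deg) 0 j ≃ₗ[k] ((b : B) → ℳ (j - deg b))) := by
  obtain ⟨e⟩ := nonempty_torGrading_equiv F (isGradedModule_freeGrading 𝒜 deg) j 0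
  obtain ⟨e'⟩ := nonempty_homology_zero_free_equiv F deg hℳ j
  exact ⟨e ≪≫ₗ e'⟩

/-- The relations between the graded pieces of `Tor_i(M, N)` and of `Tor_i(M, K)`, for
`0 → K → ⨁ R(-deg b) → N → 0` a short exact sequence of graded modules. -/
theorem torGrading_step (hℳ : IsGradedModule 𝒜 ℳ) (hfin : ∀ j, FiniteDimensional k (ℳ j))
    {N : Type y} [AddCommGroup N] [Module k N] [Module R N]
    [IsScalarTower k R N] {𝒩 : ℤ → Submodule k N} (h𝒩 : IsGradedModule 𝒜 𝒩)
    {B : Type*} [Fintype B] [DecidableEq B] {deg : B → ℤ} {φ : (B →₀ R) →ₗ[R] N}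
    (hφs : Function.Surjective φ) (hφ : ∀ j, ∀ p ∈ freeGrading 𝒜 deg j, φ p ∈ 𝒩 j)
    {K : Type*} [AddCommGroup K] [Module k K] [Module R K] [IsScalarTower k R K]
    {𝒦 : ℤ → Submodule k K} (h𝒦 : IsGradedModule 𝒜 𝒦) {ι : K →ₗ[R] (B →₀ R)}
    (hι : ∀ j, ∀ q ∈ 𝒦 j, ι q ∈ freeGrading 𝒜 deg j) (hιi : Function.Injective ι)
    (hιφ : Function.Exact ι φ) (j : ℤ) :
    FiniteDimensional k (F.torGrading 𝒩 0 j) ∧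
    ((∀ b, ℳ (j - deg b) = ⊥) → F.torGrading 𝒩 0 j = ⊥) ∧
    (∀ i, FiniteDimensional k (F.torGrading 𝒦 i j) →
      FiniteDimensional k (F.torGrading 𝒩 (i + 1) j)) ∧
    (∀ i, F.torGrading 𝒦 i j = ⊥ → F.torGrading 𝒩 (i + 1) j = ⊥) ∧
    (∀ i, Module.finrank k (F.torGrading 𝒩 (i + 2) j) =
      Module.finrank k (F.torGrading 𝒦 (i + 1) j)) ∧
    (FiniteDimensional k (F.torGrading 𝒦 0 j) →
      Module.finrank k (F.torGrading 𝒩 0 j) + Module.finrank k (F.torGrading 𝒦 0 j) =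
        ∑ b, Module.finrank k (ℳ (j - deg b)) + Module.finrank k (F.torGrading 𝒩 1 j)) := by
  obtain ⟨ψ, h1, ⟨e0⟩⟩ := exists_homology_maps F h𝒩 hφs hφ h𝒦 hι hιi hιφ j
  obtain ⟨eG⟩ := torGrading_free_zero F hℳ deg j
  have hG : FiniteDimensional k (F.torGrading (freeGrading 𝒜 deg) 0 j) :=
    Module.Finite.equiv eG.symm
  refine ⟨Module.Finite.equiv e0, fun hb => ?_, fun i hi => ?_, fun i hi => ?_, fun i => ?_,
    fun hK => ?_⟩
  · have : ∀ b, Subsingleton (ℳ (j - deg b)) := fun b => by rw [hb b]; infer_instance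
    have : Subsingleton (F.torGrading (freeGrading 𝒜 deg) 0 j) := eG.toEquiv.subsingleton
    have : Subsingleton (F.torGrading 𝒩 0 j) := e0.symm.toEquiv.subsingleton
    exact (Submodule.subsingleton_iff_eq_bot).1 this
  · obtain ⟨e⟩ := h1 i
    exact Module.Finite.equiv e.symm
  · obtain ⟨e⟩ := h1 i
    have : Subsingleton (F.torGrading 𝒦 i j) := by rw [hi]; infer_instance
    have : Subsingleton (F.torGrading 𝒩 (i + 1) j) := e.toEquiv.subsingleton
    exact (Submodule.subsingleton_iff_eq_bot).1 this
  · obtain ⟨e⟩ := h1 (i + 1)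
    have := torGrading_free_succ F deg i j
    have h2 : LinearMap.ker (ψ (i + 1)) = ⊤ := by
      rw [LinearMap.ker_eq_top]
      exact LinearMap.ext fun z => Subsingleton.elim _ _
    rw [e.finrank_eq, h2, finrank_top]
  · obtain ⟨e⟩ := h1 0
    have h2 := LinearMap.finrank_range_add_finrank_ker (ψ 0)
    have h3 := Submodule.finrank_quotient_add_finrank (LinearMap.range (ψ 0))
    rw [e0.finrank_eq, eG.finrank_eq, Module.finrank_pi_fintype] at h3
    rw [← h2, e.finrank_eq, ← h3]
    ring

end shift

/-! ### The Euler characteristic of `Tor` -/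

section euler

variable {k : Type u} {R : Type v} [Field k] [CommRing R] [Algebra k R]
  {𝒜 : ℕ → Submodule k R}

/-- A short exact sequence `0 → K → ⨁_{b ∈ B} R(-deg b) → N → 0` of graded modules, with `B` finite
and `deg b ≥ c` for all `b`, in which `K` is finitely generated and vanishes below degree `c + 1`.
-/
structure FreeCover (𝒜 : ℕ → Submodule k R) {N : Type y} [AddCommGroup N] [Module k N] [Module R N]
    (𝒩 : ℤ → Submodule k N) (c : ℤ) where
  /-- the index set of the basis -/
  B : Type
  [fintype : Fintype B]
  [decidableEq : DecidableEq B]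
  /-- the degrees of the basis vectors -/
  deg : B → ℤ
  le_deg : ∀ b, c ≤ deg b
  /-- the surjection onto `N` -/
  φ : (B →₀ R) →ₗ[R] N
  φ_surjective : Function.Surjective φ
  φ_mem : ∀ j, ∀ p ∈ freeGrading 𝒜 deg j, φ p ∈ 𝒩 j
  /-- the kernel -/
  K : Type v
  [addCommGroup : AddCommGroup K]
  [moduleBase : Module k K]
  [module : Module R K]
  [isScalarTower : IsScalarTower k R K]
  [finite : Module.Finite R K]
  /-- the grading of the kernel -/
  grading : ℤ → Submodule k K
  isGradedModule : IsGradedModule 𝒜 grading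
  grading_eq_bot : ∀ j < c + 1, grading j = ⊥
  /-- the inclusion of the kernel -/
  ι : K →ₗ[R] (B →₀ R)
  ι_mem : ∀ j, ∀ q ∈ grading j, ι q ∈ freeGrading 𝒜 deg j
  ι_injective : Function.Injective ι
  exact : Function.Exact ι φ

attribute [instance] FreeCover.fintype FreeCover.decidableEq FreeCover.addCommGroup
  FreeCover.moduleBase FreeCover.module FreeCover.isScalarTower FreeCover.finite

theorem nonempty_freeCover [GradedAlgebra 𝒜] [Algebra.FiniteType k R] (h𝒜 : 𝒜 0 = 1)
    {N : Type y} [AddCommGroup N] [Module k N] [Module R N] [IsScalarTower k R N]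
    [Module.Finite R N] {𝒩 : ℤ → Submodule k N} (h𝒩 : IsGradedModule 𝒜 𝒩) {c : ℤ}
    (hc : ∀ j < c, 𝒩 j = ⊥) : Nonempty (FreeCover 𝒜 𝒩 c) := by
  obtain ⟨B, _, _, deg, φ, hdeg, hφs, hφ, hK⟩ := exists_free_cover h𝒜 h𝒩 hc
  have hR : IsNoetherianRing R := Algebra.FiniteType.isNoetherianRing k R
  exact ⟨{
    B := B
    deg := deg
    le_deg := hdeg
    φ := φ
    φ_surjective := hφs
    φ_mem := hφ
    K := LinearMap.ker φ
    grading := subGrading (freeGrading 𝒜 deg) (LinearMap.ker φ)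
    isGradedModule := isGradedModule_subGrading (isGradedModule_freeGrading 𝒜 deg) _
      fun j m hm => by
        have h1 := gcomp_map_zero (isGradedModule_freeGrading 𝒜 deg).isInternal h𝒩.isInternal
          (φ.restrictScalars k) hφ j m
        have h2 : φ m = 0 := hm
        have h3 : φ (gcomp (isGradedModule_freeGrading 𝒜 deg).isInternal j m) =
          gcomp h𝒩.isInternal j (φ m) := h1.symm
        rw [LinearMap.mem_ker, h3, h2, map_zero]
    grading_eq_bot := hK
    ι := (LinearMap.ker φ).subtype
    ι_mem := fun _ _ hq => hq
    ι_injective := Submodule.injective_subtype _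
    exact := LinearMap.exact_subtype_ker_map φ }⟩

theorem finrank_add_finrank_of_ker_eq_range {A B C : Type*} [AddCommGroup A] [Module k A]
    [AddCommGroup B] [Module k B] [FiniteDimensional k B] [AddCommGroup C] [Module k C]
    {f : A →ₗ[k] B} {g : B →ₗ[k] C} (hf : Function.Injective f) (hg : Function.Surjective g)
    (h : LinearMap.ker g = LinearMap.range f) :
    Module.finrank k C + Module.finrank k A = Module.finrank k B := by
  rw [← LinearMap.finrank_range_add_finrank_ker g, LinearMap.range_eq_top.2 hg, finrank_top, h,
    LinearMap.finrank_range_of_inj hf]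

namespace FreeCover

variable {N : Type y} [AddCommGroup N] [Module k N] [Module R N] [IsScalarTower k R N]
  {𝒩 : ℤ → Submodule k N} {c : ℤ} (S : FreeCover 𝒜 𝒩 c)

/-- The Laurent polynomial `∑_b t ^ (deg b)`. -/
def degSeries : LaurentSeries ℚ := ∑ b, HahnSeries.single (S.deg b) 1

omit [IsScalarTower k R N] in
theorem coeff_mul_degSeries (f : LaurentSeries ℚ) (j : ℤ) :
    (f * S.degSeries).coeff j = ∑ b, f.coeff (j - S.deg b) := by
  rw [degSeries, Finset.mul_sum, HahnSeries.coeff_sum]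
  exact Finset.sum_congr rfl fun b _ => by rw [HahnSeries.coeff_mul_single, mul_one]

theorem finrank_add_finrank [GradedAlgebra 𝒜] (h𝒩 : IsGradedModule 𝒜 𝒩)
    (hfin : ∀ j, FiniteDimensional k (intGrading 𝒜 j)) (j : ℤ) :
    Module.finrank k (𝒩 j) + Module.finrank k (S.grading j) =
      ∑ b, Module.finrank k (intGrading 𝒜 (j - S.deg b)) := by
  let e : freeGrading 𝒜 S.deg j ≃ₗ[k] ((b : S.B) → intGrading 𝒜 (j - S.deg b)) :=
    { toFun := fun p b => ⟨p.1 b, p.2 b⟩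
      map_add' := fun _ _ => rfl
      map_smul' := fun _ _ => rfl
      invFun := fun p => ⟨Finsupp.equivFunOnFinite.symm fun b => p b, fun b => (p b).2⟩
      left_inv := fun p => Subtype.ext (Finsupp.ext fun b => rfl)
      right_inv := fun p => rfl }
  have hfree : FiniteDimensional k (freeGrading 𝒜 S.deg j) := Module.Finite.equiv e.symm
  let f : S.grading j →ₗ[k] freeGrading 𝒜 S.deg j := (S.ι.restrictScalars k).restrict (S.ι_mem j)
  let g : freeGrading 𝒜 S.deg j →ₗ[k] 𝒩 j := (S.φ.restrictScalars k).restrict (S.φ_mem j)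
  have hf : Function.Injective f := fun a b hab =>
    Subtype.ext (S.ι_injective (congrArg Subtype.val hab))
  have hg : Function.Surjective g := fun n => by
    obtain ⟨p, hp, hpn⟩ := exists_homogeneous_preimage
      (isGradedModule_freeGrading 𝒜 S.deg).isInternal h𝒩.isInternal (S.φ.restrictScalars k)
      S.φ_mem n.2 (S.φ_surjective _)
    exact ⟨⟨p, hp⟩, Subtype.ext hpn⟩
  have hker : LinearMap.ker g = LinearMap.range f := by
    ext p
    constructor
    · intro hp
      obtain ⟨q, hq, hqp⟩ := exists_homogeneous_preimage S.isGradedModule.isInternal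
        (isGradedModule_freeGrading 𝒜 S.deg).isInternal (S.ι.restrictScalars k) S.ι_mem p.2
        ((S.exact _).1 (congrArg Subtype.val hp))
      exact ⟨⟨q, hq⟩, Subtype.ext hqp⟩
    · rintro ⟨q, rfl⟩
      exact Subtype.ext (S.exact.apply_apply_eq_zero q.1)
  rw [← Module.finrank_pi_fintype, ← e.finrank_eq]
  exact finrank_add_finrank_of_ker_eq_range (A := S.grading j) (B := freeGrading 𝒜 S.deg j)
    (C := 𝒩 j) (f := f) (g := g) hf hg hker

end FreeCover

variable [GradedAlgebra 𝒜] [Algebra.FiniteType k R]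
  {M : Type w} [AddCommGroup M] [Module k M] [Module R M] [IsScalarTower k R M] [Module.Finite R M]
  {ℳ : ℤ → Submodule k M} (F : GradedResolution.{u, v, w, x} 𝒜 ℳ)

/-- The case of `torGrading_finite_and_eq_bot` in which `N` lies in the universe of `R`, as the
kernels in free covers do; the universe is fixed during the induction on `i`. -/
theorem torGrading_finite_and_eq_bot_aux (h𝒜 : 𝒜 0 = 1) (hℳ : IsGradedModule 𝒜 ℳ) {c₀ : ℤ}
    (hc₀ : ∀ j < c₀, ℳ j = ⊥) (i : ℕ) :
    ∀ (N : Type v) [AddCommGroup N] [Module k N] [Module R N] [IsScalarTower k R N]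
      [Module.Finite R N] (𝒩 : ℤ → Submodule k N) (_ : IsGradedModule 𝒜 𝒩) (c : ℤ)
      (_ : ∀ j < c, 𝒩 j = ⊥) (j : ℤ),
    FiniteDimensional k (F.torGrading 𝒩 i j) ∧ (j < c₀ + c + i → F.torGrading 𝒩 i j = ⊥) := by
  induction i with
  | zero =>
    intro N _ _ _ _ _ 𝒩 h𝒩 c hc j
    obtain ⟨S⟩ := nonempty_freeCover h𝒜 h𝒩 hc
    obtain ⟨h1, h2, -⟩ := torGrading_step F hℳ (finiteDimensional_graded h𝒜 hℳ) h𝒩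
      S.φ_surjective S.φ_mem S.isGradedModule S.ι_mem S.ι_injective S.exact j
    exact ⟨h1, fun hj => h2 fun b => hc₀ _ (by have := S.le_deg b; push_cast at hj; omega)⟩
  | succ i ih =>
    intro N _ _ _ _ _ 𝒩 h𝒩 c hc j
    obtain ⟨S⟩ := nonempty_freeCover h𝒜 h𝒩 hc
    obtain ⟨-, -, h1, h2, -⟩ := torGrading_step F hℳ (finiteDimensional_graded h𝒜 hℳ) h𝒩
      S.φ_surjective S.φ_mem S.isGradedModule S.ι_mem S.ι_injective S.exact j
    obtain ⟨h3, h4⟩ := ih S.K S.grading S.isGradedModule (c + 1) S.grading_eq_bot j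
    exact ⟨h1 i h3, fun hj => h2 i (h4 (by push_cast at hj; omega))⟩

/-- The graded pieces of `Tor_i(M, N)` are finite-dimensional, and vanish in degrees smaller than
`i` plus the sum of the initial degrees of `M` and `N`. -/
theorem torGrading_finite_and_eq_bot (h𝒜 : 𝒜 0 = 1) (hℳ : IsGradedModule 𝒜 ℳ) {c₀ : ℤ}
    (hc₀ : ∀ j < c₀, ℳ j = ⊥) {N : Type y} [AddCommGroup N] [Module k N] [Module R N]
    [IsScalarTower k R N] [Module.Finite R N] {𝒩 : ℤ → Submodule k N}
    (h𝒩 : IsGradedModule 𝒜 𝒩) {c : ℤ} (hc : ∀ j < c, 𝒩 j = ⊥) (i : ℕ) (j : ℤ) :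
    FiniteDimensional k (F.torGrading 𝒩 i j) ∧ (j < c₀ + c + i → F.torGrading 𝒩 i j = ⊥) := by
  obtain ⟨S⟩ := nonempty_freeCover h𝒜 h𝒩 hc
  obtain ⟨h1, h2, h3, h4, -⟩ := torGrading_step F hℳ (finiteDimensional_graded h𝒜 hℳ) h𝒩
      S.φ_surjective S.φ_mem S.isGradedModule S.ι_mem S.ι_injective S.exact j
  cases i with
  | zero =>
    exact ⟨h1, fun hj => h2 fun b => hc₀ _ (by have := S.le_deg b; push_cast at hj; omega)⟩
  | succ i =>
    obtain ⟨h5, h6⟩ := torGrading_finite_and_eq_bot_aux F h𝒜 hℳ hc₀ i S.K S.grading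
      S.isGradedModule (c + 1) S.grading_eq_bot j
    exact ⟨h3 i h5, fun hj => h4 i (h6 (by push_cast at hj; omega))⟩

omit [GradedAlgebra 𝒜] [Algebra.FiniteType k R] [IsScalarTower k R M] [Module.Finite R M] in
theorem chiCoeff_eq_sum {N : Type y} [AddCommGroup N] [Module k N] [Module R N]
    [IsScalarTower k R N] {𝒩 : ℤ → Submodule k N} {j : ℤ} {n : ℕ}
    (h : ∀ i, n ≤ i → F.torGrading 𝒩 i j = ⊥) :
    chiCoeff F 𝒩 j =
      ∑ i ∈ Finset.range n, (-1) ^ i * (Module.finrank k (F.torGrading 𝒩 i j) : ℤ) := by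
  refine finsum_eq_sum_of_support_subset _ fun i hi => ?_
  by_contra hn
  refine hi ?_
  change (-1) ^ i * (Module.finrank k (F.torGrading 𝒩 i j) : ℤ) = 0
  rw [h i (by simpa using hn)]
  simp

/-- The series `χ(M, N)(t)`. -/
def chiSeries {N : Type y} [AddCommGroup N] [Module k N] [Module R N]
    [IsScalarTower k R N] (𝒩 : ℤ → Submodule k N) : LaurentSeries ℚ :=
  laurentOf fun j => chiCoeff F 𝒩 j

theorem chiCoeff_eq_zero (h𝒜 : 𝒜 0 = 1) (hℳ : IsGradedModule 𝒜 ℳ) {c₀ : ℤ}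
    (hc₀ : ∀ j < c₀, ℳ j = ⊥) {N : Type y} [AddCommGroup N] [Module k N] [Module R N]
    [IsScalarTower k R N] [Module.Finite R N] {𝒩 : ℤ → Submodule k N}
    (h𝒩 : IsGradedModule 𝒜 𝒩) {c : ℤ} (hc : ∀ j < c, 𝒩 j = ⊥) {j : ℤ} (hj : j < c₀ + c) :
    chiCoeff F 𝒩 j = 0 := by
  rw [chiCoeff_eq_sum F (n := 0) fun i _ =>
    (torGrading_finite_and_eq_bot F h𝒜 hℳ hc₀ h𝒩 hc i j).2 (by omega)]
  rfl

theorem coeff_chiSeries (h𝒜 : 𝒜 0 = 1) (hℳ : IsGradedModule 𝒜 ℳ)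
    {N : Type y} [AddCommGroup N] [Module k N] [Module R N]
    [IsScalarTower k R N] [Module.Finite R N] {𝒩 : ℤ → Submodule k N}
    (h𝒩 : IsGradedModule 𝒜 𝒩) (j : ℤ) : (chiSeries F 𝒩).coeff j = chiCoeff F 𝒩 j := by
  obtain ⟨c₀, hc₀⟩ := exists_bddBelow hℳ
  obtain ⟨c, hc⟩ := exists_bddBelow h𝒩
  exact coeff_laurentOf ⟨c₀ + c, fun j hj => by
    rw [chiCoeff_eq_zero F h𝒜 hℳ hc₀ h𝒩 hc hj, Int.cast_zero]⟩ j

/-- Along a free cover, `χ(M, N) + χ(M, K) = HS_M ∑_b t ^ (deg b)`. -/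
theorem chiSeries_add (h𝒜 : 𝒜 0 = 1) (hℳ : IsGradedModule 𝒜 ℳ)
    {N : Type y} [AddCommGroup N] [Module k N] [Module R N]
    [IsScalarTower k R N] [Module.Finite R N] {𝒩 : ℤ → Submodule k N}
    (h𝒩 : IsGradedModule 𝒜 𝒩) {c : ℤ} (hc : ∀ j < c, 𝒩 j = ⊥) (S : FreeCover 𝒜 𝒩 c) :
    chiSeries F 𝒩 + chiSeries F S.grading = hilbertSeries ℳ * S.degSeries := by
  obtain ⟨c₀, hc₀⟩ := exists_bddBelow hℳ
  ext j
  rw [HahnSeries.coeff_add, coeff_chiSeries F h𝒜 hℳ h𝒩, coeff_chiSeries F h𝒜 hℳ S.isGradedModule,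
    S.coeff_mul_degSeries]
  simp only [coeff_hilbertSeries ⟨c₀, hc₀⟩]
  obtain ⟨-, -, -, -, h5, h6⟩ := torGrading_step F hℳ (finiteDimensional_graded h𝒜 hℳ) h𝒩
      S.φ_surjective S.φ_mem S.isGradedModule S.ι_mem S.ι_injective S.exact j
  have hK := torGrading_finite_and_eq_bot F h𝒜 hℳ hc₀ S.isGradedModule S.grading_eq_bot
  have hN := torGrading_finite_and_eq_bot F h𝒜 hℳ hc₀ h𝒩 hc
  set n := (j - c₀ - c).toNat + 1
  have h6' := h6 (hK 0 j).1
  rw [chiCoeff_eq_sum F (n := n + 2) fun i hi => (hN i j).2 (by omega),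
    chiCoeff_eq_sum F (n := n + 1) fun i hi => (hK i j).2 (by omega),
    Finset.sum_range_succ', Finset.sum_range_succ', Finset.sum_range_succ' _ n]
  simp only [h5]
  have h7 : ∑ i ∈ Finset.range n, (-1 : ℤ) ^ (i + 1 + 1) *
      (Module.finrank k (F.torGrading S.grading (i + 1) j) : ℤ) =
      - ∑ i ∈ Finset.range n, (-1 : ℤ) ^ (i + 1) *
        (Module.finrank k (F.torGrading S.grading (i + 1) j) : ℤ) := by
    rw [← Finset.sum_neg_distrib]
    exact Finset.sum_congr rfl fun i _ => by ring
  rw [h7]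
  have h8 : (Module.finrank k (F.torGrading 𝒩 0 j) : ℚ) +
      Module.finrank k (F.torGrading S.grading 0 j) =
      ∑ b, (Module.finrank k (ℳ (j - S.deg b)) : ℚ) + Module.finrank k (F.torGrading 𝒩 1 j) := by
    exact_mod_cast h6'
  push_cast
  linarith

omit [GradedAlgebra 𝒜] [Algebra.FiniteType k R] in
theorem exists_intGrading_bddBelow : ∃ c : ℤ, ∀ j < c, intGrading 𝒜 j = ⊥ :=
  ⟨0, fun j hj => by
    obtain ⟨n, rfl⟩ := Int.eq_negSucc_of_lt_zero hj
    rfl⟩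

/-- Along a free cover, `HS_N + HS_K = HS_R ∑_b t ^ (deg b)`. -/
theorem hilbertSeries_add (h𝒜 : 𝒜 0 = 1)
    {N : Type y} [AddCommGroup N] [Module k N] [Module R N]
    [IsScalarTower k R N] {𝒩 : ℤ → Submodule k N}
    (h𝒩 : IsGradedModule 𝒜 𝒩) {c : ℤ} (hc : ∀ j < c, 𝒩 j = ⊥) (S : FreeCover 𝒜 𝒩 c) :
    hilbertSeries 𝒩 + hilbertSeries S.grading =
      hilbertSeries (intGrading 𝒜) * S.degSeries := by
  ext j
  rw [HahnSeries.coeff_add, coeff_hilbertSeries ⟨c, hc⟩, coeff_hilbertSeries ⟨_, S.grading_eq_bot⟩,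
    S.coeff_mul_degSeries]
  simp only [coeff_hilbertSeries (exists_intGrading_bddBelow (𝒜 := 𝒜))]
  exact_mod_cast S.finrank_add_finrank h𝒩
    (finiteDimensional_graded h𝒜 (isGradedModule_intGrading 𝒜)) j

theorem coeff_mul_eq_zero {f g : LaurentSeries ℚ} {a b : ℤ} (hf : ∀ i < a, f.coeff i = 0)
    (hg : ∀ i < b, g.coeff i = 0) {j : ℤ} (hj : j < a + b) : (f * g).coeff j = 0 := by
  rw [HahnSeries.coeff_mul]
  refine Finset.sum_eq_zero fun p hp => ?_
  rw [Finset.mem_antidiagonal] at hp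
  by_cases h : p.1 < a
  · rw [hf _ h, zero_mul]
  · rw [hg p.2 (by omega), mul_zero]

/-- The difference `HS_R χ(M, N) - HS_M HS_N`. -/
def defect {N : Type y} [AddCommGroup N] [Module k N] [Module R N]
    [IsScalarTower k R N] (𝒩 : ℤ → Submodule k N) : LaurentSeries ℚ :=
  hilbertSeries (intGrading 𝒜) * chiSeries F 𝒩 - hilbertSeries ℳ * hilbertSeries 𝒩

theorem defect_eq_neg (h𝒜 : 𝒜 0 = 1) (hℳ : IsGradedModule 𝒜 ℳ)
    {N : Type y} [AddCommGroup N] [Module k N] [Module R N]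
    [IsScalarTower k R N] [Module.Finite R N] {𝒩 : ℤ → Submodule k N}
    (h𝒩 : IsGradedModule 𝒜 𝒩) {c : ℤ} (hc : ∀ j < c, 𝒩 j = ⊥) (S : FreeCover 𝒜 𝒩 c) :
    defect F 𝒩 = - defect F S.grading := by
  have h1 := chiSeries_add F h𝒜 hℳ h𝒩 hc S
  have h2 := hilbertSeries_add h𝒜 h𝒩 hc S
  unfold defect
  linear_combination hilbertSeries (intGrading 𝒜) * h1 - hilbertSeries ℳ * h2

/-- The coefficients of the defect vanish below the sum of the initial degrees of `M` and `N`, and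
each passage to the kernel of a free cover raises the initial degree of `N` by one and only changes
the sign of the defect. -/
theorem coeff_defect_eq_zero (h𝒜 : 𝒜 0 = 1) (hℳ : IsGradedModule 𝒜 ℳ) {c₀ : ℤ}
    (hc₀ : ∀ j < c₀, ℳ j = ⊥) (n : ℕ) :
    ∀ (N : Type v) [AddCommGroup N] [Module k N] [Module R N] [IsScalarTower k R N]
      [Module.Finite R N] (𝒩 : ℤ → Submodule k N) (_ : IsGradedModule 𝒜 𝒩) (c : ℤ)
      (_ : ∀ j < c, 𝒩 j = ⊥) (j : ℤ) (_ : j < c₀ + c + n), (defect F 𝒩).coeff j = 0 := by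
  induction n with
  | zero =>
    intro N _ _ _ _ _ 𝒩 h𝒩 c hc j hj
    rw [Nat.cast_zero, add_zero] at hj
    have h1 : ∀ i < (0 : ℤ), (hilbertSeries (intGrading 𝒜)).coeff i = 0 := fun i hi => by
      obtain ⟨n, rfl⟩ := Int.eq_negSucc_of_lt_zero hi
      rw [coeff_hilbertSeries exists_intGrading_bddBelow]
      change ((Module.finrank k (⊥ : Submodule k R) : ℕ) : ℚ) = 0
      rw [finrank_bot, Nat.cast_zero]
    have h2 : ∀ i < c₀, (hilbertSeries ℳ).coeff i = 0 := fun i hi => by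
      rw [coeff_hilbertSeries ⟨c₀, hc₀⟩, hc₀ i hi]; simp
    have h3 : ∀ i < c, (hilbertSeries 𝒩).coeff i = 0 := fun i hi => by
      rw [coeff_hilbertSeries ⟨c, hc⟩, hc i hi]; simp
    have h4 : ∀ i < c₀ + c, (chiSeries F 𝒩).coeff i = 0 := fun i hi => by
      rw [coeff_chiSeries F h𝒜 hℳ h𝒩, chiCoeff_eq_zero F h𝒜 hℳ hc₀ h𝒩 hc hi, Int.cast_zero]
    rw [defect, HahnSeries.coeff_sub, coeff_mul_eq_zero h1 h4 (by omega),
      coeff_mul_eq_zero h2 h3 hj, sub_zero]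
  | succ n ih =>
    intro N _ _ _ _ _ 𝒩 h𝒩 c hc j hj
    obtain ⟨S⟩ := nonempty_freeCover h𝒜 h𝒩 hc
    rw [defect_eq_neg F h𝒜 hℳ h𝒩 hc S, HahnSeries.coeff_neg,
      ih S.K S.grading S.isGradedModule (c + 1) S.grading_eq_bot j (by push_cast at hj; omega),
      neg_zero]

/-- The identity `HS_R χ(M, N) = HS_M HS_N`. -/
theorem hilbertSeries_mul_chiSeries (h𝒜 : 𝒜 0 = 1) (hℳ : IsGradedModule 𝒜 ℳ)
    {N : Type y} [AddCommGroup N] [Module k N] [Module R N]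
    [IsScalarTower k R N] [Module.Finite R N] {𝒩 : ℤ → Submodule k N}
    (h𝒩 : IsGradedModule 𝒜 𝒩) :
    hilbertSeries (intGrading 𝒜) * chiSeries F 𝒩 = hilbertSeries ℳ * hilbertSeries 𝒩 := by
  obtain ⟨c₀, hc₀⟩ := exists_bddBelow hℳ
  obtain ⟨c, hc⟩ := exists_bddBelow h𝒩
  obtain ⟨S⟩ := nonempty_freeCover h𝒜 h𝒩 hc
  have h1 : defect F S.grading = 0 := by
    ext j
    exact coeff_defect_eq_zero F h𝒜 hℳ hc₀ (j - c₀ - c).toNat S.K S.grading S.isGradedModule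
      (c + 1) S.grading_eq_bot j (by omega)
  have h2 := defect_eq_neg F h𝒜 hℳ h𝒩 hc S
  rw [h1, neg_zero] at h2
  exact sub_eq_zero.1 h2

end euler

/-! ### Rational functions and their values at `1` -/

section value

open Polynomial

open scoped RatFunc in
/-- The expansion of a rational function at `0`. -/
def ratFuncToLaurent (K : Type*) [Field K] : RatFunc K →+* LaurentSeries K :=
  algebraMap (RatFunc K) (LaurentSeries K)

theorem ratFuncToLaurent_algebraMap (p : ℚ[X]) :
    ratFuncToLaurent ℚ (algebraMap ℚ[X] (RatFunc ℚ) p) = toLaurent p :=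
  (RatFunc.coe_coe p).symm

theorem isExpansion_iff {f : RatFunc ℚ} {c : ℤ → ℤ} {g : LaurentSeries ℚ}
    (hg : ∀ j, g.coeff j = c j) : IsExpansion f c ↔ ratFuncToLaurent ℚ f = g := by
  constructor
  · intro h
    ext j
    exact (h j).trans (hg j).symm
  · rintro rfl j
    exact hg j

/-- The values at `1` of the reduced fraction and of any other fraction representing `f` are
proportional. -/
theorem eval_mul_eval {p q : ℚ[X]} (hq : q ≠ 0) {f : RatFunc ℚ}
    (hf : f * algebraMap ℚ[X] (RatFunc ℚ) q = algebraMap ℚ[X] (RatFunc ℚ) p) :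
    f.num.eval 1 * q.eval 1 = p.eval 1 * f.denom.eval 1 := by
  have h1 : f.num * q = p * f.denom := by
    rw [RatFunc.num_mul_eq_mul_denom_iff hq, ← hf, mul_div_cancel_right₀]
    exact RatFunc.algebraMap_ne_zero hq
  have := congrArg (eval 1) h1
  rwa [eval_mul, eval_mul] at this

theorem valueAtOne_eq_of_ne_zero {p q : ℚ[X]} (hq : q.eval 1 ≠ 0) {f : RatFunc ℚ}
    (hf : f * algebraMap ℚ[X] (RatFunc ℚ) q = algebraMap ℚ[X] (RatFunc ℚ) p) :
    valueAtOne f = ((p.eval 1 / q.eval 1 : ℚ) : OnePoint ℚ) := by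
  have h1 := eval_mul_eval (fun h => hq (by rw [h, eval_zero])) hf
  have hd : f.denom.eval 1 ≠ 0 := by
    intro hd
    rw [hd, mul_zero] at h1
    have hn : f.num.eval 1 = 0 := (mul_eq_zero.1 h1).resolve_right hq
    obtain ⟨a, b, hab⟩ := f.isCoprime_num_denom
    have := congrArg (eval 1) hab
    simp [hd, hn] at this
  rw [valueAtOne, if_neg hd]
  congr 1
  rw [div_eq_div_iff hd hq, h1]

theorem valueAtOne_eq_infty {p q : ℚ[X]} (hq0 : q ≠ 0) (hq : q.eval 1 = 0) (hp : p.eval 1 ≠ 0)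
    {f : RatFunc ℚ}
    (hf : f * algebraMap ℚ[X] (RatFunc ℚ) q = algebraMap ℚ[X] (RatFunc ℚ) p) :
    valueAtOne f = OnePoint.infty := by
  have h1 := eval_mul_eval hq0 hf
  rw [hq, mul_zero] at h1
  rw [valueAtOne, if_pos ((mul_eq_zero.1 h1.symm).resolve_left hp)]

/-- Three implications with exclusive conclusions and exhaustive, exclusive hypotheses are
equivalences. -/
theorem trichotomy_iff {f : RatFunc ℚ} {d e : WithBot ℕ∞}
    (h1 : d < e → valueAtOne f = OnePoint.infty)
    (h2 : e = d → ∃ q : ℚ, 0 < q ∧ valueAtOne f = (q : OnePoint ℚ))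
    (h3 : e < d → valueAtOne f = ((0 : ℚ) : OnePoint ℚ)) :
    (valueAtOne f = OnePoint.infty ↔ d < e) ∧
    ((∃ q : ℚ, 0 < q ∧ valueAtOne f = (q : OnePoint ℚ)) ↔ e = d) ∧
    (valueAtOne f = ((0 : ℚ) : OnePoint ℚ) ↔ e < d) := by
  rcases lt_trichotomy d e with h | h | h
  · rw [h1 h]
    simp [h, h.ne', h.not_gt]
  · obtain ⟨q, hq, hv⟩ := h2 h.symm
    rw [hv]
    have : ¬ ((q : OnePoint ℚ) = ((0 : ℚ) : OnePoint ℚ)) := fun h0 =>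
      hq.ne' (OnePoint.coe_injective h0)
    subst h
    simp only [OnePoint.coe_ne_infty, lt_self_iff_false, this, true_and, iff_true, and_true,
      iff_self]
    exact ⟨q, hq, rfl⟩
  · rw [h3 h]
    simp [h, h.ne, h.not_gt]

end value

theorem hilbertSeries_eq_zero {k : Type u} [Field k] {V : Type v} [AddCommGroup V] [Module k V]
    [Subsingleton V] (𝒱 : ℤ → Submodule k V) : hilbertSeries 𝒱 = 0 := by
  have h : ∀ j, 𝒱 j = ⊥ := fun j => by
    rw [eq_bot_iff]
    exact fun x _ => (Submodule.mem_bot k).2 (Subsingleton.elim x 0)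
  ext j
  rw [coeff_hilbertSeries ⟨0, fun j _ => h j⟩, h j, finrank_bot, Nat.cast_zero,
    HahnSeries.coeff_zero]

/-- The rational function with expansion `HS_M HS_N / HS_R`, and its value at `1`. -/
theorem exists_ratFunc {k : Type u} {R : Type v} {M : Type w} {N : Type y}
    [Field k] [CommRing R] [Nontrivial R] [Algebra k R] [Algebra.FiniteType k R]
    {𝒜 : ℕ → Submodule k R} [GradedAlgebra 𝒜] (h𝒜 : 𝒜 0 = 1)
    [AddCommGroup M] [Module k M] [Module R M] [IsScalarTower k R M] [Module.Finite R M]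
    {ℳ : ℤ → Submodule k M} (hℳ : IsGradedModule 𝒜 ℳ)
    [AddCommGroup N] [Module k N] [Module R N] [IsScalarTower k R N] [Module.Finite R N]
    {𝒩 : ℤ → Submodule k N} (h𝒩 : IsGradedModule 𝒜 𝒩) :
    hilbertSeries (intGrading 𝒜) ≠ 0 ∧
    ∃ f : RatFunc ℚ,
      hilbertSeries (intGrading 𝒜) * ratFuncToLaurent ℚ f = hilbertSeries ℳ * hilbertSeries 𝒩 ∧
      (ringKrullDim R < Module.supportDim R M + Module.supportDim R N →
        valueAtOne f = OnePoint.infty) ∧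
      (Module.supportDim R M + Module.supportDim R N = ringKrullDim R →
        ∃ q : ℚ, 0 < q ∧ valueAtOne f = (q : OnePoint ℚ)) ∧
      (Module.supportDim R M + Module.supportDim R N < ringKrullDim R →
        valueAtOne f = ((0 : ℚ) : OnePoint ℚ)) := by
  obtain ⟨r, P, Q, hr, hP, hQ, hPQ⟩ := hilbertSeries_pole h𝒜 (isGradedModule_intGrading 𝒜)
  rw [Module.supportDim_self_eq_ringKrullDim] at hr
  have hinj : Function.Injective toLaurent := fun a b hab => by
    rw [← ratFuncToLaurent_algebraMap, ← ratFuncToLaurent_algebraMap] at hab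
    exact RatFunc.algebraMap_injective ℚ ((ratFuncToLaurent ℚ).injective hab)
  have hne : ∀ p : Polynomial ℚ, 0 < p.eval 1 → p ≠ 0 := fun p hp h => by simp [h] at hp
  have hX : (1 - Polynomial.X : Polynomial ℚ) ≠ 0 := fun h => by
    simpa using congrArg (Polynomial.eval 0) h
  have hR0 : hilbertSeries (intGrading 𝒜) ≠ 0 := fun h => by
    rw [h, mul_zero] at hPQ
    exact hne P hP (hinj (by rw [← hPQ, map_zero]))
  refine ⟨hR0, ?_⟩
  have hbot : Module.supportDim R M + Module.supportDim R N = ⊥ →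
      hilbertSeries ℳ * hilbertSeries 𝒩 = 0 → ∃ f : RatFunc ℚ,
      hilbertSeries (intGrading 𝒜) * ratFuncToLaurent ℚ f = hilbertSeries ℳ * hilbertSeries 𝒩 ∧
      (ringKrullDim R < Module.supportDim R M + Module.supportDim R N →
        valueAtOne f = OnePoint.infty) ∧
      (Module.supportDim R M + Module.supportDim R N = ringKrullDim R →
        ∃ q : ℚ, 0 < q ∧ valueAtOne f = (q : OnePoint ℚ)) ∧
      (Module.supportDim R M + Module.supportDim R N < ringKrullDim R →
        valueAtOne f = ((0 : ℚ) : OnePoint ℚ)) := by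
    intro h1 h2
    rw [h1, h2]
    refine ⟨0, by simp, fun h => absurd h not_lt_bot, fun h => ?_, fun _ => ?_⟩
    · rw [hr] at h
      exact absurd h.symm (WithBot.coe_ne_bot (a := ((r : ℕ∞))))
    · rw [valueAtOne_eq_of_ne_zero (p := 0) (q := 1) (by simp) (by simp)]
      simp
  rcases subsingleton_or_nontrivial M with hM | hM
  · refine hbot ?_ ?_
    · rw [Module.supportDim_eq_bot_of_subsingleton, WithBot.bot_add]
    · rw [hilbertSeries_eq_zero ℳ, zero_mul]
  rcases subsingleton_or_nontrivial N with hN | hN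
  · refine hbot ?_ ?_
    · rw [Module.supportDim_eq_bot_of_subsingleton R N, WithBot.add_bot]
    · rw [hilbertSeries_eq_zero 𝒩, mul_zero]
  obtain ⟨m, PM, QM, hm, hPM, hQM, hPQM⟩ := hilbertSeries_pole h𝒜 hℳ
  obtain ⟨n, PN, QN, hn, hPN, hQN, hPQN⟩ := hilbertSeries_pole h𝒜 h𝒩
  set V : Polynomial ℚ := QM * QN * P with hV
  set U : Polynomial ℚ := PM * PN * Q with hU
  have hV1 : 0 < V.eval 1 := by
    simp only [hV, Polynomial.eval_mul]
    positivity
  have hU1 : 0 < U.eval 1 := by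
    simp only [hU, Polynomial.eval_mul]
    positivity
  set a := algebraMap (Polynomial ℚ) (RatFunc ℚ)
  have ha : ∀ p : Polynomial ℚ, p ≠ 0 → a p ≠ 0 := fun p hp => RatFunc.algebraMap_ne_zero hp
  have hden : (1 - Polynomial.X) ^ (m + n) * V ≠ 0 := mul_ne_zero (pow_ne_zero _ hX) (hne V hV1)
  set f : RatFunc ℚ := a ((1 - Polynomial.X) ^ r * U) / a ((1 - Polynomial.X) ^ (m + n) * V)
  have hf : f * a ((1 - Polynomial.X) ^ (m + n) * V) = a ((1 - Polynomial.X) ^ r * U) :=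
    div_mul_cancel₀ _ (ha _ hden)
  have hf' : ratFuncToLaurent ℚ f * toLaurent ((1 - Polynomial.X) ^ (m + n) * V) =
      toLaurent ((1 - Polynomial.X) ^ r * U) := by
    rw [← ratFuncToLaurent_algebraMap, ← ratFuncToLaurent_algebraMap, ← map_mul, hf]
  have hdim : ∀ p q : ℕ, (p : WithBot ℕ∞) < q ↔ p < q := fun p q => by norm_cast
  have hsum : Module.supportDim R M + Module.supportDim R N = ((m + n : ℕ) : WithBot ℕ∞) := by
    rw [hm, hn, Nat.cast_add]
  rw [hsum, hr]
  have hcancel : ∀ p q : Polynomial ℚ, ∀ e : ℕ,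
      f * a ((1 - Polynomial.X) ^ e * q) = a ((1 - Polynomial.X) ^ e * p) → f * a q = a p := by
    intro p q e h
    rw [map_mul, map_mul, mul_left_comm] at h
    exact mul_left_cancel₀ (ha _ (pow_ne_zero e hX)) h
  refine ⟨f, ?_, fun h => ?_, fun h => ?_, fun h => ?_⟩
  · have hP0 : toLaurent P ≠ 0 := fun h => hne P hP (hinj (by rw [h, map_zero]))
    have hden0 : toLaurent ((1 - Polynomial.X) ^ (m + n) * V) ≠ 0 := fun h =>
      hden (hinj (by rw [h, map_zero]))
    refine mul_right_cancel₀ hden0 ?_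
    rw [mul_assoc, hf']
    simp only [hU, hV, map_mul, map_pow, pow_add] at hPQ hPQM hPQN ⊢
    rw [← hPQ, ← hPQM, ← hPQN]
    ring
  · rw [hdim] at h
    obtain ⟨e, he⟩ := Nat.exists_eq_add_of_lt h
    have h1 := hcancel U ((1 - Polynomial.X) ^ (e + 1) * V) r (by
      rw [← mul_assoc, ← pow_add, ← add_assoc, ← he, hf])
    exact valueAtOne_eq_infty (mul_ne_zero (pow_ne_zero _ hX) (hne V hV1)) (by simp) hU1.ne' h1
  · have he : m + n = r := by exact_mod_cast h
    have h1 := hcancel U V r (by rw [← hf, he])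
    exact ⟨_, div_pos hU1 hV1, valueAtOne_eq_of_ne_zero hV1.ne' h1⟩
  · rw [hdim] at h
    obtain ⟨e, he⟩ := Nat.exists_eq_add_of_lt h
    have h1 := hcancel ((1 - Polynomial.X) ^ (e + 1) * U) V (m + n) (by
      rw [hf, ← mul_assoc _ _ U, ← pow_add, ← add_assoc, ← he])
    rw [valueAtOne_eq_of_ne_zero hV1.ne' h1]
    simp

end GradedTor

end

theorem corollary1 {k : Type u} {R : Type v} {M : Type w} {N : Type y}
    [Field k] [CommRing R] [Nontrivial R] [Algebra k R] [Algebra.FiniteType k R]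
    (𝒜 : ℕ → Submodule k R) [GradedAlgebra 𝒜] (h𝒜 : 𝒜 0 = 1)
    [AddCommGroup M] [Module k M] [Module R M] [IsScalarTower k R M] [Module.Finite R M]
    (ℳ : ℤ → Submodule k M) (hℳ : GradedTor.IsGradedModule 𝒜 ℳ)
    [AddCommGroup N] [Module k N] [Module R N] [IsScalarTower k R N] [Module.Finite R N]
    (𝒩 : ℤ → Submodule k N) (h𝒩 : GradedTor.IsGradedModule 𝒜 𝒩) :
    ∃ f : RatFunc ℚ,
      -- `Tor` may be computed by any graded projective resolution of `M`
      (∀ F : GradedTor.GradedResolution.{u, v, w, max v w} 𝒜 ℳ,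
        -- the sum defining `χ(M, N)(t)` makes sense as a formal Laurent series
        (∀ i j, FiniteDimensional k (F.torGrading 𝒩 i j)) ∧
        (∀ j, {i : ℕ | F.torGrading 𝒩 i j ≠ ⊥}.Finite) ∧
        (∃ j₀ : ℤ, ∀ i, ∀ j < j₀, F.torGrading 𝒩 i j = ⊥) ∧
        -- `f` is the unique rational function with expansion `χ(M, N)(t)`
        (∀ g : RatFunc ℚ, GradedTor.IsExpansion g (GradedTor.chiCoeff F 𝒩) ↔ g = f)) ∧
      -- the three cases for its value `χ(M, N)(1)` at `t = 1`
      (GradedTor.valueAtOne f = OnePoint.infty ↔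
        ringKrullDim R < Module.supportDim R M + Module.supportDim R N) ∧
      ((∃ q : ℚ, 0 < q ∧ GradedTor.valueAtOne f = (q : OnePoint ℚ)) ↔
        Module.supportDim R M + Module.supportDim R N = ringKrullDim R) ∧
      (GradedTor.valueAtOne f = ((0 : ℚ) : OnePoint ℚ) ↔
        Module.supportDim R M + Module.supportDim R N < ringKrullDim R) := by
  obtain ⟨hR, f, hf, h1, h2, h3⟩ := GradedTor.exists_ratFunc h𝒜 hℳ h𝒩
  refine ⟨f, fun F => ?_, GradedTor.trichotomy_iff h1 h2 h3⟩
  obtain ⟨c₀, hc₀⟩ := GradedTor.exists_bddBelow hℳ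
  obtain ⟨c, hc⟩ := GradedTor.exists_bddBelow h𝒩
  have htor := GradedTor.torGrading_finite_and_eq_bot F h𝒜 hℳ hc₀ h𝒩 hc
  refine ⟨fun i j => (htor i j).1, fun j => ?_, ⟨c₀ + c, fun i j hj => (htor i j).2 (by omega)⟩,
    fun g => ?_⟩
  · refine (Set.finite_Iic (j - c₀ - c).toNat).subset fun i hi => ?_
    by_contra hn
    rw [Set.mem_Iic] at hn
    exact hi ((htor i j).2 (by omega))
  · have hχ : GradedTor.chiSeries F 𝒩 = GradedTor.ratFuncToLaurent ℚ f :=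
      mul_left_cancel₀ hR ((GradedTor.hilbertSeries_mul_chiSeries F h𝒜 hℳ h𝒩).trans hf.symm)
    rw [GradedTor.isExpansion_iff (GradedTor.coeff_chiSeries F h𝒜 hℳ h𝒩), hχ]
    exact (GradedTor.ratFuncToLaurent ℚ).injective.eq_iff
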